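/- Let $C>0$ and $V_P(r)=e^{-C/r}/r$ for $r>0$; write also $V_P$ for the operator of multiplication by $V_P(|x|)$ in $L^2(\mathbb R^3)$ with domain $\mathscr D(-\Delta)=H^2(\mathbb R^3)$, where $H^2$ carries the graph norm of $-\Delta$. For $t\in\mathbb R$ let $(u(t)f)(x)=e^{3t/2}f(e^t x)$ on $L^2(\mathbb R^3)$. An operator $V$ in $L^2(\mathbb R^3)$ belongs to the class $C_\alpha$ ($\alpha>0$) of dilatation analytic operators if (1) $\mathscr D(V)=\mathscr D(-\Delta)$ and $V$ is symmetric; (2) $V:H^2\to L^2(\mathbb R^3)$ is bounded and compact; (3) the operators $V(t)=u(t)Vu(t)^{-1}:H^2\to L^2(\mathbb R^3)$, $t\in\mathbb R$, have an analytic continuation $V(\theta)$ (in operator norm) to the strip $|\operatorname{Im}\theta|<\alpha$. **(A)** $V_P$ satisfies the following conditions with $\alpha=\pi/2$. 1. (I) $V_P$ has an analytic extension to the sector $|\arg r|<\alpha$. 2. (II) $|V_P(r)|\to0$ as $r\to\infty$ with $|\arg r|<\beta$, for every $\beta<\alpha$. 3. (III) There is $\varepsilon>0$ such that for every $\beta<\alpha$,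 $|r^{2-\varepsilon}|\,|V_P(r)|\to0$ as $r\to0$ with $|\arg r|<\beta$. Here $|r^{2-\varepsilon}|$ means $|r|^{2-\varepsilon}$. **(B)** $V_P\in C_{\pi/2}$, i.e. $V_P$ is dilatation analytic. **(C)** Let $V_P(\theta)$ be the analytic continuation of $u(t)V_Pu(t)^{-1}$ to the strip $|\operatorname{Im}\theta|<\pi/2$. For a real coupling constant $g$ (the case $g=1$ being $-\Delta+V_P$) let $H=-\Delta+gV_P$, and let $H(\theta)=e^{-2\theta}(-\Delta)+gV_P(\theta)$, with domain $H^2$, be the continuation of $u(t)Hu(t)^{-1}$; thus $H(0)=H$. The only threshold is $0$. For every $\theta$ with $|\operatorname{Im}\theta|<\pi/2$: 1. The spectrum $\sigma(H(\theta))$ is the union of the half-line $e^{-2\theta}[0,\infty)$ and of a set of points outside that half-line, each of which is isolated in $\sigma(H(\theta))$ and is an eigenvalue of finite algebraic multiplicity. 2. The real eigenvalues of $H(\theta)$ together with the threshold are exactly those of $H$: $(\sigma_p(H(\theta))\cap\mathbb R)\cup\{0\}=(\sigma_p(H)\cap\mathbb R)\cup\{0\}$, where $\sigma_p$ is the set of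 eigenvalues. 3. If $\operatorname{Im}\theta>0$, every non-real $z\in\sigma(H(\theta))\setminus e^{-2\theta}[0,\infty)$ satisfies $-2\operatorname{Im}\theta<\arg z<0$. 4. For every $z\in\sigma(H(\theta))\setminus e^{-2\theta}[0,\infty)$ there is $\delta>0$ such that $z\in\sigma(H(\theta'))$ for all $\theta'$ with $|\operatorname{Im}\theta'|<\pi/2$ and $|\operatorname{Im}\theta'-\operatorname{Im}\theta|<\delta$. -/

import Mathlib

open MeasureTheory Filter Topology
open scoped ENNReal Laplacian SchwartzMap InnerProductSpace

noncomputable section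

namespace DilationAnalytic

/-- Physical space `ℝ³`. -/
abbrev R3 : Type := EuclideanSpace ℝ (Fin 3)

/-- The complex Hilbert space `L²(ℝ³)`. -/
abbrev L2 : Type := Lp ℂ 2 (volume : Measure R3)

/-! ### The softened Coulomb potential and the conditions on a radial potential -/

/-- The radial profile `r ↦ e^{-C/r} / r` of the softened Coulomb potential. -/
def VP (C : ℝ) (r : ℝ) : ℝ := Real.exp (-C / r) / r

/-- The open sector `{r e^{iφ} : r > 0, -α < φ < α}`, for `0 < α ≤ π`. -/
def sector (α : ℝ) : Set ℂ := {z | z ≠ 0 ∧ |z.arg| < α}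

/-- The three conditions on a radial potential with profile `v`, for the sector of half-angle `α`:
(I) `v` has an analytic extension `F` to the sector; (II) `F` tends to `0` at infinity inside every
smaller sector; (III) for some `ε > 0`, `|r ^ (2 - ε)| |F r|` tends to `0` as `r → 0` inside every
smaller sector. -/
def RadialConditions (v : ℝ → ℝ) (α : ℝ) : Prop :=
  ∃ F : ℂ → ℂ,
    (AnalyticOnNhd ℂ F (sector α) ∧ ∀ r : ℝ, 0 < r → F (r : ℂ) = (v r : ℂ)) ∧
    (∀ β : ℝ, β < α → Tendsto (fun z => ‖F z‖) (Bornology.cobounded ℂ ⊓ 𝓟 (sector β)) (𝓝 0)) ∧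
    (∃ ε : ℝ, 0 < ε ∧ ∀ β : ℝ, β < α →
      Tendsto (fun z => ‖z‖ ^ (2 - ε) * ‖F z‖) (𝓝[sector β] 0) (𝓝 0))

/-! ### The Laplacian and the Sobolev space `H²` -/

/-- The Sobolev space `H² = 𝒟(-Δ)`, realised as the graph of `-Δ`: the pairs `(f, g)` of elements
of `L²(ℝ³)` with `-Δ f = g` in the sense of (tempered) distributions. Its norm, inherited from
`L² × L²`, is the graph norm. -/
def H2 : Submodule ℂ (L2 × L2) where
  carrier := {p | -(Δ (p.1 : 𝓢'(R3, ℂ))) = (p.2 : 𝓢'(R3, ℂ))}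
  zero_mem' := by
    simp only [Set.mem_ofPred_eq, Prod.fst_zero, Prod.snd_zero]
    rw [← Lp.toTemperedDistributionCLM_apply, map_zero,
      ← TemperedDistribution.laplacianCLM_apply, map_zero, neg_zero]
  add_mem' := by
    intro p q hp hq
    simp only [Set.mem_ofPred_eq, Prod.fst_add, Prod.snd_add] at *
    rw [← Lp.toTemperedDistributionCLM_apply, ← TemperedDistribution.laplacianCLM_apply] at *
    rw [← Lp.toTemperedDistributionCLM_apply] at *
    rw [map_add, map_add, map_add, neg_add, hp, hq]
  smul_mem' := by
    intro c p hp
    simp only [Set.mem_ofPred_eq, Prod.smul_fst, Prod.smul_snd] at *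
    rw [← Lp.toTemperedDistributionCLM_apply, ← TemperedDistribution.laplacianCLM_apply] at *
    rw [← Lp.toTemperedDistributionCLM_apply] at *
    rw [map_smul, map_smul, map_smul, ← smul_neg, hp]

/-- The inclusion `H² → L²`. -/
def incl : H2 →L[ℂ] L2 := (ContinuousLinearMap.fst ℂ L2 L2).comp H2.subtypeL

/-- The operator `-Δ : H² → L²`. -/
def negLaplacian : H2 →L[ℂ] L2 := (ContinuousLinearMap.snd ℂ L2 L2).comp H2.subtypeL

theorem incl_injective : Function.Injective (incl : H2 →ₗ[ℂ] L2) := by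
  rw [injective_iff_map_eq_zero]
  rintro ⟨⟨f, g⟩, h⟩ hf
  have hf' : f = 0 := hf
  subst hf'
  have h0 := (H2.zero_mem : (0 : L2 × L2) ∈ H2)
  have h1 : -(Δ ((0 : L2) : 𝓢'(R3, ℂ))) = (g : 𝓢'(R3, ℂ)) := h
  have h2 : -(Δ ((0 : L2) : 𝓢'(R3, ℂ))) = ((0 : L2) : 𝓢'(R3, ℂ)) := h0
  have h3 : Lp.toTemperedDistributionCLM ℂ (volume : Measure R3) 2 g = 0 := by
    rw [Lp.toTemperedDistributionCLM_apply, ← h1, h2, ← Lp.toTemperedDistributionCLM_apply,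
      map_zero]
  have h4 : g = 0 := by
    have := LinearMap.ker_eq_bot'.1
      (Lp.ker_toTemperedDistributionCLM_eq_bot (F := ℂ) (μ := (volume : Measure R3)) (p := 2))
    exact this g h3
  subst h4
  rfl

/-- `𝒟(-Δ)` as a subspace of `L²`. -/
def domH2 : Submodule ℂ L2 := LinearMap.range (incl : H2 →ₗ[ℂ] L2)

/-- The identification of `𝒟(-Δ) ⊆ L²` with the normed space `H²`. -/
def toH2 : domH2 ≃ₗ[ℂ] H2 := (LinearEquiv.ofInjective (incl : H2 →ₗ[ℂ] L2) incl_injective).symm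

/-- An operator `A : H² → L²`, seen as an unbounded operator in `L²` with domain `𝒟(-Δ)`. -/
def unbounded (A : H2 →L[ℂ] L2) : L2 →ₗ.[ℂ] L2 where
  domain := domH2
  toFun := (A : H2 →ₗ[ℂ] L2).comp (toH2 : domH2 →ₗ[ℂ] H2)

/-! ### Dilatations and multiplication operators -/

theorem memLp_dilate (t : ℝ) (f : L2) :
    MemLp (fun x : R3 => ((Real.exp (3 * t / 2) : ℝ) : ℂ) * f (Real.exp t • x)) 2 volume := by
  have hne : Real.exp t ≠ 0 := (Real.exp_pos t).ne'
  have hmap : Measure.map (fun x : R3 => Real.exp t • x) volume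
      = ENNReal.ofReal |((Real.exp t) ^ Module.finrank ℝ R3)⁻¹| • (volume : Measure R3) :=
    Measure.map_addHaar_smul volume hne
  have h1 : MemLp (f : R3 → ℂ) 2 (Measure.map (fun x : R3 => Real.exp t • x) volume) := by
    rw [hmap]
    exact (Lp.memLp f).smul_measure ENNReal.ofReal_ne_top
  have h2 := h1.comp_of_map (measurable_const_smul (Real.exp t)).aemeasurable
  exact h2.const_mul _

/-- The dilatation `(u(t) f)(x) = e^{3t/2} f(e^t x)` on `L²(ℝ³)`, `t` real; `u(t)⁻¹ = u(-t)`. -/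
def dilate (t : ℝ) (f : L2) : L2 := (memLp_dilate t f).toLp _

/-- The subspace `{f ∈ 𝒟(-Δ) : v f ∈ L²}` of `L²(ℝ³)`. -/
def mulDomain (v : R3 → ℂ) : Submodule ℂ L2 where
  carrier := {f | f ∈ domH2 ∧ MemLp (fun x => v x * f x) 2 volume}
  zero_mem' := by
    refine ⟨domH2.zero_mem, ?_⟩
    refine (MemLp.zero' (ε := ℂ)).ae_eq ?_
    filter_upwards [Lp.coeFn_zero ℂ 2 (volume : Measure R3)] with x hx
    rw [hx, Pi.zero_apply, mul_zero]
  add_mem' := by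
    rintro f g ⟨hf, hf'⟩ ⟨hg, hg'⟩
    refine ⟨domH2.add_mem hf hg, (hf'.add hg').ae_eq ?_⟩
    filter_upwards [Lp.coeFn_add f g] with x hx
    rw [hx, Pi.add_apply, Pi.add_apply, mul_add]
  smul_mem' := by
    rintro c f ⟨hf, hf'⟩
    refine ⟨domH2.smul_mem c hf, (hf'.const_smul c).ae_eq ?_⟩
    filter_upwards [Lp.coeFn_smul c f] with x hx
    rw [hx, Pi.smul_apply, Pi.smul_apply, smul_eq_mul, smul_eq_mul, mul_left_comm]

/-- The operator `f ↦ v f` of multiplication by `v` in `L²(ℝ³)`, with domain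
`{f ∈ 𝒟(-Δ) : v f ∈ L²}`. -/
def mulOp (v : R3 → ℂ) : L2 →ₗ.[ℂ] L2 where
  domain := mulDomain v
  toFun :=
    { toFun := fun f => MemLp.toLp (fun x => v x * (f : L2) x) f.2.2
      map_add' := by
        intro f g
        rw [← MemLp.toLp_add]
        apply MemLp.toLp_congr
        filter_upwards [Lp.coeFn_add (f : L2) (g : L2)] with x hx
        rw [Submodule.coe_add, hx, Pi.add_apply, Pi.add_apply, mul_add]
      map_smul' := by
        intro c f
        rw [RingHom.id_apply, ← MemLp.toLp_const_smul]
        apply MemLp.toLp_congr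
        filter_upwards [Lp.coeFn_smul c (f : L2)] with x hx
        rw [Submodule.coe_smul, hx, Pi.smul_apply, Pi.smul_apply, smul_eq_mul, smul_eq_mul,
          mul_left_comm] }

/-! ### Dilatation analytic operators -/

/-- `W` is an analytic continuation to the strip `|Im θ| < α` of the family
`V(t) = u(t) V u(t)⁻¹ : H² → L²`, `t ∈ ℝ` (analytic in the operator norm). -/
def IsContinuation (V : L2 →ₗ.[ℂ] L2) (α : ℝ) (W : ℂ → H2 →L[ℂ] L2) : Prop :=
  AnalyticOnNhd ℂ W {θ : ℂ | |θ.im| < α} ∧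
  ∀ (t : ℝ) (f : H2), ∃ h : dilate (-t) (incl f) ∈ V.domain,
    W (t : ℂ) f = dilate t (V ⟨dilate (-t) (incl f), h⟩)

/-- The class `C_α` of dilatation analytic operators on `L²(ℝ³)`. -/
structure ClassC (α : ℝ) (V : L2 →ₗ.[ℂ] L2) : Prop where
  domain_eq : V.domain = domH2
  symmetric : V.IsFormalAdjoint V
  compact : ∃ T : H2 →L[ℂ] L2, IsCompactOperator T ∧
    ∀ f : H2, ∃ h : incl f ∈ V.domain, T f = V ⟨incl f, h⟩
  continuation : ∃ W : ℂ → H2 →L[ℂ] L2, IsContinuation V α W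

/-! ### Spectral notions for unbounded operators -/

/-- `z` is in the resolvent set of `A`: `A - z` is a bijection of `𝒟(A)` onto `L²` with a bounded
inverse `R`. -/
def InResolventSet (A : L2 →ₗ.[ℂ] L2) (z : ℂ) : Prop :=
  ∃ R : L2 →L[ℂ] L2,
    (∀ f : L2, ∃ h : R f ∈ A.domain, A ⟨R f, h⟩ - z • R f = f) ∧
    ∀ f : A.domain, R (A f - z • (f : L2)) = f

/-- The spectrum of `A`. -/
def spec (A : L2 →ₗ.[ℂ] L2) : Set ℂ := {z | ¬ InResolventSet A z}

/-- `z` is an eigenvalue of `A`. -/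
def IsEigenvalue (A : L2 →ₗ.[ℂ] L2) (z : ℂ) : Prop :=
  ∃ f : A.domain, (f : L2) ≠ 0 ∧ A f = z • (f : L2)

/-- `ker (A - z)ⁿ`, with the natural domain of the power. -/
def genKer (A : L2 →ₗ.[ℂ] L2) (z : ℂ) : ℕ → Submodule ℂ L2
  | 0 => ⊥
  | n + 1 => ((genKer A z n).comap (A.toFun - z • A.domain.subtype)).map A.domain.subtype

/-- `z` is an isolated point of the spectrum of `A` and an eigenvalue of finite (algebraic, hence
also geometric) multiplicity. -/
def IsDiscreteEigenvalue (A : L2 →ₗ.[ℂ] L2) (z : ℂ) : Prop :=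
  (∃ δ : ℝ, 0 < δ ∧ ∀ w ∈ spec A, ‖w - z‖ < δ → w = z) ∧
  IsEigenvalue A z ∧
  FiniteDimensional ℂ (⨆ n, genKer A z n : Submodule ℂ L2)

/-- The dilated Hamiltonian `H(θ) = e^{-2θ} (-Δ) + g V(θ)` with domain `H²`, where `W θ = V(θ)`. For
`θ = 0` it is the Hamiltonian `H = -Δ + g V` itself. -/
def dilatedHamiltonian (W : ℂ → H2 →L[ℂ] L2) (g : ℝ) (θ : ℂ) : L2 →ₗ.[ℂ] L2 :=
  unbounded (Complex.exp (-2 * θ) • negLaplacian + (g : ℂ) • W θ)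

/-- The half-line `e^{-2θ} [0, ∞)`: the rotated half-line attached to the only threshold `0` of a
one-body Hamiltonian. -/
def rotatedRay (θ : ℂ) : Set ℂ := {z | ∃ x : ℝ, 0 ≤ x ∧ z = Complex.exp (-2 * θ) * x}

end DilationAnalytic

end

open DilationAnalytic

/-! For `|Im θ| < π/2` the point `z = e^θ r`, `r > 0`, lies in the right half-plane, where
`|e^{-C/z}/z|` is at most `1/|z|` and at most `|z|/(C Re z) = 1/(C cos Im θ)`. So the dilated
potential is a bounded function that vanishes at infinity, and its multiplication operator is
norm-holomorphic in `θ`. This gives (A) and (B), and by the identity theorem every continuation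
coincides with it (`IsContinuation.eq_dilated`).

Put `c = e^{-2θ}`. Off the half-line `c[0,∞)` one has `H(θ) - z = c (1 + K(z)) (-Δ - z/c)`, where
`K(z) = c⁻¹ g V(θ) (-Δ - z/c)⁻¹` is compact and analytic in `z`. Analytic Fredholm theory makes the
spectrum discrete there and the resolvent meromorphic. The integral of the resolvent over a small
circle is a compact operator acting as `-2πi` on generalized eigenvectors, hence the multiplicities
are finite (`finiteDimensional_genKer`). Conversely, if `cx` with `x ≥ 0` were in the resolvent set,
relative compactness would bound `-Δ - x` from below, against its approximate eigenvectors
(`smul_posRay_subset_spec`).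

Real dilatations conjugate `H(θ)` into `H(θ + t)`, so the spectrum depends on `Im θ` only. For fixed
`z` off the half-line, Fredholm theory in the variable `θ` says that `1 + K` is near `θ` either
never invertible or invertible off `θ`; translation invariance removes the exceptional point, so
membership of `z` in the spectrum is locally constant in `θ` (`eventually_mem_hamSpec_iff`). This is
the stability claim. As `H` is symmetric and has no non-real spectrum, a non-real `z` can enter the
spectrum only after the rotating half-line has crossed it, which gives the bounds on `arg z`.

For the real eigenvalues, Gaussian averages `f_θ` of `u(t) f` are entire in `θ`, and `⟪f_{conj θ},
(H(θ) - z)⁻¹ h_θ⟫` is invariant under real shifts of `θ`. Being holomorphic, it does not depend on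
`θ` as long as the half-line avoids the half-plane of `z` (`matElem_eq_zero_param`). Letting `z`
tend to a real `E ≠ 0`, the singularity of the resolvent of `H(θ)` at `E` is compared with the limit
of `ε (H - E ∓ iε)⁻¹`, which vanishes strongly exactly when `E` is not an eigenvalue of `H`. -/

noncomputable section

namespace DilationAnalytic

/-! ### Analytic Fredholm theory -/

section Fredholm

variable {X : Type*} [NormedAddCommGroup X] [InnerProductSpace ℂ X]

/-- A totally bounded subset of an inner product space is uniformly close to a finite-dimensional
subspace. -/
theorem _root_.TotallyBounded.exists_finiteDimensional_approx {S : Set X} (hS : TotallyBounded S)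
    {ε : ℝ} (hε : 0 < ε) : ∃ U : Submodule ℂ X, ∃ _ : FiniteDimensional ℂ U,
      ∀ x ∈ S, ‖x - U.starProjection x‖ ≤ ε := by
  obtain ⟨t, ht, hcov⟩ := Metric.totallyBounded_iff.1 hS ε hε
  have hfd : FiniteDimensional ℂ (Submodule.span ℂ t) := FiniteDimensional.span_of_finite ℂ ht
  refine ⟨Submodule.span ℂ t, hfd, fun x hx => ?_⟩
  obtain ⟨y, hy, hxy⟩ := Set.mem_iUnion₂.1 (hcov hx)
  have h1 := Submodule.starProjection_minimal (U := Submodule.span ℂ t) x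
  rw [h1]
  refine (ciInf_le ⟨0, ?_⟩ (⟨y, Submodule.subset_span hy⟩ : Submodule.span ℂ t)).trans ?_
  · rintro _ ⟨w, rfl⟩
    exact norm_nonneg _
  · rw [← dist_eq_norm]
    exact (Metric.mem_ball.1 hxy).le

theorem analyticAt_det {n : Type*} [Fintype n] [DecidableEq n] {M : ℂ → Matrix n n ℂ} {z₀ : ℂ}
    (h : ∀ i j, AnalyticAt ℂ (fun z => M z i j) z₀) : AnalyticAt ℂ (fun z => (M z).det) z₀ := by
  simp only [Matrix.det_apply]
  refine Finset.analyticAt_fun_sum _ fun σ _ => ?_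
  have h1 : AnalyticAt ℂ (fun z => ∏ i, M z (σ i) i) z₀ :=
    Finset.analyticAt_fun_prod _ fun i _ => h _ _
  rcases Int.units_eq_one_or (Equiv.Perm.sign σ) with hs | hs
  · simpa [hs] using h1
  · simpa [hs] using h1.fun_neg

theorem analyticAt_adjugate {n : Type*} [Fintype n] [DecidableEq n] {M : ℂ → Matrix n n ℂ} {z₀ : ℂ}
    (h : ∀ i j, AnalyticAt ℂ (fun z => M z i j) z₀) (i j : n) :
    AnalyticAt ℂ (fun z => (M z).adjugate i j) z₀ := by
  simp only [Matrix.adjugate_apply]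
  refine analyticAt_det fun k l => ?_
  by_cases hk : k = j
  · subst hk
    simpa only [Matrix.updateRow_self] using analyticAt_const
  · simpa only [Matrix.updateRow_ne hk] using h k l

/-- An analytic family of endomorphisms of a finite-dimensional space has an analytic determinant
and an analytic adjugate. -/
theorem exists_analyticAt_adjugate {U : Type*} [NormedAddCommGroup U] [NormedSpace ℂ U]
    [FiniteDimensional ℂ U] {D : ℂ → U →L[ℂ] U} {z₀ : ℂ} (hD : AnalyticAt ℂ D z₀) :
    ∃ N : ℂ → U →L[ℂ] U, AnalyticAt ℂ N z₀ ∧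
      AnalyticAt ℂ (fun z => LinearMap.det (D z : U →ₗ[ℂ] U)) z₀ ∧
      ∀ z, D z * N z = LinearMap.det (D z : U →ₗ[ℂ] U) • 1 ∧
        N z * D z = LinearMap.det (D z : U →ₗ[ℂ] U) • 1 := by
  classical
  let b := Module.finBasis ℂ U
  let M : ℂ → Matrix _ _ ℂ := fun z => LinearMap.toMatrix b b (D z : U →ₗ[ℂ] U)
  have hM : ∀ i j, AnalyticAt ℂ (fun z => M z i j) z₀ := by
    intro i j
    let φ : (U →L[ℂ] U) →L[ℂ] ℂ :=
      (LinearMap.toContinuousLinearMap (b.coord i)).comp (ContinuousLinearMap.apply ℂ U (b j))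
    have : (fun z => M z i j) = fun z => φ (D z) := by
      funext z
      simp [M, φ, LinearMap.toMatrix_apply]
    rw [this]
    exact (φ.analyticAt _).comp hD
  have hdet : (fun z => LinearMap.det (D z : U →ₗ[ℂ] U)) = fun z => (M z).det := by
    funext z
    exact (LinearMap.det_toMatrix b _).symm
  let N : ℂ → U →L[ℂ] U := fun z =>
    LinearMap.toContinuousLinearMap (Matrix.toLin b b (M z).adjugate)
  have hlin : ∀ z, (N z : U →ₗ[ℂ] U) = Matrix.toLin b b (M z).adjugate := fun z => rfl
  have hDlin : ∀ z, (D z : U →ₗ[ℂ] U) = Matrix.toLin b b (M z) := fun z =>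
    (Matrix.toLin_toMatrix b b _).symm
  refine ⟨N, ?_, ?_, fun z => ⟨?_, ?_⟩⟩
  -- Expansion in matrix units reduces analyticity of the operator to that of its scalar entries.
  · have : N = fun z => ∑ i, ∑ j, (M z).adjugate i j •
        LinearMap.toContinuousLinearMap (Matrix.toLin b b (Matrix.single i j 1)) := by
      funext z
      simp only [N]
      conv_lhs => rw [Matrix.matrix_eq_sum_single (M z).adjugate]
      simp only [map_sum]
      refine Finset.sum_congr rfl fun i _ => Finset.sum_congr rfl fun j _ => ?_
      rw [← map_smul, ← map_smul, Matrix.smul_single, smul_eq_mul, mul_one]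
    rw [this]
    exact Finset.analyticAt_fun_sum _ fun i _ => Finset.analyticAt_fun_sum _ fun j _ =>
      (analyticAt_adjugate hM i j).fun_smul analyticAt_const
  · rw [hdet]
    exact analyticAt_det hM
  · apply ContinuousLinearMap.coe_injective
    change (D z : U →ₗ[ℂ] U) ∘ₗ (N z : U →ₗ[ℂ] U) = _ • LinearMap.id
    rw [hlin, congrFun hdet z, hDlin, ← Matrix.toLin_mul, Matrix.mul_adjugate, map_smul,
      Matrix.toLin_one]
  · apply ContinuousLinearMap.coe_injective
    change (N z : U →ₗ[ℂ] U) ∘ₗ (D z : U →ₗ[ℂ] U) = _ • LinearMap.id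
    rw [hlin, congrFun hdet z, hDlin, ← Matrix.toLin_mul, Matrix.adjugate_mul, map_smul,
      Matrix.toLin_one]

variable [CompleteSpace X]

/-- Local form of the analytic Fredholm theorem: near a point where `K` is compact, `1 + K z` has a
scalar analytic determinant `d` and an analytic adjugate `N`. -/
theorem exists_fredholm_det {K : ℂ → X →L[ℂ] X} {z₀ : ℂ} (hK : AnalyticAt ℂ K z₀)
    (hc : IsCompactOperator (K z₀)) :
    ∃ (d : ℂ → ℂ) (N : ℂ → X →L[ℂ] X), AnalyticAt ℂ d z₀ ∧ AnalyticAt ℂ N z₀ ∧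
      ∀ᶠ z in 𝓝 z₀, (d z ≠ 0 ↔ IsUnit (1 + K z)) ∧ (1 + K z) * N z = d z • 1 ∧
        N z * (1 + K z) = d z • 1 := by
  -- Compactness splits `K z₀` into the finite-rank part `ι π` and a remainder of norm at most
  -- `1/2`. Then `1 + K z = G z + ι π`, with `G` invertible near `z₀`.
  have htb : TotallyBounded (K z₀ '' Metric.closedBall 0 1) :=
    (hc.isCompact_closure_image_closedBall 1).totallyBounded.subset subset_closure
  obtain ⟨U, hU, hUapp⟩ := htb.exists_finiteDimensional_approx (ε := 1 / 2) (by norm_num)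
  let ι : U →L[ℂ] X := U.subtypeL
  let π : X →L[ℂ] U := U.orthogonalProjectionOnto.comp (K z₀)
  have hnorm : ‖K z₀ - ι.comp π‖ < 1 := by
    refine lt_of_le_of_lt (ContinuousLinearMap.opNorm_le_of_unit_norm (C := 1 / 2)
      (by norm_num) fun x hx => ?_) (by norm_num)
    exact hUapp _ ⟨x, by simp [hx], rfl⟩
  let G : ℂ → X →L[ℂ] X := fun z => 1 + K z - ι.comp π
  have hG : AnalyticAt ℂ G z₀ := (analyticAt_const.add hK).sub analyticAt_const
  have hGu : IsUnit (G z₀) := by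
    have h : G z₀ = 1 - (-(K z₀ - ι.comp π)) := by simp only [G]; abel
    rw [h]
    exact isUnit_one_sub_of_norm_lt_one (by rwa [norm_neg])
  let Gi : ℂ → X →L[ℂ] X := fun z => Ring.inverse (G z)
  have hGi : AnalyticAt ℂ Gi z₀ := by
    obtain ⟨u, hu⟩ := hGu
    have h := analyticAt_inverse (𝕜 := ℂ) u
    rw [hu] at h
    exact h.comp hG
  let B : ℂ → X →L[ℂ] U := fun z => π.comp (Gi z)
  have hB : AnalyticAt ℂ B z₀ :=
    ((ContinuousLinearMap.compL ℂ X X U π).analyticAt _).comp hGi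
  -- From `1 + K = (1 + ι B) G`, invertibility is that of `1 + ι B`, equivalently of `1 + B ι` on
  -- the finite-dimensional `U`. The scalar `d` is the determinant of the latter.
  let D : ℂ → U →L[ℂ] U := fun z => 1 + (B z).comp ι
  have hD : AnalyticAt ℂ D z₀ :=
    analyticAt_const.add ((((ContinuousLinearMap.compL ℂ U X U).flip ι).analyticAt _).comp hB)
  obtain ⟨A, hA, hd, hAD⟩ := exists_analyticAt_adjugate hD
  set d : ℂ → ℂ := fun z => LinearMap.det (D z : U →ₗ[ℂ] U) with hd_def
  -- This is `d G⁻¹ (1 - ι D⁻¹ B)`, that is `d (1 + K)⁻¹`, with `d D⁻¹` replaced by the adjugate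
  -- `A`, which makes sense also where `D` is singular.
  let N : ℂ → X →L[ℂ] X := fun z => Gi z * (d z • 1 - ι.comp ((A z).comp (B z)))
  have hN : AnalyticAt ℂ N z₀ := by
    refine hGi.mul ((hd.fun_smul analyticAt_const).sub ?_)
    refine ((ContinuousLinearMap.compL ℂ X U X ι).analyticAt _).comp ?_
    exact ((ContinuousLinearMap.compL ℂ X U U).analyticAt_bilinear (A z₀, B z₀)).comp₂ hA hB
  refine ⟨d, N, hd, hN, ?_⟩
  filter_upwards [hG.continuousAt.eventually (Units.isOpen.mem_nhds hGu)] with z hz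
  have hz : IsUnit (G z) := hz
  have hl : Gi z * G z = 1 := Ring.inverse_mul_cancel _ hz
  have hr : G z * Gi z = 1 := Ring.mul_inverse_cancel _ hz
  have hl' : ∀ x, Gi z (G z x) = x := fun x => DFunLike.congr_fun hl x
  have hr' : ∀ x, G z (Gi z x) = x := fun x => DFunLike.congr_fun hr x
  have hKz : ∀ x, (1 + K z) x = G z x + ι (π x) := fun x => by simp [G]
  have hBι : ∀ u, B z (ι u) = D z u - u := fun u => by simp [D]
  have hDA : ∀ u, D z (A z u) = d z • u := fun u => DFunLike.congr_fun (hAD z).1 u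
  have hAD' : ∀ u, A z (D z u) = d z • u := fun u => DFunLike.congr_fun (hAD z).2 u
  have hπ : ∀ x, π (Gi z x) = B z x := fun x => rfl
  have hπG : ∀ x, B z (G z x) = π x := fun x => by simp only [B, ContinuousLinearMap.comp_apply, hl']
  have h1 : (1 + K z) * N z = d z • 1 := by
    ext x
    have : N z x = Gi z (d z • x - ι (A z (B z x))) := rfl
    rw [mul_apply_eq_comp, hKz, this, hr', hπ, map_sub, map_smul, hBι, hDA]
    simp
  have h2 : N z * (1 + K z) = d z • 1 := by
    ext x
    have : ∀ y, N z y = Gi z (d z • y - ι (A z (B z y))) := fun _ => rfl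
    rw [mul_apply_eq_comp, hKz, this, map_add (B z), hπG, hBι, add_sub_cancel, hAD',
      smul_add, map_smul ι, add_sub_cancel_right, map_smul, hl']
    rfl
  refine ⟨⟨fun h0 => ?_, fun hu => ?_⟩, h1, h2⟩
  · refine ⟨⟨1 + K z, (d z)⁻¹ • N z, ?_, ?_⟩, rfl⟩
    · rw [mul_smul_comm, h1, smul_smul, inv_mul_cancel₀ h0, one_smul]
    · rw [smul_mul_assoc, h2, smul_smul, inv_mul_cancel₀ h0, one_smul]
  · obtain ⟨u, hu⟩ := hu
    -- `T` is a right inverse of `1 + ι B`; then `1 - B T ι` is a right inverse of `D`, so the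
    -- determinant cannot vanish.
    let T : X →L[ℂ] X := G z * (↑u⁻¹ : X →L[ℂ] X)
    have hT : ∀ x, T x + ι (B z (T x)) = x := by
      intro x
      have h3 : (1 + K z) ((↑u⁻¹ : X →L[ℂ] X) x) = x := by
        rw [← hu]
        exact DFunLike.congr_fun u.mul_inv x
      rw [hKz] at h3
      simpa only [T, mul_apply_eq_comp, hπG] using h3
    have hDinv : D z * (1 - (B z).comp (T.comp ι)) = 1 := by
      ext v : 1
      change (1 - (B z).comp (T.comp ι)) v + B z (ι ((1 - (B z).comp (T.comp ι)) v)) = v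
      have h4 : (1 - (B z).comp (T.comp ι)) v = v - B z (T (ι v)) := rfl
      have h5 : ι (B z (T (ι v))) = ι v - T (ι v) := eq_sub_of_add_eq' (hT (ι v))
      rw [h4, map_sub ι, h5]
      simp
    have h6 : d z * LinearMap.det ((1 - (B z).comp (T.comp ι) : U →L[ℂ] U) : U →ₗ[ℂ] U) = 1 := by
      rw [hd_def]
      dsimp only
      rw [← LinearMap.det_comp]
      have := congrArg (fun L : U →L[ℂ] U => LinearMap.det (L : U →ₗ[ℂ] U)) hDinv
      simpa using this
    exact left_ne_zero_of_mul_eq_one h6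

/-- Near a point where `K` is compact, `1 + K z` is invertible off that point or never. -/
theorem fredholm_dichotomy {K : ℂ → X →L[ℂ] X} {z₀ : ℂ} (hK : AnalyticAt ℂ K z₀)
    (hc : IsCompactOperator (K z₀)) :
    (∀ᶠ z in 𝓝 z₀, ¬ IsUnit (1 + K z)) ∨ ∀ᶠ z in 𝓝[≠] z₀, IsUnit (1 + K z) := by
  obtain ⟨d, N, hd, -, h⟩ := exists_fredholm_det hK hc
  rcases hd.eventually_eq_zero_or_eventually_ne_zero with h0 | h0
  · left
    filter_upwards [h, h0] with z hz hz0
    rw [← hz.1]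
    simpa using hz0
  · right
    filter_upwards [h.filter_mono nhdsWithin_le_nhds, h0] with z hz hz0
    exact hz.1.1 hz0

/-- Near a point where `K` is compact, `(1 + K z)⁻¹` is meromorphic unless it never exists. -/
theorem fredholm_meromorphicAt {K : ℂ → X →L[ℂ] X} {z₀ : ℂ} (hK : AnalyticAt ℂ K z₀)
    (hc : IsCompactOperator (K z₀)) (hu : ∀ᶠ z in 𝓝[≠] z₀, IsUnit (1 + K z)) :
    MeromorphicAt (fun z => Ring.inverse (1 + K z)) z₀ := by
  obtain ⟨d, N, hd, hN, h⟩ := exists_fredholm_det hK hc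
  refine (hd.meromorphicAt.inv.smul hN.meromorphicAt).congr ?_
  filter_upwards [h.filter_mono nhdsWithin_le_nhds, hu] with z hz hzu
  have hd0 : d z ≠ 0 := hz.1.2 hzu
  have : N z = d z • Ring.inverse (1 + K z) := by
    calc N z = N z * ((1 + K z) * Ring.inverse (1 + K z)) := by
          rw [Ring.mul_inverse_cancel _ hzu, mul_one]
      _ = _ := by rw [← mul_assoc, hz.2.2, smul_mul_assoc, one_mul]
  simp [this, smul_smul, inv_mul_cancel₀ hd0]

/-- The analytic Fredholm theorem on a preconnected open set. -/
theorem fredholm_eventually_isUnit {K : ℂ → X →L[ℂ] X} {Ω : Set ℂ} (hΩ : IsOpen Ω)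
    (hconn : IsPreconnected Ω) (hK : ∀ z ∈ Ω, AnalyticAt ℂ K z)
    (hc : ∀ z ∈ Ω, IsCompactOperator (K z)) (hex : ∃ z ∈ Ω, IsUnit (1 + K z)) :
    ∀ z ∈ Ω, ∀ᶠ w in 𝓝[≠] z, IsUnit (1 + K w) := by
  by_contra! hcon
  obtain ⟨z₁, hz₁, hz₁'⟩ := hcon
  obtain ⟨z₂, hz₂, hz₂'⟩ := hex
  -- By the dichotomy the open sets `S` and `Ω ∩ T` cover `Ω`. They have no common point, since
  -- punctured neighbourhoods in `ℂ` are nontrivial, so connectedness leaves only one of them.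
  let S : Set ℂ := {z | ∀ᶠ w in 𝓝 z, ¬ IsUnit (1 + K w)}
  let T : Set ℂ := {z | ∀ᶠ w in 𝓝[≠] z, IsUnit (1 + K w)}
  have hSo : IsOpen S := isOpen_iff_mem_nhds.2 fun z hz => eventually_eventually_nhds.2 hz
  have hTo : IsOpen (Ω ∩ T) := by
    rw [isOpen_iff_mem_nhds]
    rintro z ⟨hz, hzT⟩
    have h1 : ∀ᶠ w in 𝓝[≠] z, ∀ᶠ v in 𝓝[≠] w, IsUnit (1 + K v) := by
      have h2 : ∀ᶠ w in 𝓝[≠] z, ∀ᶠ v in 𝓝 w, v ≠ z → IsUnit (1 + K v) :=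
        (eventually_eventually_nhds.2 (eventually_nhdsWithin_iff.1 hzT)).filter_mono
          nhdsWithin_le_nhds
      filter_upwards [h2, self_mem_nhdsWithin] with w hw hwz
      have h3 : ∀ᶠ v in 𝓝 w, v ≠ z := isOpen_ne.mem_nhds hwz
      filter_upwards [hw.filter_mono nhdsWithin_le_nhds, h3.filter_mono nhdsWithin_le_nhds]
        with v hv hv' using hv hv'
    have h4 : ∀ᶠ w in 𝓝 z, w ∈ T := by
      rw [eventually_nhdsWithin_iff] at h1
      filter_upwards [h1] with w hw
      by_cases hwz : w = z
      · rw [hwz]; exact hzT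
      · exact hw hwz
    exact Filter.inter_mem (hΩ.mem_nhds hz) h4
  have hcov : Ω ⊆ S ∪ (Ω ∩ T) := by
    intro z hz
    rcases fredholm_dichotomy (hK z hz) (hc z hz) with h | h
    · exact Or.inl h
    · exact Or.inr ⟨hz, h⟩
  have hz₁S : z₁ ∈ S := (hcov hz₁).resolve_right fun h =>
    hz₁' ((show ∀ᶠ w in 𝓝[≠] z₁, IsUnit (1 + K w) from h.2).mono fun _ h => not_not.2 h)
  have hz₂T : z₂ ∈ Ω ∩ T :=
    (hcov hz₂).resolve_left fun h => (mem_of_mem_nhds h : ¬ IsUnit (1 + K z₂)) hz₂'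
  obtain ⟨w, -, hwS, -, hwT⟩ := hconn S (Ω ∩ T) hSo hTo hcov ⟨z₁, hz₁, hz₁S⟩ ⟨z₂, hz₂, hz₂T⟩
  have hwS : ∀ᶠ v in 𝓝 w, ¬ IsUnit (1 + K v) := hwS
  have hwT : ∀ᶠ v in 𝓝[≠] w, IsUnit (1 + K v) := hwT
  obtain ⟨v, hv1, hv2⟩ := ((hwS.filter_mono nhdsWithin_le_nhds).and hwT).exists
  exact hv1 hv2

/-- The Fredholm alternative for `1 + K`. -/
theorem exists_ne_zero_of_not_isUnit_one_add {K : X →L[ℂ] X} (hc : IsCompactOperator K)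
    (hu : ¬ IsUnit (1 + K)) : ∃ x ≠ 0, x + K x = 0 := by
  rcases hc.hasEigenvalue_or_mem_resolventSet (μ := -1) (by norm_num) with h | h
  · obtain ⟨x, hx⟩ := h.exists_hasEigenvector
    refine ⟨x, hx.2, ?_⟩
    have : K x = (-1 : ℂ) • x := hx.apply_eq_smul
    rw [this]
    simp
  · exfalso
    apply hu
    rw [spectrum.mem_resolventSet_iff] at h
    have : algebraMap ℂ (X →L[ℂ] X) (-1) - K = -(1 + K) := by simp; abel
    rw [this, IsUnit.neg_iff] at h
    exact h

end Fredholm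

/-! ### Bounded multiplication operators -/

/-- Bounded measurable functions on `ℝ³`. -/
def IsBddMeas (v : R3 → ℂ) : Prop := Measurable v ∧ ∃ M : ℝ, ∀ x, ‖v x‖ ≤ M

theorem IsBddMeas.memLp {v : R3 → ℂ} (hv : IsBddMeas v) (f : L2) :
    MemLp (fun x => v x * f x) 2 volume := by
  obtain ⟨hm, M, hM⟩ := hv
  refine (Lp.memLp f).of_le_mul (c := M)
    (hm.aestronglyMeasurable.mul (Lp.aestronglyMeasurable f)) (Eventually.of_forall fun x => ?_)
  rw [norm_mul]
  exact mul_le_mul_of_nonneg_right (hM x) (norm_nonneg _)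

open Classical in
/-- Multiplication by the bounded measurable function `v`, as a bounded operator on `L²`. -/
def mulL (v : R3 → ℂ) : L2 →L[ℂ] L2 :=
  if hv : IsBddMeas v then
    LinearMap.mkContinuousOfExistsBound
      { toFun := fun f => (hv.memLp f).toLp _
        map_add' := fun f g => by
          rw [← MemLp.toLp_add]
          apply MemLp.toLp_congr
          filter_upwards [Lp.coeFn_add f g] with x hx
          rw [hx, Pi.add_apply, Pi.add_apply, mul_add]
        map_smul' := fun c f => by
          rw [RingHom.id_apply, ← MemLp.toLp_const_smul]
          apply MemLp.toLp_congr
          filter_upwards [Lp.coeFn_smul c f] with x hx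
          rw [hx, Pi.smul_apply, Pi.smul_apply, smul_eq_mul, smul_eq_mul, mul_left_comm] }
      (by
        obtain ⟨-, M, hM⟩ := id hv
        refine ⟨M, fun f => Lp.norm_le_mul_norm_of_ae_le_mul ?_⟩
        filter_upwards [(hv.memLp f).coeFn_toLp] with x hx
        change ‖((hv.memLp f).toLp _ : L2) x‖ ≤ _
        rw [hx, norm_mul]
        exact mul_le_mul_of_nonneg_right (hM x) (norm_nonneg _))
  -- The default `0` lets the norm bound `norm_mulL_le` hold without measurability.
  else 0

theorem mulL_ae {v : R3 → ℂ} (hv : IsBddMeas v) (f : L2) :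
    mulL v f =ᵐ[volume] fun x => v x * f x := by
  rw [mulL, dif_pos hv]
  exact (hv.memLp f).coeFn_toLp

theorem norm_mulL_le {v : R3 → ℂ} {M : ℝ} (hM0 : 0 ≤ M) (hM : ∀ x, ‖v x‖ ≤ M) :
    ‖mulL v‖ ≤ M := by
  by_cases hv : IsBddMeas v
  · refine ContinuousLinearMap.opNorm_le_bound _ hM0 fun f => Lp.norm_le_mul_norm_of_ae_le_mul ?_
    filter_upwards [mulL_ae hv f] with x hx
    rw [hx, norm_mul]
    exact mul_le_mul_of_nonneg_right (hM x) (norm_nonneg _)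
  · rw [mulL, dif_neg hv, norm_zero]
    exact hM0

theorem mulL_eq_iff {v : R3 → ℂ} (hv : IsBddMeas v) (f g : L2) :
    mulL v f = g ↔ (fun x => v x * f x) =ᵐ[volume] g :=
  ⟨fun h => h ▸ (mulL_ae hv f).symm, fun h => Lp.ext ((mulL_ae hv f).trans h)⟩

theorem IsBddMeas.mul {v w : R3 → ℂ} (hv : IsBddMeas v) (hw : IsBddMeas w) :
    IsBddMeas (fun x => v x * w x) := by
  obtain ⟨hv, M, hM⟩ := hv
  obtain ⟨hw, N, hN⟩ := hw
  refine ⟨hv.mul hw, M * N, fun x => ?_⟩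
  rw [norm_mul]
  exact mul_le_mul (hM x) (hN x) (norm_nonneg _) ((norm_nonneg _).trans (hM x))

theorem IsBddMeas.sub {v w : R3 → ℂ} (hv : IsBddMeas v) (hw : IsBddMeas w) :
    IsBddMeas (fun x => v x - w x) := by
  obtain ⟨hv, M, hM⟩ := hv
  obtain ⟨hw, N, hN⟩ := hw
  exact ⟨hv.sub hw, M + N, fun x => (norm_sub_le _ _).trans (add_le_add (hM x) (hN x))⟩

theorem isBddMeas_const (c : ℂ) : IsBddMeas (fun _ => c) :=
  ⟨measurable_const, ‖c‖, fun _ => le_rfl⟩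

theorem mulL_comp {v w : R3 → ℂ} (hv : IsBddMeas v) (hw : IsBddMeas w) :
    mulL v * mulL w = mulL (fun x => v x * w x) := by
  ext1 f
  apply Lp.ext
  filter_upwards [mulL_ae (hv.mul hw) f, mulL_ae hv (mulL w f), mulL_ae hw f] with x h1 h2 h3
  rw [h1, mul_apply_eq_comp, h2, h3, mul_assoc]

theorem mulL_sub {v w : R3 → ℂ} (hv : IsBddMeas v) (hw : IsBddMeas w) :
    mulL (fun x => v x - w x) = mulL v - mulL w := by
  ext1 f
  apply Lp.ext
  filter_upwards [mulL_ae (hv.sub hw) f, mulL_ae hv f, mulL_ae hw f,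
    Lp.coeFn_sub (mulL v f) (mulL w f)] with x h1 h2 h3 h4
  rw [h1, sub_apply, h4, Pi.sub_apply, h2, h3, sub_mul]

theorem mulL_const (c : ℂ) : mulL (fun _ => c) = c • 1 := by
  ext1 f
  rw [mulL_eq_iff (isBddMeas_const c)]
  filter_upwards [Lp.coeFn_smul c f] with x hx
  change _ = (c • f : L2) x
  rw [hx, Pi.smul_apply, smul_eq_mul]

theorem mulL_smul {v : R3 → ℂ} (hv : IsBddMeas v) (c : ℂ) :
    mulL (fun x => c * v x) = c • mulL v := by
  rw [← mulL_comp (isBddMeas_const c) hv, mulL_const, smul_mul_assoc, one_mul]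

theorem inner_mulL {v w : R3 → ℂ} (hv : IsBddMeas v) (hw : IsBddMeas w)
    (hvw : ∀ x, w x = starRingEnd ℂ (v x)) (f g : L2) :
    ⟪mulL v f, g⟫_ℂ = ⟪f, mulL w g⟫_ℂ := by
  rw [L2.inner_def, L2.inner_def]
  apply integral_congr_ae
  filter_upwards [mulL_ae hv f, mulL_ae hw g] with x h1 h2
  rw [h1, h2, hvw, RCLike.inner_apply, RCLike.inner_apply, map_mul]
  ring

/-- A locally uniformly bounded, pointwise holomorphic family of measurable functions defines a
norm-holomorphic family of multiplication operators. -/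
theorem differentiableOn_mulL {U : Set ℂ} (hU : IsOpen U) {v : ℂ → R3 → ℂ}
    (hm : ∀ z ∈ U, Measurable (v z)) (hd : ∀ x, DifferentiableOn ℂ (fun z => v z x) U)
    (hb : ∀ z₀ ∈ U, ∃ M : ℝ, ∀ᶠ z in 𝓝 z₀, ∀ x, ‖v z x‖ ≤ M) :
    DifferentiableOn ℂ (fun z => mulL (v z)) U := by
  intro z₀ hz₀
  apply DifferentiableAt.differentiableWithinAt
  obtain ⟨M, hM⟩ := hb z₀ hz₀
  obtain ⟨R, hR, hball⟩ := Metric.eventually_nhds_iff_ball.1 (hM.and (hU.mem_nhds hz₀))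
  have hM0 : 0 ≤ M := (norm_nonneg _).trans ((hball z₀ (Metric.mem_ball_self hR)).1 0)
  -- Two Cauchy estimates on circles of radius `r` are chained: `v` is bounded on the ball of radius
  -- `3r`, `v'` on that of radius `3r/2`, `v''` on that of radius `r/2`.
  set r := R / 3 with hr
  have hr0 : 0 < r := by positivity
  have hdiff : ∀ x, DifferentiableOn ℂ (fun z => v z x) (Metric.ball z₀ R) := fun x =>
    (hd x).mono fun z hz => (hball z hz).2
  have hdiff' : ∀ x, DifferentiableOn ℂ (deriv fun z => v z x) (Metric.ball z₀ R) := fun x =>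
    (hdiff x).deriv Metric.isOpen_ball
  have hsub : ∀ {a b : ℝ} {z : ℂ}, a + b < R → z ∈ Metric.closedBall z₀ a →
      Metric.closedBall z b ⊆ Metric.ball z₀ R := fun hab hz =>
    Metric.closedBall_subset_ball' (lt_of_le_of_lt (by
      rw [add_comm]; exact add_le_add_left (Metric.mem_closedBall.1 hz) _) hab)
  have hcl : ∀ {z : ℂ} {b : ℝ}, 0 < b → Metric.closedBall z b ⊆ Metric.ball z₀ R →
      ∀ {f : ℂ → ℂ}, DifferentiableOn ℂ f (Metric.ball z₀ R) →
        DiffContOnCl ℂ f (Metric.ball z b) := fun hb hs f hf =>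
    (hf.mono ((closure_ball _ hb.ne').subset.trans hs)).diffContOnCl
  have h1 : ∀ x, ∀ z ∈ Metric.closedBall z₀ (2 / 3 * R - r / 2),
      ‖deriv (fun z => v z x) z‖ ≤ M / r := by
    intro x z hz
    have hs := hsub (b := r) (by rw [hr]; linarith) hz
    refine Complex.norm_deriv_le_of_forall_mem_sphere_norm_le hr0 (hcl hr0 hs (hdiff x))
      fun w hw => (hball w (hs (Metric.sphere_subset_closedBall hw))).1 x
  have h2 : ∀ x, ∀ z ∈ Metric.closedBall z₀ (r / 2),
      ‖deriv (deriv fun z => v z x) z‖ ≤ M / r / r := by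
    intro x z hz
    have hs := hsub (b := r) (by rw [hr]; linarith) hz
    refine Complex.norm_deriv_le_of_forall_mem_sphere_norm_le hr0 (hcl hr0 hs (hdiff' x))
      fun w hw => h1 x w ?_
    rw [Metric.mem_closedBall]
    have := dist_triangle w z z₀
    rw [Metric.mem_sphere] at hw
    rw [Metric.mem_closedBall] at hz
    linarith
  set C := M / r / r with hC
  have hC0 : 0 ≤ C := by positivity
  let v' : R3 → ℂ := fun x => deriv (fun z => v z x) z₀
  have hz₀r : z₀ ∈ Metric.closedBall z₀ (r / 2) := Metric.mem_closedBall_self (by positivity)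
  have hin : ∀ {z}, z ∈ Metric.closedBall z₀ (r / 2) → z ∈ Metric.ball z₀ R := fun hz =>
    Metric.closedBall_subset_ball (by rw [hr]; linarith) hz
  -- The constant does not depend on `x`, so the pointwise remainder bounds the operator norm of the
  -- remainder.
  have hTaylor : ∀ x, ∀ z ∈ Metric.closedBall z₀ (r / 2),
      ‖v z x - v z₀ x - (z - z₀) * v' x‖ ≤ C * ‖z - z₀‖ ^ 2 := by
    intro x z hz
    have hlip : ∀ w ∈ Metric.closedBall z₀ (r / 2),
        ‖deriv (fun z => v z x) w - v' x‖ ≤ C * ‖w - z₀‖ := fun w hw =>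
      Convex.norm_image_sub_le_of_norm_deriv_le
        (fun y hy => ((hdiff' x).differentiableAt (Metric.isOpen_ball.mem_nhds (hin hy))))
        (h2 x) (convex_closedBall _ _) hz₀r hw
    have hseg : segment ℝ z₀ z ⊆ Metric.closedBall z₀ (r / 2) :=
      (convex_closedBall _ _).segment_subset hz₀r hz
    have hda : ∀ y ∈ segment ℝ z₀ z, HasDerivAt (fun w => v w x - w * v' x)
        (deriv (fun z => v z x) y - v' x) y := fun y hy => by
      have := ((hdiff x).differentiableAt (Metric.isOpen_ball.mem_nhds (hin (hseg hy)))).hasDerivAt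
      simpa using this.fun_sub ((hasDerivAt_id' y).mul_const (v' x))
    have := Convex.norm_image_sub_le_of_norm_deriv_le (f := fun w => v w x - w * v' x)
      (C := C * ‖z - z₀‖) (fun y hy => (hda y hy).differentiableAt) (fun y hy => ?_)
      (convex_segment z₀ z) (left_mem_segment ℝ z₀ z) (right_mem_segment ℝ z₀ z)
    · convert this using 1
      · congr 1; ring
      · ring
    · rw [(hda y hy).deriv]
      refine (hlip y (hseg hy)).trans (mul_le_mul_of_nonneg_left ?_ hC0)
      obtain ⟨t, ht, rfl⟩ := (segment_eq_image' ℝ z₀ z ▸ hy : y ∈ _ '' _)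
      simp only [add_sub_cancel_left, norm_smul, Real.norm_eq_abs, abs_of_nonneg ht.1]
      exact mul_le_of_le_one_left (norm_nonneg _) ht.2
  -- The derivative in `z` is a pointwise limit of difference quotients along a sequence, hence
  -- measurable in `x`.
  have hv'm : Measurable v' := by
    have hlim : ∀ x, Tendsto (fun n : ℕ => (((r / 2 / (n + 1) : ℝ)) : ℂ)⁻¹ *
        (v (z₀ + ((r / 2 / (n + 1) : ℝ) : ℂ)) x - v z₀ x)) atTop (𝓝 (v' x)) := by
      intro x
      have hs := ((hdiff x).differentiableAt (Metric.isOpen_ball.mem_nhds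
        (hin hz₀r))).hasDerivAt.tendsto_slope_zero
      have ht : Tendsto (fun n : ℕ => ((r / 2 / (n + 1) : ℝ) : ℂ)) atTop (𝓝[≠] 0) := by
        refine tendsto_nhdsWithin_iff.2 ⟨?_, Eventually.of_forall fun n => ?_⟩
        · have : Tendsto (fun n : ℕ => r / 2 / ((n : ℝ) + 1)) atTop (𝓝 0) :=
            tendsto_const_nhds.div_atTop (tendsto_natCast_atTop_atTop.atTop_add tendsto_const_nhds)
          simpa [Function.comp_def] using (Complex.continuous_ofReal.tendsto 0).comp this
        · simp only [Set.mem_compl_iff, Set.mem_singleton_iff, Complex.ofReal_eq_zero]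
          positivity
      simpa only [smul_eq_mul, Function.comp_def] using hs.comp ht
    refine measurable_of_tendsto_metrizable (fun n => ?_) (tendsto_pi_nhds.2 hlim)
    refine measurable_const.mul ((hm _ (hball _ (hin ?_)).2).sub (hm _ hz₀))
    rw [Metric.mem_closedBall, dist_eq_norm, add_sub_cancel_left, Complex.norm_real,
      Real.norm_of_nonneg (by positivity)]
    exact div_le_self (by positivity) (by linarith [Nat.cast_nonneg (α := ℝ) n])
  have hv' : IsBddMeas v' := ⟨hv'm, M / r, fun x => h1 x z₀
    (Metric.mem_closedBall_self (by rw [hr]; linarith))⟩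
  have hvz : ∀ z ∈ Metric.closedBall z₀ (r / 2), IsBddMeas (v z) := fun z hz =>
    ⟨hm z (hball z (hin hz)).2, M, (hball z (hin hz)).1⟩
  have hder : HasDerivAt (fun z => mulL (v z)) (mulL v') z₀ := by
    rw [hasDerivAt_iff_isLittleO]
    refine Asymptotics.IsBigO.trans_isLittleO (g := fun z => (z - z₀) ^ 2) ?_ ?_
    · refine Asymptotics.IsBigO.of_bound C ?_
      filter_upwards [Metric.closedBall_mem_nhds z₀ (show 0 < r / 2 by positivity)] with z hz
      have h3 : mulL (v z) - mulL (v z₀) - (z - z₀) • mulL v'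
          = mulL (fun x => v z x - v z₀ x - (z - z₀) * v' x) := by
        rw [mulL_sub ((hvz z hz).sub (hvz z₀ hz₀r)) ((isBddMeas_const _).mul hv'),
          mulL_sub (hvz z hz) (hvz z₀ hz₀r), mulL_smul hv']
      rw [h3, norm_pow]
      exact norm_mulL_le (by positivity) (fun x => hTaylor x z hz)
    · have : Tendsto (fun z => z - z₀) (𝓝 z₀) (𝓝 0) := by
        simpa using (continuous_sub_right z₀).tendsto z₀
      simpa [pow_two] using ((Asymptotics.isLittleO_one_iff ℂ).2 this).mul_isBigO
        (Asymptotics.isBigO_refl (fun z : ℂ => z - z₀) (𝓝 z₀))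
  exact hder.differentiableAt

/-! ### The free resolvent -/

/-- The symbol `4π²|ξ|²` of `-Δ`. -/
def symb (ξ : R3) : ℝ := (2 * Real.pi) ^ 2 * ‖ξ‖ ^ 2

theorem symb_nonneg (ξ : R3) : 0 ≤ symb ξ := by unfold symb; positivity

theorem continuous_symb : Continuous symb := by unfold symb; fun_prop

/-- The Fourier transform on `L²(ℝ³)`. -/
def four : L2 ≃ₗᵢ[ℂ] L2 := Lp.fourierTransformₗᵢ R3 ℂ

/-- The Fourier transform turns the distributional Laplacian into multiplication by the symbol. Both
sides are then locally integrable functions, and such functions are determined almost everywhere by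
their pairings with smooth compactly supported functions. -/
theorem mem_H2_iff (f g : L2) :
    (f, g) ∈ H2 ↔ (fun ξ => (symb ξ : ℂ) * four f ξ) =ᵐ[volume] four g := by
  have hs : Function.HasTemperateGrowth (fun x : R3 => ((‖x‖ ^ 2 : ℝ) : ℂ)) := by fun_prop
  have key : ∀ φ : 𝓢(R3, ℂ),
      (FourierTransform.fourier (-(Δ (f : 𝓢'(R3, ℂ)))) : 𝓢'(R3, ℂ)) φ
        = ∫ ξ, φ ξ • ((symb ξ : ℂ) * four f ξ) := by
    intro φ
    have h0 : FourierTransform.fourier (-(Δ (f : 𝓢'(R3, ℂ))))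
        = ((2 * Real.pi) ^ 2 : ℝ) • TemperedDistribution.smulLeftCLM ℂ
          (fun x : R3 => ((‖x‖ ^ 2 : ℝ) : ℂ)) (four f : 𝓢'(R3, ℂ)) := by
      rw [TemperedDistribution.laplacian_eq_fourierMultiplierCLM,
        TemperedDistribution.fourierMultiplierCLM_apply, neg_smul, neg_neg,
        Lp.fourier_toTemperedDistribution_eq]
      rw [← Complex.coe_smul, FourierTransform.fourier_smul,
        FourierTransform.fourier_fourierInv_eq, Complex.coe_smul]
      rfl
    rw [h0]
    change ((2 * Real.pi) ^ 2 : ℝ) • (TemperedDistribution.smulLeftCLM ℂ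
          (fun x : R3 => ((‖x‖ ^ 2 : ℝ) : ℂ)) (four f : 𝓢'(R3, ℂ))) φ = _
    rw [TemperedDistribution.smulLeftCLM_apply_apply, Lp.toTemperedDistribution_apply,
      ← integral_smul]
    congr 1
    funext ξ
    rw [SchwartzMap.smulLeftCLM_apply_apply hs, ← Complex.coe_smul]
    simp only [symb, smul_eq_mul]
    push_cast
    ring
  have hloc1 : LocallyIntegrable (fun ξ => (symb ξ : ℂ) * four f ξ) volume :=
    ((Lp.memLp (four f)).locallyIntegrable (by norm_num)).continuous_smul
      (Complex.continuous_ofReal.comp continuous_symb)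
  have hloc2 : LocallyIntegrable (four g) volume :=
    (Lp.memLp (four g)).locallyIntegrable (by norm_num)
  constructor
  · intro h
    have h : -(Δ (f : 𝓢'(R3, ℂ))) = (g : 𝓢'(R3, ℂ)) := h
    refine ae_eq_of_integral_contDiff_smul_eq hloc1 hloc2 fun u hu hc => ?_
    have hg₁ : HasCompactSupport (Complex.ofRealCLM ∘ u) := hc.comp_left rfl
    have hg₂ : ContDiff ℝ (⊤ : ℕ∞) (Complex.ofRealCLM ∘ u) :=
      Complex.ofRealCLM.contDiff.comp hu
    have h1 := key (hg₁.toSchwartzMap hg₂)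
    rw [h, Lp.fourier_toTemperedDistribution_eq, Lp.toTemperedDistribution_apply] at h1
    simpa [show four g = FourierTransform.fourier g from rfl] using h1.symm
  · intro h
    have h2 : FourierTransform.fourier (-(Δ (f : 𝓢'(R3, ℂ))))
        = FourierTransform.fourier (g : 𝓢'(R3, ℂ)) := by
      ext φ
      rw [key, Lp.fourier_toTemperedDistribution_eq, Lp.toTemperedDistribution_apply]
      apply integral_congr_ae
      filter_upwards [h] with x hx
      rw [hx]
      rfl
    have h3 := congrArg FourierTransformInv.fourierInv h2
    rwa [FourierTransform.fourierInv_fourier_eq, FourierTransform.fourierInv_fourier_eq] at h3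

/-- The half-line `[0, ∞)` in `ℂ`. -/
def posRay : Set ℂ := Complex.ofReal '' Set.Ici 0

theorem isClosed_posRay : IsClosed posRay :=
  Complex.isometry_ofReal.isClosedEmbedding.isClosedMap _ isClosed_Ici

theorem posRay_nonempty : posRay.Nonempty := ⟨0, 0, by simp⟩

theorem symb_mem_posRay (ξ : R3) : (symb ξ : ℂ) ∈ posRay := ⟨_, symb_nonneg ξ, rfl⟩

theorem infDist_posRay_pos {ζ : ℂ} (hζ : ζ ∉ posRay) : 0 < Metric.infDist ζ posRay :=
  (isClosed_posRay.notMem_iff_infDist_pos posRay_nonempty).1 hζ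

theorem infDist_le_norm_symb_sub (ζ : ℂ) (ξ : R3) :
    Metric.infDist ζ posRay ≤ ‖(symb ξ : ℂ) - ζ‖ := by
  rw [← dist_eq_norm, dist_comm]
  exact Metric.infDist_le_dist_of_mem (symb_mem_posRay ξ)

/-- The multiplier `(4π²|ξ|² - ζ)⁻¹` of the free resolvent. -/
def resSymb (ζ : ℂ) (ξ : R3) : ℂ := ((symb ξ : ℂ) - ζ)⁻¹

theorem norm_resSymb_le {ζ : ℂ} (hζ : ζ ∉ posRay) (ξ : R3) :
    ‖resSymb ζ ξ‖ ≤ (Metric.infDist ζ posRay)⁻¹ := by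
  rw [resSymb, norm_inv]
  exact inv_anti₀ (infDist_posRay_pos hζ) (infDist_le_norm_symb_sub ζ ξ)

theorem symb_sub_ne_zero {ζ : ℂ} (hζ : ζ ∉ posRay) (ξ : R3) : (symb ξ : ℂ) - ζ ≠ 0 := fun h =>
  hζ (sub_eq_zero.1 h ▸ symb_mem_posRay ξ)

theorem measurable_resSymb (ζ : ℂ) : Measurable (resSymb ζ) :=
  ((Complex.continuous_ofReal.comp continuous_symb).sub continuous_const).measurable.inv

theorem isBddMeas_resSymb {ζ : ℂ} (hζ : ζ ∉ posRay) : IsBddMeas (resSymb ζ) :=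
  ⟨measurable_resSymb ζ, _, norm_resSymb_le hζ⟩

/-- The free resolvent `(-Δ - ζ)⁻¹` on `L²`. -/
def freeRes (ζ : ℂ) : L2 →L[ℂ] L2 :=
  (four.symm.toContinuousLinearEquiv : L2 →L[ℂ] L2).comp
    ((mulL (resSymb ζ)).comp (four.toContinuousLinearEquiv : L2 →L[ℂ] L2))

theorem freeRes_apply (ζ : ℂ) (f : L2) : freeRes ζ f = four.symm (mulL (resSymb ζ) (four f)) := rfl

theorem four_freeRes (ζ : ℂ) (f : L2) : four (freeRes ζ f) = mulL (resSymb ζ) (four f) := by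
  rw [freeRes_apply, LinearIsometryEquiv.apply_symm_apply]

theorem norm_freeRes_le {ζ : ℂ} (hζ : ζ ∉ posRay) :
    ‖freeRes ζ‖ ≤ (Metric.infDist ζ posRay)⁻¹ := by
  have h0 : 0 ≤ (Metric.infDist ζ posRay)⁻¹ := inv_nonneg.2 Metric.infDist_nonneg
  refine ContinuousLinearMap.opNorm_le_bound _ h0 fun f => ?_
  rw [freeRes_apply, LinearIsometryEquiv.norm_map]
  refine (ContinuousLinearMap.le_of_opNorm_le _ (norm_mulL_le h0 (norm_resSymb_le hζ)) _).trans ?_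
  rw [LinearIsometryEquiv.norm_map]

theorem differentiableOn_freeRes : DifferentiableOn ℂ freeRes posRayᶜ := by
  refine (differentiableOn_const _).clm_comp (DifferentiableOn.clm_comp ?_ (differentiableOn_const _))
  refine differentiableOn_mulL isClosed_posRay.isOpen_compl (fun z _ => measurable_resSymb z)
    (fun x z hz => ?_) fun z₀ hz₀ => ?_
  · exact (((differentiableAt_const _).sub differentiableAt_id).inv
      (symb_sub_ne_zero hz x)).differentiableWithinAt
  · have hpos := infDist_posRay_pos hz₀
    refine ⟨(Metric.infDist z₀ posRay / 2)⁻¹, ?_⟩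
    have hc : ∀ᶠ z in 𝓝 z₀, Metric.infDist z₀ posRay / 2 < Metric.infDist z posRay :=
      (Metric.continuous_infDist_pt posRay).continuousAt.eventually_const_lt (by linarith)
    filter_upwards [hc, isClosed_posRay.isOpen_compl.mem_nhds hz₀] with z hz hz' x
    exact (norm_resSymb_le hz' x).trans (inv_anti₀ (by positivity) hz.le)

theorem analyticAt_freeRes {ζ : ℂ} (hζ : ζ ∉ posRay) : AnalyticAt ℂ freeRes ζ :=
  differentiableOn_freeRes.analyticAt (isClosed_posRay.isOpen_compl.mem_nhds hζ)

/-- With `σ` the symbol, this is `σ (σ - ζ)⁻¹ = 1 + ζ (σ - ζ)⁻¹`. -/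
theorem freeRes_mem_H2 {ζ : ℂ} (hζ : ζ ∉ posRay) (f : L2) :
    (freeRes ζ f, f + ζ • freeRes ζ f) ∈ H2 := by
  rw [mem_H2_iff, map_add, map_smul, four_freeRes]
  filter_upwards [mulL_ae (isBddMeas_resSymb hζ) (four f),
    Lp.coeFn_add (four f) (ζ • mulL (resSymb ζ) (four f)),
    Lp.coeFn_smul ζ (mulL (resSymb ζ) (four f))] with x h1 h2 h3
  rw [h2, Pi.add_apply, h3, Pi.smul_apply, h1, resSymb, smul_eq_mul]
  have := symb_sub_ne_zero hζ x
  field_simp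
  ring

/-- The free resolvent as a map into `H²`. -/
def freeResH2 (ζ : ℂ) (hζ : ζ ∉ posRay) (f : L2) : H2 :=
  ⟨(freeRes ζ f, f + ζ • freeRes ζ f), freeRes_mem_H2 hζ f⟩

theorem incl_freeResH2 {ζ : ℂ} (hζ : ζ ∉ posRay) (f : L2) :
    incl (freeResH2 ζ hζ f) = freeRes ζ f := rfl

theorem negLaplacian_freeResH2 {ζ : ℂ} (hζ : ζ ∉ posRay) (f : L2) :
    negLaplacian (freeResH2 ζ hζ f) = f + ζ • freeRes ζ f := rfl

theorem four_negLaplacian (p : H2) :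
    (fun ξ => (symb ξ : ℂ) * four (incl p) ξ) =ᵐ[volume] four (negLaplacian p) :=
  (mem_H2_iff _ _).1 p.2

theorem freeRes_negLaplacian {ζ : ℂ} (hζ : ζ ∉ posRay) (p : H2) :
    freeRes ζ (negLaplacian p - ζ • incl p) = incl p := by
  apply four.injective
  rw [four_freeRes, mulL_eq_iff (isBddMeas_resSymb hζ), map_sub, map_smul]
  filter_upwards [four_negLaplacian p,
    Lp.coeFn_sub (four (negLaplacian p)) (ζ • four (incl p)),
    Lp.coeFn_smul ζ (four (incl p))] with x h1 h2 h3
  rw [h2, Pi.sub_apply, h3, Pi.smul_apply, ← h1, resSymb, smul_eq_mul, ← sub_mul,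
    inv_mul_cancel_left₀ (symb_sub_ne_zero hζ x)]

theorem inner_negLaplacian (p q : H2) :
    ⟪negLaplacian p, incl q⟫_ℂ = ⟪incl p, negLaplacian q⟫_ℂ := by
  rw [← four.inner_map_map, ← four.inner_map_map (incl p), L2.inner_def, L2.inner_def]
  apply integral_congr_ae
  filter_upwards [four_negLaplacian p, four_negLaplacian q] with x h1 h2
  rw [← h1, ← h2, RCLike.inner_apply, RCLike.inner_apply, map_mul, Complex.conj_ofReal]
  ring

theorem symb_eq_null (s : ℝ) : ∀ᵐ ξ : R3, symb ξ ≠ s := by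
  have h : {ξ : R3 | ¬ symb ξ ≠ s} ⊆ Metric.sphere 0 (√s / (2 * Real.pi)) := by
    intro ξ hξ
    have hξ : symb ξ = s := not_not.1 hξ
    rw [mem_sphere_zero_iff_norm, ← hξ, symb, ← mul_pow, Real.sqrt_sq (by positivity)]
    field_simp
  exact measure_mono_null h (Measure.addHaar_sphere _ _ _)

/-- `-Δ` has no real eigenvalue. -/
theorem eq_zero_of_negLaplacian_eq {s : ℝ} {p : H2} (h : negLaplacian p = (s : ℂ) • incl p) :
    incl p = 0 := by
  have h1 := four_negLaplacian p
  rw [h, map_smul] at h1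
  have h2 : four (incl p) = 0 := by
    rw [Lp.eq_zero_iff_ae_eq_zero]
    filter_upwards [h1, Lp.coeFn_smul (s : ℂ) (four (incl p)), symb_eq_null s] with x h3 h4 h5
    rw [h4, Pi.smul_apply, smul_eq_mul, ← sub_eq_zero, ← sub_mul] at h3
    refine (mul_eq_zero.1 h3).resolve_left fun h6 => h5 ?_
    exact_mod_cast sub_eq_zero.1 h6
  simpa using h2

/-- Approximate eigenvectors of `-Δ` at every `s ≥ 0`. -/
theorem exists_approx_eigenvector {s : ℝ} (hs : 0 ≤ s) {ε : ℝ} (hε : 0 < ε) :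
    ∃ p : H2, incl p ≠ 0 ∧ ‖negLaplacian p - (s : ℂ) • incl p‖ ≤ ε * ‖incl p‖ := by
  -- A point where the symbol equals `s`. The approximate eigenvector has as Fourier transform the
  -- indicator of a neighbourhood of it, cut by a unit ball to have finite measure.
  set ξ₀ : R3 := EuclideanSpace.single 0 (√s / (2 * Real.pi)) with hξ₀
  have hξ₀s : symb ξ₀ = s := by
    rw [symb, hξ₀, PiLp.norm_single, Real.norm_of_nonneg (by positivity), ← mul_pow,
      mul_div_cancel₀ _ (by positivity), Real.sq_sqrt hs]
  let A : Set R3 := {ξ | |symb ξ - s| < ε} ∩ Metric.ball ξ₀ 1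
  have hAo : IsOpen A :=
    (isOpen_lt (continuous_symb.sub continuous_const).abs continuous_const).inter
      Metric.isOpen_ball
  have hAne : A.Nonempty := ⟨ξ₀, by simp [hξ₀s, hε], Metric.mem_ball_self one_pos⟩
  have hAfin : volume A ≠ ⊤ :=
    ((measure_mono Set.inter_subset_right).trans_lt measure_ball_lt_top).ne
  let h : L2 := indicatorConstLp 2 hAo.measurableSet hAfin (1 : ℂ)
  have hh : h ≠ 0 := by
    intro h0
    have h1 : ‖h‖ = 0 := by rw [h0, norm_zero]
    rw [norm_indicatorConstLp (by norm_num) (by norm_num), norm_one, one_mul] at h1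
    have h2 : 0 < volume.real A := ENNReal.toReal_pos (hAo.measure_pos _ hAne).ne' hAfin
    exact (Real.rpow_pos_of_pos h2 _).ne' h1
  let w : R3 → ℂ := A.indicator fun ξ => ((symb ξ - s : ℝ) : ℂ)
  have hwb : ∀ ξ, ‖w ξ‖ ≤ ε := by
    intro ξ
    by_cases hξ : ξ ∈ A
    · simp only [w, Set.indicator_of_mem hξ, Complex.norm_real, Real.norm_eq_abs]
      exact hξ.1.le
    · simp only [w, Set.indicator_of_notMem hξ, norm_zero, hε.le]
  have hw : IsBddMeas w :=
    ⟨(Complex.continuous_ofReal.comp (continuous_symb.sub continuous_const)).measurable.indicator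
      hAo.measurableSet, ε, hwb⟩
  have hae : ∀ᵐ ξ, h ξ = A.indicator (fun _ => (1 : ℂ)) ξ := indicatorConstLp_coeFn
  have hmem : (four.symm h, four.symm (mulL w h + (s : ℂ) • h)) ∈ H2 := by
    rw [mem_H2_iff, LinearIsometryEquiv.apply_symm_apply, LinearIsometryEquiv.apply_symm_apply]
    filter_upwards [mulL_ae hw h, Lp.coeFn_add (mulL w h) ((s : ℂ) • h),
      Lp.coeFn_smul (s : ℂ) h, hae] with ξ h1 h2 h3 h4
    rw [h2, Pi.add_apply, h1, h3, Pi.smul_apply, smul_eq_mul, h4]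
    by_cases hξ : ξ ∈ A
    · simp [w, hξ]
    · simp [hξ]
  refine ⟨⟨_, hmem⟩, ?_, ?_⟩
  · change four.symm h ≠ 0
    simpa using hh
  · change ‖four.symm (mulL w h + (s : ℂ) • h) - (s : ℂ) • four.symm h‖ ≤ ε * ‖four.symm h‖
    rw [map_add, map_smul, add_sub_cancel_right, LinearIsometryEquiv.norm_map,
      LinearIsometryEquiv.norm_map]
    exact ContinuousLinearMap.le_of_opNorm_le _ (norm_mulL_le hε.le hwb) _

/-! ### Relative compactness of potentials vanishing at infinity -/

/-- On integrable functions in `L²`, the inverse Fourier transform is given by the integral. -/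
theorem four_symm_ae_eq {g : L2} (hg : Integrable g volume) :
    four.symm g =ᵐ[volume] FourierTransformInv.fourierInv (g : R3 → ℂ) := by
  have hLc : Continuous fun p : R3 × R3 => (-innerₗ R3) p.1 p.2 := by
    simp only [LinearMap.neg_apply, innerₗ_apply_apply]
    fun_prop
  have hcont : Continuous (FourierTransformInv.fourierInv (g : R3 → ℂ)) :=
    VectorFourier.fourierIntegral_continuous Real.continuous_fourierChar hLc hg
  refine ae_eq_of_integral_contDiff_smul_eq
    ((Lp.memLp (four.symm g)).locallyIntegrable (by norm_num)) hcont.locallyIntegrable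
    fun u hu hc => ?_
  have hg₁ : HasCompactSupport (Complex.ofRealCLM ∘ u) := hc.comp_left rfl
  have hg₂ : ContDiff ℝ (⊤ : ℕ∞) (Complex.ofRealCLM ∘ u) := Complex.ofRealCLM.contDiff.comp hu
  set φ : 𝓢(R3, ℂ) := hg₁.toSchwartzMap hg₂ with hφ
  have hφu : ∀ x, φ x = (u x : ℂ) := fun x => rfl
  have h1 : (FourierTransformInv.fourierInv (Lp.toTemperedDistribution g) : 𝓢'(R3, ℂ)) φ
      = ∫ x, φ x • four.symm g x := by
    rw [Lp.fourierInv_toTemperedDistribution_eq, Lp.toTemperedDistribution_apply]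
    rfl
  rw [TemperedDistribution.fourierInv_apply, Lp.toTemperedDistribution_apply] at h1
  -- The `L²` transform is known through its pairings with Schwartz functions. Moving the integral
  -- transform onto the test function shows that the two transforms have the same pairings.
  have h2 := VectorFourier.integral_fourierIntegral_smul_eq_flip (L := -innerₗ R3)
    Real.continuous_fourierChar hLc (φ.integrable (μ := volume)) hg
  have hflip : (-innerₗ R3).flip = -innerₗ R3 := by
    ext x y
    simp [real_inner_comm]
  rw [hflip] at h2
  have h3 : ∀ ξ, VectorFourier.fourierIntegral Real.fourierChar volume (-innerₗ R3) φ ξ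
      = (FourierTransformInv.fourierInv φ : 𝓢(R3, ℂ)) ξ := by
    intro ξ
    rw [SchwartzMap.fourierInv_coe]
    rfl
  simp only [h3] at h2
  rw [h1] at h2
  have h4 : ∀ x, VectorFourier.fourierIntegral Real.fourierChar volume (-innerₗ R3) (g : R3 → ℂ) x
      = FourierTransformInv.fourierInv (g : R3 → ℂ) x := fun x => rfl
  simpa only [hφu, h4, smul_eq_mul, Complex.real_smul] using h2

/-- Functions with bounded support. -/
def HasBddSupport (v : R3 → ℂ) : Prop := ∃ R : ℝ, ∀ x, R < ‖x‖ → v x = 0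

theorem IsBddMeas.memLp_of_support {v : R3 → ℂ} (hv : IsBddMeas v) (hs : HasBddSupport v)
    (p : ℝ≥0∞) : MemLp v p volume := by
  obtain ⟨hm, M, hM⟩ := hv
  obtain ⟨R, hR⟩ := hs
  refine (memLp_indicator_const p (measurableSet_closedBall (x := (0 : R3)) (ε := R)) (M : ℝ)
    (Or.inr measure_closedBall_lt_top.ne)).mono hm.aestronglyMeasurable
    (Eventually.of_forall fun x => ?_)
  by_cases hx : x ∈ Metric.closedBall (0 : R3) R
  · rw [Set.indicator_of_mem hx]
    exact (hM x).trans (le_abs_self M)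
  · rw [hR x (by simpa using hx)]
    simp

/-- The character `ξ ↦ e^{-2πi⟨ξ, x⟩}`. -/
def character (x ξ : R3) : ℂ := Complex.exp (-(2 * Real.pi * inner ℝ ξ x : ℝ) * Complex.I)

theorem norm_character (x ξ : R3) : ‖character x ξ‖ = 1 := by
  rw [character, ← Complex.ofReal_neg, Complex.norm_exp_ofReal_mul_I]

theorem measurable_character (x : R3) : Measurable (character x) := by
  unfold character
  exact (by fun_prop : Continuous fun ξ : R3 =>
    Complex.exp (-(2 * Real.pi * inner ℝ ξ x : ℝ) * Complex.I)).measurable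

theorem isBddMeas_character (x : R3) : IsBddMeas (character x) :=
  ⟨measurable_character x, 1, fun ξ => (norm_character x ξ).le⟩

theorem norm_character_sub_le (x y ξ : R3) :
    ‖character x ξ - character y ξ‖ ≤ 2 * Real.pi * ‖ξ‖ * ‖x - y‖ := by
  have h1 : character x ξ - character y ξ = character y ξ *
      (Complex.exp (Complex.I * ((-(2 * Real.pi * inner ℝ ξ (x - y))) : ℝ)) - 1) := by
    rw [mul_sub, mul_one, character, character, ← Complex.exp_add, inner_sub_right]
    congr 2
    push_cast
    ring
  rw [h1, norm_mul, norm_character, one_mul]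
  refine (Real.norm_exp_I_mul_ofReal_sub_one_le).trans ?_
  rw [norm_neg, norm_mul, Real.norm_of_nonneg (show 0 ≤ 2 * Real.pi by positivity),
    mul_assoc (2 * Real.pi) ‖ξ‖]
  exact mul_le_mul_of_nonneg_left (norm_inner_le_norm ξ (x - y)) (by positivity)

/-- `v(x) w(-i∇)` is compact if both `v` and `w` are bounded with bounded support. -/
theorem isCompactOperator_mul_four_mul_of_support {v w : R3 → ℂ} (hv : IsBddMeas v)
    (hw : IsBddMeas w) (hvs : HasBddSupport v) (hws : HasBddSupport w) :
    IsCompactOperator ((mulL v).comp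
      ((four.symm.toContinuousLinearEquiv : L2 →L[ℂ] L2).comp (mulL w))) := by
  set T : L2 →L[ℂ] L2 := (mulL v).comp
    ((four.symm.toContinuousLinearEquiv : L2 →L[ℂ] L2).comp (mulL w)) with hT
  have hTap : ∀ h, T h = mulL v (four.symm (mulL w h)) := fun h => rfl
  let wc : R3 → ℂ := fun ξ => starRingEnd ℂ (w ξ)
  have hwcb : IsBddMeas wc := by
    obtain ⟨hm, M, hM⟩ := hw
    exact ⟨Complex.continuous_conj.measurable.comp hm, M, fun x => by
      simpa only [wc, RCLike.norm_conj] using hM x⟩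
  obtain ⟨R, hR⟩ := id hws
  have hwcs : HasBddSupport wc := ⟨R, fun x hx => by simp only [wc, hR x hx, map_zero]⟩
  let W : L2 := (hwcb.memLp_of_support hwcs 2).toLp wc
  have hWae : W =ᵐ[volume] wc := (hwcb.memLp_of_support hwcs 2).coeFn_toLp
  -- The operator has the form `h ↦ v(x) ⟪Φ x, h⟫`. The conjugate of `w` and the negative exponent
  -- compensate for conjugate-linearity in the first slot.
  let Φ : R3 → L2 := fun x => mulL (character x) W
  have hΦae : ∀ x, Φ x =ᵐ[volume] fun ξ => character x ξ * wc ξ := fun x => by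
    filter_upwards [mulL_ae (isBddMeas_character x) W, hWae] with ξ h1 h2
    rw [h1, h2]
  have hΦlip : ∀ x y, ‖Φ x - Φ y‖ ≤ 2 * Real.pi * |R| * ‖x - y‖ * ‖W‖ := by
    intro x y
    refine Lp.norm_le_mul_norm_of_ae_le_mul ?_
    filter_upwards [Lp.coeFn_sub (Φ x) (Φ y), hΦae x, hΦae y, hWae] with ξ h1 h2 h3 h4
    rw [h1, Pi.sub_apply, h2, h3, h4, ← sub_mul, norm_mul]
    by_cases hξ : R < ‖ξ‖
    · simp [wc, hR ξ hξ]
    · refine mul_le_mul_of_nonneg_right ((norm_character_sub_le x y ξ).trans ?_) (norm_nonneg _)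
      have : ‖ξ‖ ≤ |R| := (not_lt.1 hξ).trans (le_abs_self R)
      gcongr
  have hΦc : Continuous Φ := by
    refine (LipschitzWith.of_dist_le_mul (K := Real.toNNReal (2 * Real.pi * |R| * ‖W‖))
      fun x y => ?_).continuous
    rw [dist_eq_norm, dist_eq_norm, Real.coe_toNNReal _ (by positivity)]
    exact (hΦlip x y).trans (by linarith)
  have hformula : ∀ h : L2, T h =ᵐ[volume] fun x => v x * ⟪Φ x, h⟫_ℂ := by
    intro h
    have hwmul : mulL w h =ᵐ[volume] fun ξ => w ξ * h ξ := mulL_ae hw h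
    have hint : Integrable (mulL w h) volume := by
      rw [integrable_congr hwmul]
      have := MemLp.mul (p := 2) (q := 2) (r := 1) (Lp.memLp h) (hw.memLp_of_support hws 2)
      exact memLp_one_iff_integrable.1 this
    filter_upwards [mulL_ae hv (four.symm (mulL w h)), four_symm_ae_eq hint] with x h1 h2
    rw [hTap, h1, h2, Real.fourierInv_eq, L2.inner_def]
    congr 1
    apply integral_congr_ae
    filter_upwards [hwmul, hΦae x] with ξ h3 h4
    rw [h3, h4, RCLike.inner_apply, map_mul, Circle.smul_def, Real.fourierChar_apply, smul_eq_mul]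
    simp only [wc, Complex.conj_conj, character]
    rw [← Complex.exp_conj]
    simp only [map_mul, map_neg, Complex.conj_ofReal, Complex.conj_I]
    rw [neg_mul_neg]
    ring
  obtain ⟨Rv, hRv⟩ := id hvs
  let vL : L2 := (hv.memLp_of_support hvs 2).toLp v
  have hvLae : vL =ᵐ[volume] v := (hv.memLp_of_support hvs 2).coeFn_toLp
  -- Only `x` in the support of `v` matters, so the relevant `Φ x` form a compact set, uniformly
  -- close to a finite-dimensional `U`. Composing `T` with the projection onto `U` then gives
  -- finite-rank approximants in norm.
  have htb : TotallyBounded (Φ '' Metric.closedBall 0 Rv) :=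
    ((isCompact_closedBall _ _).image hΦc).totallyBounded
  have hclosed : IsClosed {S : L2 →L[ℂ] L2 | IsCompactOperator S} :=
    isClosed_setOfPred_isCompactOperator
  refine hclosed.closure_subset (Metric.mem_closure_iff.2 fun ε hε => ?_)
  obtain ⟨U, hU, hUapp⟩ := htb.exists_finiteDimensional_approx
    (ε := ε / 2 / (‖vL‖ + 1)) (by positivity)
  refine ⟨T.comp U.starProjection, ?_, ?_⟩
  · have h1 : IsCompactOperator (U.orthogonalProjectionOnto : L2 →L[ℂ] U) :=
      isCompactOperator_of_locallyCompactSpace_dom U.orthogonalProjectionOnto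
    exact (h1.clm_comp U.subtypeL).clm_comp T
  · rw [dist_eq_norm]
    refine lt_of_le_of_lt (ContinuousLinearMap.opNorm_le_bound _ (M := ε / 2) (by positivity)
      fun h => ?_) (by linarith)
    have h1 : (T - T.comp U.starProjection) h = T (h - U.starProjection h) := by
      rw [map_sub]; rfl
    rw [h1]
    have h2 : ‖T (h - U.starProjection h)‖ ≤ (ε / 2 / (‖vL‖ + 1) * ‖h‖) * ‖vL‖ := by
      refine Lp.norm_le_mul_norm_of_ae_le_mul ?_
      filter_upwards [hformula (h - U.starProjection h), hvLae] with x h3 h4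
      rw [h3, h4, norm_mul, mul_comm]
      by_cases hx : Rv < ‖x‖
      · simp [hRv x hx]
      · refine mul_le_mul_of_nonneg_right ?_ (norm_nonneg _)
        -- Self-adjointness moves the projection from `h` to `Φ x`, where the approximation is
        -- uniform.
        have h5 : ⟪Φ x, h - U.starProjection h⟫_ℂ = ⟪Φ x - U.starProjection (Φ x), h⟫_ℂ := by
          rw [inner_sub_right, inner_sub_left, U.inner_starProjection_left_eq_right]
        rw [h5]
        refine (norm_inner_le_norm _ _).trans (mul_le_mul_of_nonneg_right ?_ (norm_nonneg _))
        exact hUapp _ ⟨x, by simpa using hx, rfl⟩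
    refine h2.trans ?_
    have h6 : ‖vL‖ / (‖vL‖ + 1) ≤ 1 := div_le_one_of_le₀ (by linarith) (by positivity)
    calc ε / 2 / (‖vL‖ + 1) * ‖h‖ * ‖vL‖ = ε / 2 * ‖h‖ * (‖vL‖ / (‖vL‖ + 1)) := by ring
      _ ≤ ε / 2 * ‖h‖ * 1 := by gcongr
      _ = ε / 2 * ‖h‖ := mul_one _

/-- Functions vanishing at infinity. -/
def Vanishes (v : R3 → ℂ) : Prop := ∀ ε > 0, ∃ R : ℝ, ∀ x, R < ‖x‖ → ‖v x‖ ≤ ε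

theorem exists_truncation {v : R3 → ℂ} (hv : IsBddMeas v) (hv0 : Vanishes v) {ε : ℝ}
    (hε : 0 < ε) :
    ∃ v', IsBddMeas v' ∧ HasBddSupport v' ∧ ‖mulL v - mulL v'‖ ≤ ε := by
  obtain ⟨R, hR⟩ := hv0 ε hε
  have hv' : IsBddMeas ((Metric.closedBall (0 : R3) R).indicator v) := by
    obtain ⟨hm, M, hM⟩ := hv
    exact ⟨hm.indicator measurableSet_closedBall, M, fun x =>
      (norm_indicator_le_norm_self _ _).trans (hM x)⟩
  refine ⟨(Metric.closedBall (0 : R3) R).indicator v, hv',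
    ⟨R, fun x hx => Set.indicator_of_notMem (by simpa using hx) _⟩, ?_⟩
  rw [← mulL_sub hv hv']
  refine norm_mulL_le hε.le fun x => ?_
  by_cases hx : x ∈ Metric.closedBall (0 : R3) R
  · rw [Set.indicator_of_mem hx, sub_self, norm_zero]
    exact hε.le
  · rw [Set.indicator_of_notMem hx, sub_zero]
    exact hR x (by simpa using hx)

/-- `v(x) w(-i∇)` is compact if both `v` and `w` are bounded and vanish at infinity. -/
theorem isCompactOperator_mul_four_mul {v w : R3 → ℂ} (hv : IsBddMeas v)
    (hw : IsBddMeas w) (hv0 : Vanishes v) (hw0 : Vanishes w) :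
    IsCompactOperator ((mulL v).comp
      ((four.symm.toContinuousLinearEquiv : L2 →L[ℂ] L2).comp (mulL w))) := by
  set J : L2 →L[ℂ] L2 := (four.symm.toContinuousLinearEquiv : L2 →L[ℂ] L2)
  have hclosed : IsClosed {S : L2 →L[ℂ] L2 | IsCompactOperator S} :=
    isClosed_setOfPred_isCompactOperator
  have hstep : ∀ v', IsBddMeas v' → HasBddSupport v' →
      IsCompactOperator ((mulL v').comp (J.comp (mulL w))) := by
    intro v' hv' hv's
    refine hclosed.closure_subset (Metric.mem_closure_iff.2 fun ε hε => ?_)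
    obtain ⟨w', hw', hw's, hww'⟩ := exists_truncation hw hw0
      (ε := ε / 2 / (‖(mulL v').comp J‖ + 1)) (by positivity)
    refine ⟨_, isCompactOperator_mul_four_mul_of_support hv' hw' hv's hw's, ?_⟩
    have h1 : (mulL v').comp (J.comp (mulL w)) - (mulL v').comp (J.comp (mulL w'))
        = ((mulL v').comp J).comp (mulL w - mulL w') := by
      simp only [ContinuousLinearMap.comp_sub, ContinuousLinearMap.comp_assoc]
    rw [dist_eq_norm, h1]
    refine (ContinuousLinearMap.opNorm_comp_le _ _).trans_lt ?_
    have h6 : ‖(mulL v').comp J‖ / (‖(mulL v').comp J‖ + 1) ≤ 1 :=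
      div_le_one_of_le₀ (by linarith) (by positivity)
    calc ‖(mulL v').comp J‖ * ‖mulL w - mulL w'‖
        ≤ ‖(mulL v').comp J‖ * (ε / 2 / (‖(mulL v').comp J‖ + 1)) := by gcongr
      _ = ε / 2 * (‖(mulL v').comp J‖ / (‖(mulL v').comp J‖ + 1)) := by ring
      _ ≤ ε / 2 * 1 := by gcongr
      _ < ε := by linarith
  refine hclosed.closure_subset (Metric.mem_closure_iff.2 fun ε hε => ?_)
  obtain ⟨v', hv', hv's, hvv'⟩ := exists_truncation hv hv0
    (ε := ε / 2 / (‖J.comp (mulL w)‖ + 1)) (by positivity)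
  refine ⟨_, hstep v' hv' hv's, ?_⟩
  rw [dist_eq_norm, ← ContinuousLinearMap.sub_comp]
  refine (ContinuousLinearMap.opNorm_comp_le _ _).trans_lt ?_
  have h6 : ‖J.comp (mulL w)‖ / (‖J.comp (mulL w)‖ + 1) ≤ 1 :=
    div_le_one_of_le₀ (by linarith) (by positivity)
  calc ‖mulL v - mulL v'‖ * ‖J.comp (mulL w)‖
      ≤ (ε / 2 / (‖J.comp (mulL w)‖ + 1)) * ‖J.comp (mulL w)‖ := by gcongr
    _ = ε / 2 * (‖J.comp (mulL w)‖ / (‖J.comp (mulL w)‖ + 1)) := by ring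
    _ ≤ ε / 2 * 1 := by gcongr
    _ < ε := by linarith

theorem vanishes_resSymb (ζ : ℂ) : Vanishes (resSymb ζ) := by
  intro ε hε
  refine ⟨‖ζ‖ + ε⁻¹ + 1, fun ξ hξ => ?_⟩
  have hε' : 0 < ε⁻¹ := inv_pos.2 hε
  have h1 : ‖ξ‖ ≤ symb ξ := by
    have h2 : 1 ≤ ‖ξ‖ := by linarith [norm_nonneg ζ]
    have h3 : 1 ≤ (2 * Real.pi) ^ 2 := by nlinarith [Real.pi_gt_three]
    unfold symb
    nlinarith
  have h4 : ε⁻¹ ≤ ‖(symb ξ : ℂ) - ζ‖ := by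
    have := norm_sub_norm_le (symb ξ : ℂ) ζ
    rw [Complex.norm_real, Real.norm_of_nonneg (symb_nonneg ξ)] at this
    linarith
  rw [resSymb, norm_inv]
  exact inv_le_of_inv_le₀ hε h4

/-- A bounded potential vanishing at infinity is relatively compact with respect to `-Δ`. -/
theorem isCompactOperator_mulL_freeRes {v : R3 → ℂ} (hv : IsBddMeas v) (hv0 : Vanishes v) {ζ : ℂ}
    (hζ : ζ ∉ posRay) : IsCompactOperator (mulL v * freeRes ζ) :=
  (isCompactOperator_mul_four_mul hv (isBddMeas_resSymb hζ) hv0 (vanishes_resSymb ζ)).comp_clm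
    (four.toContinuousLinearEquiv : L2 →L[ℂ] L2)

/-! ### The dilatation group -/

/-- Null sets stay null under scaling, so almost-everywhere identities may be composed with it. -/
theorem quasiMeasurePreserving_smul (t : ℝ) :
    Measure.QuasiMeasurePreserving (fun x : R3 => Real.exp t • x) volume volume := by
  refine ⟨measurable_const_smul _, ?_⟩
  rw [Measure.map_addHaar_smul volume (Real.exp_pos t).ne']
  exact Measure.smul_absolutelyContinuous

theorem integral_comp_exp_smul {E : Type*} [NormedAddCommGroup E] [NormedSpace ℝ E]
    (t : ℝ) (F : R3 → E) :
    ∫ x, F (Real.exp t • x) = Real.exp (-(3 * t)) • ∫ x, F x := by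
  rw [Measure.integral_comp_smul, finrank_euclideanSpace_fin, ← Real.exp_nat_mul, ← Real.exp_neg,
    abs_of_pos (Real.exp_pos _)]
  norm_num

theorem dilate_ae (t : ℝ) (f : L2) :
    dilate t f =ᵐ[volume] fun x => ((Real.exp (3 * t / 2) : ℝ) : ℂ) * f (Real.exp t • x) :=
  (memLp_dilate t f).coeFn_toLp

theorem ae_comp_smul (t : ℝ) {p : R3 → Prop} (h : ∀ᵐ x, p x) : ∀ᵐ x : R3, p (Real.exp t • x) :=
  (quasiMeasurePreserving_smul t).ae h

theorem dilate_add (t : ℝ) (f g : L2) : dilate t (f + g) = dilate t f + dilate t g := by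
  apply Lp.ext
  filter_upwards [dilate_ae t (f + g), dilate_ae t f, dilate_ae t g,
    Lp.coeFn_add (dilate t f) (dilate t g), ae_comp_smul t (Lp.coeFn_add f g)] with x h1 h2 h3 h4 h5
  rw [h1, h4, Pi.add_apply, h2, h3, h5, Pi.add_apply, mul_add]

theorem dilate_smul (t : ℝ) (c : ℂ) (f : L2) : dilate t (c • f) = c • dilate t f := by
  apply Lp.ext
  filter_upwards [dilate_ae t (c • f), dilate_ae t f, Lp.coeFn_smul c (dilate t f),
    ae_comp_smul t (Lp.coeFn_smul c f)] with x h1 h2 h4 h5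
  rw [h1, h4, Pi.smul_apply, h2, h5, Pi.smul_apply, smul_eq_mul, smul_eq_mul]
  ring_nf

theorem dilate_dilate (s t : ℝ) (f : L2) : dilate s (dilate t f) = dilate (s + t) f := by
  apply Lp.ext
  filter_upwards [dilate_ae s (dilate t f), dilate_ae (s + t) f,
    ae_comp_smul s (dilate_ae t f)] with x h1 h2 h3
  rw [h1, h2, h3, smul_smul, ← Real.exp_add, ← mul_assoc, ← Complex.ofReal_mul, ← Real.exp_add]
  ring_nf

theorem dilate_zero (f : L2) : dilate 0 f = f := by
  apply Lp.ext
  filter_upwards [dilate_ae 0 f] with x h1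
  rw [h1]
  simp

theorem inner_dilate (t : ℝ) (f g : L2) : ⟪dilate t f, dilate t g⟫_ℂ = ⟪f, g⟫_ℂ := by
  rw [L2.inner_def, L2.inner_def]
  have h1 : ∫ x, ⟪dilate t f x, dilate t g x⟫_ℂ
      = ∫ x, (fun y => ((Real.exp (3 * t) : ℝ) : ℂ) * ⟪f y, g y⟫_ℂ) (Real.exp t • x) := by
    apply integral_congr_ae
    filter_upwards [dilate_ae t f, dilate_ae t g] with x h1 h2
    rw [h1, h2]
    have : (3 * t : ℝ) = 3 * t / 2 + 3 * t / 2 := by ring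
    rw [this, Real.exp_add]
    simp only [RCLike.inner_apply, map_mul, Complex.conj_ofReal, Complex.ofReal_mul]
    ring_nf
  rw [h1, integral_comp_exp_smul t (fun y => ((Real.exp (3 * t) : ℝ) : ℂ) * ⟪f y, g y⟫_ℂ),
    integral_const_mul, ← Complex.coe_smul, smul_eq_mul, ← mul_assoc,
    ← Complex.ofReal_mul, ← Real.exp_add, neg_add_cancel, Real.exp_zero, Complex.ofReal_one, one_mul]

/-- The dilatation as a unitary operator. -/
def dil (t : ℝ) : L2 ≃ₗᵢ[ℂ] L2 where
  toFun := dilate t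
  invFun := dilate (-t)
  map_add' := dilate_add t
  map_smul' := dilate_smul t
  left_inv f := by rw [dilate_dilate, neg_add_cancel, dilate_zero]
  right_inv f := by rw [dilate_dilate, add_neg_cancel, dilate_zero]
  norm_map' f := by
    change ‖dilate t f‖ = ‖f‖
    rw [@norm_eq_sqrt_re_inner ℂ, @norm_eq_sqrt_re_inner ℂ, inner_dilate]

theorem dil_apply (t : ℝ) (f : L2) : dil t f = dilate t f := rfl

theorem dil_dil (s t : ℝ) (f : L2) : dil s (dil t f) = dil (s + t) f := dilate_dilate s t f

theorem dil_zero (f : L2) : dil 0 f = f := dilate_zero f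

theorem dil_neg_dil (t : ℝ) (f : L2) : dil (-t) (dil t f) = f := by
  rw [dil_dil, neg_add_cancel, dil_zero]

theorem dil_dil_neg (t : ℝ) (f : L2) : dil t (dil (-t) f) = f := by
  rw [dil_dil, add_neg_cancel, dil_zero]

theorem IsBddMeas.comp_smul {v : R3 → ℂ} (hv : IsBddMeas v) (t : ℝ) :
    IsBddMeas (fun x => v (Real.exp t • x)) := by
  obtain ⟨hm, M, hM⟩ := hv
  exact ⟨hm.comp (measurable_const_smul _), M, fun x => hM _⟩

theorem dil_mulL {v : R3 → ℂ} (hv : IsBddMeas v) (t : ℝ) (f : L2) :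
    dil t (mulL v f) = mulL (fun x => v (Real.exp t • x)) (dil t f) := by
  apply Lp.ext
  rw [dil_apply, dil_apply]
  filter_upwards [dilate_ae t (mulL v f), mulL_ae (hv.comp_smul t) (dilate t f), dilate_ae t f,
    ae_comp_smul t (mulL_ae hv f)] with x h1 h2 h3 h4
  rw [h1, h2, h3, h4]
  ring_nf

/-- A change of variables puts the scaling on the test function; the normalisation `e^{3t/2}` and
the Jacobian `e^{-3t}` combine to `e^{-3t/2}`. -/
theorem toTemperedDistribution_dilate (t : ℝ) (f : L2) (φ : 𝓢(R3, ℂ)) :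
    (dilate t f : 𝓢'(R3, ℂ)) φ = ((Real.exp (-(3 * t / 2)) : ℝ) : ℂ) *
      (f : 𝓢'(R3, ℂ)) (SchwartzMap.compCLMOfContinuousLinearEquiv ℂ
        (ContinuousLinearEquiv.smulLeft (Units.mk0 (Real.exp (-t)) (Real.exp_pos _).ne')) φ) := by
  rw [Lp.toTemperedDistribution_apply, Lp.toTemperedDistribution_apply]
  have h1 : ∫ x, φ x • dilate t f x = ∫ x, (fun y => ((Real.exp (3 * t / 2) : ℝ) : ℂ) *
      (φ (Real.exp (-t) • y) * f y)) (Real.exp t • x) := by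
    apply integral_congr_ae
    filter_upwards [dilate_ae t f] with x h1
    simp only [h1, smul_smul, smul_eq_mul, ← Real.exp_add, neg_add_cancel, Real.exp_zero, one_smul]
    ring_nf
  rw [h1, integral_comp_exp_smul t (fun y => ((Real.exp (3 * t / 2) : ℝ) : ℂ) *
      (φ (Real.exp (-t) • y) * f y)), integral_const_mul, ← Complex.coe_smul, smul_eq_mul,
    ← mul_assoc, ← Complex.ofReal_mul, ← Real.exp_add]
  congr 3
  ring_nf

open LineDeriv in
theorem laplacian_comp_smul (c : ℝ) (hc : c ≠ 0) (φ : 𝓢(R3, ℂ)) :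
    Δ (SchwartzMap.compCLMOfContinuousLinearEquiv ℂ
        (ContinuousLinearEquiv.smulLeft (Units.mk0 c hc)) φ)
      = ((c ^ 2 : ℝ) : ℂ) • SchwartzMap.compCLMOfContinuousLinearEquiv ℂ
        (ContinuousLinearEquiv.smulLeft (Units.mk0 c hc) : R3 ≃L[ℝ] R3) (Δ φ) := by
  have h0 : ∀ m : R3, (ContinuousLinearEquiv.smulLeft (Units.mk0 c hc) : R3 ≃L[ℝ] R3) m = c • m :=
    fun m => rfl
  rw [SchwartzMap.laplacian_eq_sum (stdOrthonormalBasis ℝ R3),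
    SchwartzMap.laplacian_eq_sum (stdOrthonormalBasis ℝ R3), map_sum, Finset.smul_sum]
  refine Finset.sum_congr rfl fun i _ => ?_
  rw [SchwartzMap.lineDerivOp_compCLMOfContinuousLinearEquiv,
    SchwartzMap.lineDerivOp_compCLMOfContinuousLinearEquiv, h0, lineDerivOp_left_smul,
    lineDerivOp_left_smul, lineDerivOp_smul, smul_smul, ← pow_two, Complex.coe_smul]
  ext x
  rfl

/-- By duality this is the scaling law of the Laplacian on Schwartz functions. -/
theorem dil_mem_H2 (t : ℝ) {f g : L2} (h : (f, g) ∈ H2) :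
    (dil t f, ((Real.exp (2 * t) : ℝ) : ℂ) • dil t g) ∈ H2 := by
  have h : -(Δ (f : 𝓢'(R3, ℂ))) = (g : 𝓢'(R3, ℂ)) := h
  change -(Δ (dilate t f : 𝓢'(R3, ℂ))) = ((((Real.exp (2 * t) : ℝ) : ℂ) • dilate t g : L2) :
    𝓢'(R3, ℂ))
  rw [← dilate_smul]
  ext φ
  set e : R3 ≃L[ℝ] R3 :=
    ContinuousLinearEquiv.smulLeft (Units.mk0 (Real.exp (-t)) (Real.exp_pos _).ne') with he
  rw [toTemperedDistribution_dilate]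
  change -((Δ (dilate t f : 𝓢'(R3, ℂ))) φ) = _
  rw [TemperedDistribution.laplacian_apply_apply, toTemperedDistribution_dilate, ← he]
  have h1 := laplacian_comp_smul (Real.exp (-t)) (Real.exp_pos _).ne' φ
  rw [← he] at h1
  have h2 : SchwartzMap.compCLMOfContinuousLinearEquiv ℂ e (Δ φ)
      = ((Real.exp (2 * t) : ℝ) : ℂ) • Δ (SchwartzMap.compCLMOfContinuousLinearEquiv ℂ e φ) := by
    rw [h1, smul_smul, ← Complex.ofReal_mul, ← Real.exp_nat_mul, ← Real.exp_add]
    simp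
  rw [h2, map_smul, ← TemperedDistribution.laplacian_apply_apply]
  have h3 : ∀ ψ : 𝓢(R3, ℂ), (Δ (f : 𝓢'(R3, ℂ))) ψ = -((g : 𝓢'(R3, ℂ)) ψ) := fun ψ => by
    rw [← h]
    change _ = - -_
    rw [neg_neg]
    rfl
  have h4 : (((((Real.exp (2 * t) : ℝ) : ℂ) • g : L2)) : 𝓢'(R3, ℂ))
      = ((Real.exp (2 * t) : ℝ) : ℂ) • (g : 𝓢'(R3, ℂ)) :=
    map_smul (Lp.toTemperedDistributionCLM ℂ (volume : Measure R3) 2) _ g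
  rw [h3, h4]
  simp only [smul_apply, smul_eq_mul]
  ring_nf

/-- The action of dilatations on `H²`. -/
def dilH2 (t : ℝ) (p : H2) : H2 :=
  ⟨(dil t (incl p), ((Real.exp (2 * t) : ℝ) : ℂ) • dil t (negLaplacian p)), dil_mem_H2 t p.2⟩

theorem incl_dilH2 (t : ℝ) (p : H2) : incl (dilH2 t p) = dil t (incl p) := rfl

theorem negLaplacian_dilH2 (t : ℝ) (p : H2) :
    negLaplacian (dilH2 t p) = ((Real.exp (2 * t) : ℝ) : ℂ) • dil t (negLaplacian p) := rfl

theorem tendsto_dil_zero_of_hasCompactSupport {g : R3 → ℂ} (hg : Continuous g)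
    (hc : HasCompactSupport g) (hm : MemLp g 2 volume) :
    Tendsto (fun t => dil t (hm.toLp g)) (𝓝 0) (𝓝 (hm.toLp g)) := by
  obtain ⟨M, hM⟩ := hc.exists_bound_of_continuous hg
  have hM0 : 0 ≤ M := (norm_nonneg _).trans (hM 0)
  obtain ⟨R, hR⟩ := hc.isCompact.isBounded.subset_closedBall 0
  have hsupp : ∀ x, R < ‖x‖ → g x = 0 := fun x hx => by
    by_contra h
    have := hR (subset_closure (Function.mem_support.2 h))
    rw [mem_closedBall_zero_iff] at this
    linarith
  set F : ℝ → R3 → ℂ := fun t x => ((Real.exp (3 * t / 2) : ℝ) : ℂ) * g (Real.exp t • x) - g x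
    with hF
  have hFc : ∀ x, Continuous fun t => F t x := fun x => by fun_prop
  have hnorm : ∀ t, ‖dil t (hm.toLp g) - hm.toLp g‖ ^ 2 = ∫ x, ‖F t x‖ ^ 2 := by
    intro t
    rw [← @inner_self_eq_norm_sq ℂ, L2.inner_def,
      ← integral_re (L2.integrable_inner _ _)]
    apply integral_congr_ae
    filter_upwards [Lp.coeFn_sub (dil t (hm.toLp g)) (hm.toLp g), dilate_ae t (hm.toLp g),
      hm.coeFn_toLp, ae_comp_smul t hm.coeFn_toLp] with x h1 h2 h3 h4
    rw [h1, Pi.sub_apply, dil_apply, h2, h3, h4, inner_self_eq_norm_sq]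
  have hlim : Tendsto (fun t => ∫ x, ‖F t x‖ ^ 2) (𝓝 0) (𝓝 (∫ x, ‖F 0 x‖ ^ 2)) := by
    have hE : 0 ≤ Real.exp 1 * |R| := by positivity
    -- For `|t| < 1` both `g` and its dilate vanish outside the ball of radius `e |R|`, and
    -- `e^{3t/2} ≤ e²`.
    refine tendsto_integral_filter_of_dominated_convergence
      ((Metric.closedBall (0 : R3) (Real.exp 1 * |R|)).indicator
        fun _ => (Real.exp 2 * M + M) ^ 2) ?_ ?_ ?_ ?_
    · refine Eventually.of_forall fun t => ?_
      have : Continuous fun x => ‖F t x‖ ^ 2 := by fun_prop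
      exact this.aestronglyMeasurable
    · filter_upwards [Metric.ball_mem_nhds (0 : ℝ) one_pos] with t ht
      refine Eventually.of_forall fun x => ?_
      rw [mem_ball_zero_iff, Real.norm_eq_abs, abs_lt] at ht
      rw [Real.norm_of_nonneg (by positivity)]
      by_cases hx : x ∈ Metric.closedBall (0 : R3) (Real.exp 1 * |R|)
      · rw [Set.indicator_of_mem hx]
        gcongr
        refine (norm_sub_le _ _).trans (add_le_add ?_ (hM x))
        rw [norm_mul, Complex.norm_real, Real.norm_of_nonneg (Real.exp_pos _).le]
        gcongr
        · linarith
        · exact hM _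
      · rw [Set.indicator_of_notMem hx]
        rw [mem_closedBall_zero_iff, not_le] at hx
        have h1 : R < ‖x‖ := by
          have : |R| ≤ Real.exp 1 * |R| :=
            le_mul_of_one_le_left (abs_nonneg _) (Real.one_le_exp zero_le_one)
          linarith [le_abs_self R]
        have h2 : R < ‖Real.exp t • x‖ := by
          rw [norm_smul, Real.norm_of_nonneg (Real.exp_pos _).le]
          have h3 : Real.exp (-1) ≤ Real.exp t := Real.exp_le_exp.2 ht.1.le
          have h4 : |R| < Real.exp (-1) * ‖x‖ := by
            have := mul_lt_mul_of_pos_left hx (Real.exp_pos (-1))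
            rwa [← mul_assoc, ← Real.exp_add, neg_add_cancel, Real.exp_zero, one_mul] at this
          have h5 := mul_le_mul_of_nonneg_right h3 (norm_nonneg x)
          linarith [le_abs_self R]
        simp only [hF, hsupp x h1, hsupp _ h2]
        simp
    · exact (integrable_indicator_iff measurableSet_closedBall).2
        (integrableOn_const measure_closedBall_lt_top.ne)
    · refine Eventually.of_forall fun x => ?_
      exact ((hFc x).norm.pow 2).tendsto 0
  have h0 : ∫ x, ‖F 0 x‖ ^ 2 = 0 := by simp [hF]
  rw [h0] at hlim
  rw [tendsto_iff_norm_sub_tendsto_zero]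
  simp_rw [← hnorm] at hlim
  have := hlim.sqrt
  simpa [Real.sqrt_sq] using this

theorem tendsto_dil_zero (f : L2) : Tendsto (fun t => dil t f) (𝓝 0) (𝓝 f) := by
  rw [Metric.tendsto_nhds]
  intro ε hε
  obtain ⟨g, hgc, hfg, hg, hgm⟩ := (Lp.memLp f).exists_hasCompactSupport_eLpNorm_sub_le
    (by norm_num) (ε := ENNReal.ofReal (ε / 3)) (by simpa using hε)
  set G : L2 := hgm.toLp g with hG
  have hd : ‖f - G‖ ≤ ε / 3 := by
    have : f - G = ((Lp.memLp f).sub hgm).toLp _ := by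
      rw [MemLp.toLp_sub (Lp.memLp f) hgm, Lp.toLp_coeFn]
    rw [this, Lp.norm_toLp]
    exact ENNReal.toReal_le_of_le_ofReal (by positivity) hfg
  filter_upwards [Metric.tendsto_nhds.1 (tendsto_dil_zero_of_hasCompactSupport hg hgc hgm) (ε / 3)
    (by positivity)] with t ht
  rw [dist_eq_norm] at ht ⊢
  have h1 : dil t f - f = dil t (f - G) + (dil t G - G) - (f - G) := by
    rw [map_sub]; abel
  have h2 : ‖dil t (f - G)‖ ≤ ε / 3 := by rwa [LinearIsometryEquiv.norm_map]
  rw [h1]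
  calc _ ≤ ‖dil t (f - G) + (dil t G - G)‖ + ‖f - G‖ := norm_sub_le _ _
    _ ≤ ‖dil t (f - G)‖ + ‖dil t G - G‖ + ‖f - G‖ := by gcongr; exact norm_add_le _ _
    _ < ε := by linarith

theorem continuous_dil (f : L2) : Continuous fun t => dil t f := by
  rw [continuous_iff_continuousAt]
  intro t
  have h1 : Tendsto (fun s => dil t (dil (s - t) f)) (𝓝 t) (𝓝 (dil t f)) := by
    refine ((dil t).continuous.tendsto f).comp ((tendsto_dil_zero f).comp ?_)
    simpa using (continuous_sub_right t).tendsto t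
  simpa [ContinuousAt, dil_dil] using h1

/-! ### Unbounded operators with domain `H²` -/

theorem incl_mem_domH2 (p : H2) : incl p ∈ domH2 := ⟨p, rfl⟩

theorem unbounded_incl (A : H2 →L[ℂ] L2) (p : H2) (h : incl p ∈ (unbounded A).domain) :
    unbounded A ⟨incl p, h⟩ = A p := by
  have h1 : toH2 ⟨incl p, h⟩ = p :=
    (LinearEquiv.ofInjective (incl : H2 →ₗ[ℂ] L2) incl_injective).symm_apply_apply p
  exact congrArg A h1

theorem unbounded_incl' (A : H2 →L[ℂ] L2) (p : H2) :
    unbounded A (⟨incl p, incl_mem_domH2 p⟩ : (unbounded A).domain) = A p := unbounded_incl A p _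

theorem isEigenvalue_unbounded_iff (A : H2 →L[ℂ] L2) (z : ℂ) :
    IsEigenvalue (unbounded A) z ↔ ∃ p : H2, incl p ≠ 0 ∧ A p = z • incl p := by
  constructor
  · rintro ⟨⟨f, p, rfl⟩, hf, h⟩
    exact ⟨p, hf, (unbounded_incl' A p).symm.trans h⟩
  · rintro ⟨p, hp, h⟩
    exact ⟨⟨incl p, incl_mem_domH2 p⟩, hp, (unbounded_incl' A p).trans h⟩

/-- Replaces vectors of `L²` carrying a proof of membership in the domain by elements of the graph
space. -/
theorem inResolventSet_unbounded_iff (A : H2 →L[ℂ] L2) (z : ℂ) :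
    InResolventSet (unbounded A) z ↔ ∃ R : L2 →L[ℂ] L2,
      (∀ f, ∃ p : H2, incl p = R f ∧ A p - z • incl p = f) ∧
      ∀ p : H2, R (A p - z • incl p) = incl p := by
  constructor
  · rintro ⟨R, h1, h2⟩
    refine ⟨R, fun f => ?_, fun p => ?_⟩
    · obtain ⟨⟨p, hp⟩, h⟩ := h1 f
      have hp : incl p = R f := hp
      refine ⟨p, hp, ?_⟩
      have h3 : (⟨R f, ⟨p, hp⟩⟩ : (unbounded A).domain) = ⟨incl p, incl_mem_domH2 p⟩ :=
        Subtype.ext hp.symm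
      rw [h3, unbounded_incl', ← hp] at h
      exact h
    · rw [← unbounded_incl' A p]
      exact h2 ⟨incl p, incl_mem_domH2 p⟩
  · rintro ⟨R, h1, h2⟩
    refine ⟨R, fun f => ?_, ?_⟩
    · obtain ⟨p, hp, h⟩ := h1 f
      refine ⟨⟨p, hp⟩, ?_⟩
      have h3 : (⟨R f, ⟨p, hp⟩⟩ : (unbounded A).domain) = ⟨incl p, incl_mem_domH2 p⟩ :=
        Subtype.ext hp.symm
      rw [h3, unbounded_incl', ← hp, h]
    · rintro ⟨_, p, rfl⟩
      have h3 := h2 p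
      rw [← unbounded_incl' A p] at h3
      exact h3

theorem mem_genKer_succ_iff (A : H2 →L[ℂ] L2) (z : ℂ) (n : ℕ) (f : L2) :
    f ∈ genKer (unbounded A) z (n + 1) ↔
      ∃ p : H2, incl p = f ∧ A p - z • incl p ∈ genKer (unbounded A) z n := by
  constructor
  · rintro ⟨⟨_, p, rfl⟩, h, rfl⟩
    refine ⟨p, rfl, ?_⟩
    rw [← unbounded_incl' A p]
    exact h
  · rintro ⟨p, rfl, h⟩
    refine ⟨⟨incl p, incl_mem_domH2 p⟩, ?_, rfl⟩
    rw [← unbounded_incl' A p] at h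
    exact h

theorem not_inResolventSet_of_isEigenvalue {A : H2 →L[ℂ] L2} {z : ℂ}
    (h : IsEigenvalue (unbounded A) z) : z ∈ spec (unbounded A) := by
  intro hR
  obtain ⟨p, hp, hA⟩ := (isEigenvalue_unbounded_iff A z).1 h
  obtain ⟨R, -, h2⟩ := (inResolventSet_unbounded_iff A z).1 hR
  have := h2 p
  rw [hA, sub_self, map_zero] at this
  exact hp this.symm

/-! ### Relatively compact perturbations of `-cΔ` -/

/-- The operator `-cΔ + B : H² → L²`. -/
def perturbed (c : ℂ) (B : L2 →L[ℂ] L2) : H2 →L[ℂ] L2 := c • negLaplacian + B.comp incl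

theorem perturbed_apply (c : ℂ) (B : L2 →L[ℂ] L2) (p : H2) :
    perturbed c B p = c • negLaplacian p + B (incl p) := rfl

/-- The Birman–Schwinger type operator `B (-cΔ - z)⁻¹`. -/
def birman (c : ℂ) (B : L2 →L[ℂ] L2) (z : ℂ) : L2 →L[ℂ] L2 := c⁻¹ • (B * freeRes (z / c))

/-- The resolvent `(-cΔ + B - z)⁻¹`. -/
def resolv (c : ℂ) (B : L2 →L[ℂ] L2) (z : ℂ) : L2 →L[ℂ] L2 :=
  c⁻¹ • (freeRes (z / c) * Ring.inverse (1 + birman c B z))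

/-- `B` is relatively compact with respect to `-Δ`. -/
def RelCompact (B : L2 →L[ℂ] L2) : Prop := ∀ ζ ∉ posRay, IsCompactOperator (B * freeRes ζ)

section Perturbed

variable {c : ℂ} {B : L2 →L[ℂ] L2} {z : ℂ}

theorem RelCompact.birman (hB : RelCompact B) (hz : z / c ∉ posRay) :
    IsCompactOperator (birman c B z) := (hB _ hz).smul c⁻¹

/-- The factorisation `-cΔ + B - z = c (1 + K(z)) (-Δ - z/c)`, on which everything off the half-line
rests. -/
theorem perturbed_freeResH2 (hc : c ≠ 0) (hz : z / c ∉ posRay) (f : L2) :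
    perturbed c B (freeResH2 _ hz f) - z • incl (freeResH2 _ hz f)
      = c • (f + birman c B z f) := by
  rw [perturbed_apply, negLaplacian_freeResH2, incl_freeResH2]
  have h1 : birman c B z f = c⁻¹ • B (freeRes (z / c) f) := rfl
  rw [h1, smul_add, smul_add, smul_smul, smul_smul, mul_inv_cancel₀ hc, one_smul,
    mul_div_cancel₀ z hc]
  abel

/-- The free resolvent maps onto `H²`, so the factorisation covers the whole domain. -/
theorem perturbed_sub_eq (hc : c ≠ 0) (hz : z / c ∉ posRay) (p : H2) :
    ∃ h : L2, incl p = freeRes (z / c) h ∧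
      perturbed c B p - z • incl p = c • (h + birman c B z h) := by
  have h1 := freeRes_negLaplacian hz p
  refine ⟨_, h1.symm, ?_⟩
  rw [← perturbed_freeResH2 hc hz]
  have h2 : freeResH2 (z / c) hz (negLaplacian p - (z / c) • incl p) = p := incl_injective h1
  rw [h2]

theorem resolv_perturbed (hc : c ≠ 0) (hz : z / c ∉ posRay) (hu : IsUnit (1 + birman c B z))
    (p : H2) : resolv c B z (perturbed c B p - z • incl p) = incl p := by
  obtain ⟨h, hp, hA⟩ := perturbed_sub_eq (B := B) hc hz p
  have h1 : Ring.inverse (1 + birman c B z) (h + birman c B z h) = h :=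
    DFunLike.congr_fun (Ring.inverse_mul_cancel _ hu) h
  rw [hA, map_smul, hp]
  change c • (c⁻¹ • freeRes (z / c) (Ring.inverse (1 + birman c B z) (h + birman c B z h))) = _
  rw [h1, smul_smul, mul_inv_cancel₀ hc, one_smul]

theorem exists_resolv_eq (hc : c ≠ 0) (hz : z / c ∉ posRay) (hu : IsUnit (1 + birman c B z))
    (f : L2) : ∃ p : H2, incl p = resolv c B z f ∧ perturbed c B p - z • incl p = f := by
  refine ⟨freeResH2 _ hz (Ring.inverse (1 + birman c B z) (c⁻¹ • f)), ?_, ?_⟩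
  · rw [incl_freeResH2, map_smul, map_smul]
    rfl
  · rw [perturbed_freeResH2 hc hz]
    have h1 : Ring.inverse (1 + birman c B z) (c⁻¹ • f)
        + birman c B z (Ring.inverse (1 + birman c B z) (c⁻¹ • f)) = c⁻¹ • f :=
      DFunLike.congr_fun (Ring.mul_inverse_cancel _ hu) (c⁻¹ • f)
    rw [h1, smul_smul, mul_inv_cancel₀ hc, one_smul]

theorem inResolventSet_of_isUnit (hc : c ≠ 0) (hz : z / c ∉ posRay)
    (hu : IsUnit (1 + birman c B z)) : InResolventSet (unbounded (perturbed c B)) z :=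
  (inResolventSet_unbounded_iff _ _).2
    ⟨resolv c B z, exists_resolv_eq hc hz hu, resolv_perturbed hc hz hu⟩

/-- The Fredholm alternative gives `h ≠ 0` with `h + K h = 0`, and the free resolvent sends it to an
eigenvector. The image is nonzero, since otherwise `K h = 0` and then `h = 0`. -/
theorem isEigenvalue_of_not_isUnit (hB : RelCompact B) (hc : c ≠ 0) (hz : z / c ∉ posRay)
    (hu : ¬ IsUnit (1 + birman c B z)) : IsEigenvalue (unbounded (perturbed c B)) z := by
  obtain ⟨h, hh, h0⟩ := exists_ne_zero_of_not_isUnit_one_add (hB.birman hz) hu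
  rw [isEigenvalue_unbounded_iff]
  refine ⟨freeResH2 _ hz h, fun h1 => hh ?_, ?_⟩
  · have h2 : birman c B z h = c⁻¹ • B (freeRes (z / c) h) := rfl
    rw [incl_freeResH2] at h1
    rw [h2, h1, map_zero, smul_zero, add_zero] at h0
    exact h0
  · rw [← sub_eq_zero, perturbed_freeResH2 hc hz, h0, smul_zero]

/-- Off the essential spectrum, the spectrum consists of the `z` for which the Birman–Schwinger
operator is not invertible. -/
theorem mem_spec_iff (hB : RelCompact B) (hc : c ≠ 0) (hz : z / c ∉ posRay) :
    z ∈ spec (unbounded (perturbed c B)) ↔ ¬ IsUnit (1 + birman c B z) :=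
  ⟨fun h hu => h (inResolventSet_of_isUnit hc hz hu), fun h =>
    not_inResolventSet_of_isEigenvalue (isEigenvalue_of_not_isUnit hB hc hz h)⟩

theorem isEigenvalue_iff_mem_spec (hB : RelCompact B) (hc : c ≠ 0) (hz : z / c ∉ posRay) :
    IsEigenvalue (unbounded (perturbed c B)) z ↔ z ∈ spec (unbounded (perturbed c B)) :=
  ⟨not_inResolventSet_of_isEigenvalue, fun h =>
    isEigenvalue_of_not_isUnit hB hc hz ((mem_spec_iff hB hc hz).1 h)⟩

/-- The half-line `c [0, ∞)` belongs to the spectrum. -/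
theorem smul_posRay_subset_spec (hB : RelCompact B) (hc : c ≠ 0) {x : ℝ} (hx : 0 ≤ x) :
    c * x ∈ spec (unbounded (perturbed c B)) := by
  intro hres
  obtain ⟨R, h1, h2⟩ := (inResolventSet_unbounded_iff _ _).1 hres
  have hm1 : (-1 : ℂ) ∉ posRay := by
    rintro ⟨y, hy, h⟩
    have : y = -1 := by exact_mod_cast h
    rw [this] at hy
    norm_num at hy
  let S : L2 →L[ℂ] L2 := c⁻¹ • (1 + (c * x : ℂ) • R - B * R) + R
  have hRS : R = freeRes (-1) * S := by
    ext1 f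
    obtain ⟨p, hp, hA⟩ := h1 f
    rw [mul_apply_eq_comp, ← hp, ← freeRes_negLaplacian hm1 p]
    congr 1
    have : S f = c⁻¹ • (f + (c * x : ℂ) • R f - B (R f)) + R f := rfl
    rw [this, ← hp, ← hA, perturbed_apply, sub_add_cancel, add_sub_cancel_right, smul_smul,
      inv_mul_cancel₀ hc]
    simp
  have hcomp : IsCompactOperator (-(B * R)) := by
    rw [hRS, ← mul_assoc]
    exact ((hB _ hm1).comp_clm S).neg
  -- `1 - B R` is the free operator `c (-Δ - x)` composed with `R`. If it is invertible, `-Δ - x` is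
  -- bounded below; if not, its kernel yields an eigenvector of `-Δ`.
  have hBR : ∀ p : H2, ∀ f, incl p = R f → perturbed c B p - (c * x : ℂ) • incl p = f →
      (1 + -(B * R)) f = c • (negLaplacian p - (x : ℂ) • incl p) := by
    intro p f hp hA
    have : (1 + -(B * R)) f = f - B (R f) := (sub_eq_add_neg _ _).symm
    rw [this, ← hp, ← hA, perturbed_apply, smul_sub, smul_smul]
    abel
  by_cases hu : IsUnit (1 + -(B * R))
  · obtain ⟨u, hu⟩ := hu
    set T : L2 →L[ℂ] L2 := (↑u⁻¹ : L2 →L[ℂ] L2)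
    have hbound : ∀ p : H2, ‖incl p‖ ≤
        ‖R‖ * ‖T‖ * ‖c‖ * ‖negLaplacian p - (x : ℂ) • incl p‖ := by
      intro p
      set f := perturbed c B p - (c * x : ℂ) • incl p with hf
      have hp : incl p = R f := (h2 p).symm
      have h3 : f = T (c • (negLaplacian p - (x : ℂ) • incl p)) := by
        rw [← hBR p f hp hf.symm, ← hu]
        exact (DFunLike.congr_fun u.inv_mul f).symm
      calc ‖incl p‖ = ‖R f‖ := by rw [hp]
        _ ≤ ‖R‖ * ‖f‖ := R.le_opNorm f
        _ ≤ ‖R‖ * (‖T‖ * ‖c • (negLaplacian p - (x : ℂ) • incl p)‖) := by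
          gcongr
          conv_lhs => rw [h3]
          exact T.le_opNorm _
        _ = _ := by rw [norm_smul]; ring
    set M := ‖R‖ * ‖T‖ * ‖c‖ with hM
    have hM0 : 0 ≤ M := by positivity
    -- This choice makes `M ε ≤ 1/2`, so the lower bound would give `‖p‖ ≤ ‖p‖/2`.
    obtain ⟨p, hp0, hp⟩ := exists_approx_eigenvector hx (ε := (M + 1)⁻¹ / 2) (by positivity)
    have h4 := hbound p
    have h5 : 0 < ‖incl p‖ := norm_pos_iff.2 hp0
    have h6 : M * ((M + 1)⁻¹ / 2 * ‖incl p‖) ≤ ‖incl p‖ / 2 := by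
      have : M * (M + 1)⁻¹ ≤ 1 := by
        rw [← div_eq_mul_inv]
        exact div_le_one_of_le₀ (by linarith) (by positivity)
      calc M * ((M + 1)⁻¹ / 2 * ‖incl p‖) = (M * (M + 1)⁻¹) * (‖incl p‖ / 2) := by ring
        _ ≤ 1 * (‖incl p‖ / 2) := by gcongr
        _ = _ := one_mul _
    have h7 := mul_le_mul_of_nonneg_left hp hM0
    linarith
  · obtain ⟨f, hf, h0⟩ := exists_ne_zero_of_not_isUnit_one_add hcomp hu
    obtain ⟨p, hp, hA⟩ := h1 f
    have h3 : c • (negLaplacian p - (x : ℂ) • incl p) = 0 := by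
      rw [← hBR p f hp hA]
      exact h0
    have h4 : negLaplacian p = (x : ℂ) • incl p :=
      sub_eq_zero.1 ((smul_eq_zero.1 h3).resolve_left hc)
    have h5 := eq_zero_of_negLaplacian_eq h4
    apply hf
    have h6 : p = 0 := incl_injective (by rw [ContinuousLinearMap.coe_coe, h5, map_zero])
    rw [← hA, h6]
    simp

/-! ### Analyticity and invertibility in the spectral parameter off the half-line -/

theorem notMem_posRay_iff {ζ : ℂ} : ζ ∉ posRay ↔ -ζ ∈ Complex.slitPlane := by
  rw [Complex.mem_slitPlane_iff, not_iff_comm, not_or, not_lt, not_not]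
  constructor
  · rintro ⟨h1, h2⟩
    refine ⟨ζ.re, by simpa using h1, Complex.ext (by simp) ?_⟩
    rw [Complex.neg_im, neg_eq_zero] at h2
    simp [h2]
  · rintro ⟨y, hy, rfl⟩
    simpa using hy

theorem isPreconnected_offRay (hc : c ≠ 0) : IsPreconnected {z : ℂ | z / c ∉ posRay} := by
  have h1 : IsPreconnected Complex.slitPlane :=
    (Complex.starConvex_one_slitPlane.isPathConnected
      Complex.one_mem_slitPlane).isConnected.isPreconnected
  have h2 : {z : ℂ | z / c ∉ posRay} = (fun w => -c * w) '' Complex.slitPlane := by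
    ext z
    rw [Set.mem_ofPred_eq, notMem_posRay_iff]
    constructor
    · intro h
      refine ⟨_, h, ?_⟩
      field_simp
    · rintro ⟨w, hw, rfl⟩
      convert hw using 1
      field_simp
  rw [h2]
  exact h1.image _ (by fun_prop)

theorem isOpen_offRay (c : ℂ) : IsOpen {z : ℂ | z / c ∉ posRay} :=
  isClosed_posRay.isOpen_compl.preimage (continuous_id.div_const c)

theorem analyticAt_freeRes_div (hz : z / c ∉ posRay) :
    AnalyticAt ℂ (fun w => freeRes (w / c)) z :=
  (analyticAt_freeRes hz).comp (f := fun w => w / c) (by fun_prop)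

theorem analyticAt_birman (hz : z / c ∉ posRay) : AnalyticAt ℂ (birman c B) z :=
  (analyticAt_const.fun_mul (analyticAt_freeRes_div hz)).fun_const_smul

theorem analyticAt_ringInverse {X : Type*} [NormedRing X] [NormedAlgebra ℂ X] [CompleteSpace X]
    {f : ℂ → X} (hf : AnalyticAt ℂ f z) (hu : IsUnit (f z)) :
    AnalyticAt ℂ (fun w => Ring.inverse (f w)) z := by
  obtain ⟨u, hu⟩ := hu
  have h := analyticAt_inverse (𝕜 := ℂ) u
  rw [hu] at h
  exact h.comp hf

theorem analyticAt_resolv (hz : z / c ∉ posRay) (hu : IsUnit (1 + birman c B z)) :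
    AnalyticAt ℂ (resolv c B) z :=
  ((analyticAt_freeRes_div hz).fun_mul
    (analyticAt_ringInverse (analyticAt_const.add (analyticAt_birman hz)) hu)).fun_const_smul

/-- At `z = -cs` the free resolvent has norm at most `1/s`, so for `s > ‖c⁻¹‖ ‖B‖` the
Birman–Schwinger operator has norm below 1. This rules out the degenerate case of the analytic
Fredholm theorem. -/
theorem exists_isUnit_birman (hc : c ≠ 0) (B : L2 →L[ℂ] L2) :
    ∃ z, z / c ∉ posRay ∧ IsUnit (1 + birman c B z) := by
  set s : ℝ := ‖c⁻¹‖ * ‖B‖ + 1 with hs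
  have hs0 : 0 < s := by positivity
  have hζ : (-(s : ℂ)) ∉ posRay := by
    rintro ⟨y, hy, h⟩
    have : y = -s := by exact_mod_cast h
    rw [Set.mem_Ici] at hy
    linarith
  have hinf : s ≤ Metric.infDist (-(s : ℂ)) posRay := by
    refine (Metric.le_infDist posRay_nonempty).2 ?_
    rintro _ ⟨y, hy, rfl⟩
    rw [Set.mem_Ici] at hy
    rw [dist_eq_norm, ← Complex.ofReal_neg, ← Complex.ofReal_sub, Complex.norm_real,
      Real.norm_eq_abs, abs_sub_comm, abs_of_nonneg (by linarith)]
    linarith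
  have hdiv : c * (-(s : ℂ)) / c = -(s : ℂ) := mul_div_cancel_left₀ _ hc
  refine ⟨c * (-(s : ℂ)), by rwa [hdiv], ?_⟩
  have h1 : ‖birman c B (c * (-(s : ℂ)))‖ < 1 := by
    rw [birman, hdiv, norm_smul]
    calc ‖c⁻¹‖ * ‖B * freeRes (-(s : ℂ))‖ ≤ ‖c⁻¹‖ * (‖B‖ * ‖freeRes (-(s : ℂ))‖) := by
          gcongr; exact norm_mul_le _ _
      _ ≤ ‖c⁻¹‖ * (‖B‖ * s⁻¹) := by
          gcongr
          exact (norm_freeRes_le hζ).trans (inv_anti₀ hs0 hinf)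
      _ = (‖c⁻¹‖ * ‖B‖) / s := by ring
      _ < 1 := by rw [div_lt_one hs0]; linarith
  have h2 : 1 + birman c B (c * (-(s : ℂ))) = 1 - (-birman c B (c * (-(s : ℂ)))) := by abel
  rw [h2]
  exact isUnit_one_sub_of_norm_lt_one (by rwa [norm_neg])

theorem eventually_isUnit_birman (hB : RelCompact B) (hc : c ≠ 0) (hz : z / c ∉ posRay) :
    ∀ᶠ w in 𝓝[≠] z, IsUnit (1 + birman c B w) :=
  fredholm_eventually_isUnit (isOpen_offRay c) (isPreconnected_offRay hc)
    (fun _ hw => analyticAt_birman hw) (fun _ hw => hB.birman hw) (exists_isUnit_birman hc B) z hz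

/-- Off the essential spectrum the resolvent is meromorphic. -/
theorem meromorphicAt_resolv (hB : RelCompact B) (hc : c ≠ 0) (hz : z / c ∉ posRay) :
    MeromorphicAt (resolv c B) z := by
  have h1 := fredholm_meromorphicAt (analyticAt_birman hz) (hB.birman hz)
    (eventually_isUnit_birman hB hc hz)
  obtain ⟨n, hn⟩ := h1
  refine ⟨n, ?_⟩
  have h3 := ((analyticAt_freeRes_div hz).mul hn).const_smul (c := c⁻¹)
  refine h3.congr (Eventually.of_forall fun w => ?_)
  simp only [Pi.smul_apply, Pi.mul_apply, resolv]
  rw [mul_smul_comm, smul_comm]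

theorem eventually_resolv (hB : RelCompact B) (hc : c ≠ 0) (hz : z / c ∉ posRay) :
    ∃ ρ : ℝ, 0 < ρ ∧ Metric.closedBall z ρ ⊆ {w | w / c ∉ posRay} ∧
      ∀ w ∈ Metric.closedBall z ρ, w ≠ z → IsUnit (1 + birman c B w) := by
  have h1 := eventually_nhdsWithin_iff.1 (eventually_isUnit_birman hB hc hz)
  have h2 := h1.and ((isOpen_offRay c).mem_nhds hz)
  obtain ⟨ρ, hρ, h⟩ := Metric.eventually_nhds_iff_ball.1 h2
  have hsub : Metric.closedBall z (ρ / 2) ⊆ Metric.ball z ρ :=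
    Metric.closedBall_subset_ball (by linarith)
  exact ⟨ρ / 2, by linarith, fun w hw => (h w (hsub hw)).2, fun w hw => (h w (hsub hw)).1⟩

/-! ### Riesz projections and finite multiplicity -/

theorem circleIntegral_apply {ρ : ℝ} (hρ : 0 ≤ ρ) {F : ℂ → L2 →L[ℂ] L2}
    (hF : ContinuousOn F (Metric.sphere z ρ)) (f : L2) :
    (∮ w in C(z, ρ), F w) f = ∮ w in C(z, ρ), F w f := by
  simp only [circleIntegral]
  exact ContinuousLinearMap.intervalIntegral_apply (hF.circleIntegrable hρ).out f

theorem intervalIntegral_mem {X : Type*} [NormedAddCommGroup X] [NormedSpace ℂ X]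
    [CompleteSpace X] (S : Submodule ℂ X) (hS : IsClosed (S : Set X)) {f : ℝ → X} (hmem : ∀ t, f t ∈ S) (a b : ℝ) : ∫ t in a..b, f t ∈ S := by
  have hcompl : CompleteSpace S := hS.completeSpace_coe
  let G : ℝ → S := fun t => ⟨f t, hmem t⟩
  have h1 := S.subtypeₗᵢ.intervalIntegral_comp_comm (a := a) (b := b) (μ := volume) G
  change (∫ t in a..b, f t) = ((∫ t in a..b, G t : S) : X) at h1
  rw [h1]
  exact (∫ t in a..b, G t : S).2

/-- The contour integral of a continuous family of compact operators is compact. -/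
theorem isCompactOperator_circleIntegral {ρ : ℝ} (hρ : 0 ≤ ρ) {F : ℂ → L2 →L[ℂ] L2}
    (hc : ∀ w ∈ Metric.sphere z ρ, IsCompactOperator (F w)) :
    IsCompactOperator (∮ w in C(z, ρ), F w : L2 →L[ℂ] L2) := by
  let S : Submodule ℂ (L2 →L[ℂ] L2) := compactOperator (RingHom.id ℂ) L2 L2
  have hS : IsClosed (S : Set (L2 →L[ℂ] L2)) := isClosed_setOfPred_isCompactOperator
  have hsph : ∀ θ, circleMap z ρ θ ∈ Metric.sphere z ρ := circleMap_mem_sphere z hρ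
  have hmem : ∀ θ, deriv (circleMap z ρ) θ • F (circleMap z ρ θ) ∈ S := fun θ =>
    S.smul_mem _ (hc _ (hsph θ))
  exact intervalIntegral_mem S hS hmem 0 (2 * Real.pi)

/-- Every isolated spectral point off the essential spectrum has finite algebraic multiplicity. -/
theorem finiteDimensional_genKer (hB : RelCompact B) (hc : c ≠ 0) (hz : z / c ∉ posRay) :
    FiniteDimensional ℂ (⨆ n, genKer (unbounded (perturbed c B)) z n : Submodule ℂ L2) := by
  obtain ⟨ρ, hρ, hball, hunit⟩ := eventually_resolv hB hc hz
  have hsc : Metric.sphere z ρ ⊆ Metric.closedBall z ρ := Metric.sphere_subset_closedBall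
  have hne : ∀ w ∈ Metric.sphere z ρ, w ≠ z := fun w hw h => by
    rw [h, Metric.mem_sphere, dist_self] at hw
    exact hρ.ne hw
  have hu : ∀ w ∈ Metric.sphere z ρ, IsUnit (1 + birman c B w) := fun w hw =>
    hunit w (hsc hw) (hne w hw)
  have hcont : ContinuousOn (resolv c B) (Metric.sphere z ρ) := fun w hw =>
    (analyticAt_resolv (hball (hsc hw)) (hu w hw)).continuousAt.continuousWithinAt
  set P : L2 →L[ℂ] L2 := ∮ w in C(z, ρ), resolv c B w with hP
  have hPc : IsCompactOperator P := by
    -- By `(1 + K)⁻¹ = 1 - K (1 + K)⁻¹` the resolvent is the free one minus a term with a compact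
    -- factor. The free part is analytic in the disc and integrates to zero.
    let F1 : ℂ → L2 →L[ℂ] L2 := fun w => c⁻¹ • freeRes (w / c)
    let F2 : ℂ → L2 →L[ℂ] L2 := fun w =>
      freeRes (w / c) * (birman c B w * Ring.inverse (1 + birman c B w))
    have hF1a : ∀ w ∈ Metric.closedBall z ρ, AnalyticAt ℂ F1 w := fun w hw =>
      (analyticAt_freeRes_div (hball hw)).fun_const_smul
    have hF2c : ContinuousOn F2 (Metric.sphere z ρ) := fun w hw =>
      ((analyticAt_freeRes_div (hball (hsc hw))).mul ((analyticAt_birman (hball (hsc hw))).mul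
        (analyticAt_ringInverse (analyticAt_const.add (analyticAt_birman (hball (hsc hw))))
          (hu w hw)))).continuousAt.continuousWithinAt
    have hsplit : Set.EqOn (resolv c B) (fun w => F1 w - c⁻¹ • F2 w) (Metric.sphere z ρ) := by
      intro w hw
      have h1 : Ring.inverse (1 + birman c B w)
          = 1 - birman c B w * Ring.inverse (1 + birman c B w) := by
        have := Ring.mul_inverse_cancel _ (hu w hw)
        rw [add_mul, one_mul] at this
        exact eq_sub_of_add_eq this
      simp only [resolv, F1, F2]
      conv_lhs => rw [h1]
      rw [mul_sub, mul_one, smul_sub]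
    have hF1c : ContinuousOn F1 (Metric.sphere z ρ) := fun w hw =>
      (hF1a w (hsc hw)).continuousAt.continuousWithinAt
    have h0 : (∮ w in C(z, ρ), F1 w) = 0 := by
      refine DiffContOnCl.circleIntegral_eq_zero hρ.le (DifferentiableOn.diffContOnCl ?_)
      rw [closure_ball _ hρ.ne']
      exact fun w hw => (hF1a w hw).differentiableAt.differentiableWithinAt
    rw [hP, circleIntegral.integral_congr hρ.le hsplit, circleIntegral.integral_sub
      (hF1c.circleIntegrable hρ.le) ((hF2c.fun_const_smul c⁻¹).circleIntegrable hρ.le), h0, zero_sub]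
    refine IsCompactOperator.neg ?_
    refine isCompactOperator_circleIntegral hρ.le fun w hw => ?_
    have h1 : IsCompactOperator (birman c B w * Ring.inverse (1 + birman c B w)) :=
      (hB.birman (hball (hsc hw))).comp_clm _
    have h2 : IsCompactOperator (F2 w) := h1.clm_comp (freeRes (w / c))
    exact h2.smul c⁻¹
  -- Only `j = 0` is used in the end, but passing from `n` to `n + 1` raises the power of `(w -
  -- z)⁻¹`, so the induction needs every `j`.
  have key : ∀ n, ∀ f ∈ genKer (unbounded (perturbed c B)) z n, ∀ j : ℕ,
      (∮ w in C(z, ρ), ((w - z) ^ j)⁻¹ • resolv c B w f)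
        = if j = 0 then -(2 * Real.pi * Complex.I : ℂ) • f else 0 := by
    intro n
    induction n with
    | zero =>
      intro f hf j
      have hf : f = 0 := hf
      simp [hf, circleIntegral]
    | succ n ih =>
      intro f hf j
      obtain ⟨p, rfl, hp⟩ := (mem_genKer_succ_iff _ _ _ _).1 hf
      set f' := perturbed c B p - z • incl p with hf'
      -- With `f' = (A - z) f`, applying the resolvent to `(A - w) f = f' - (w - z) f` gives `R(w) f
      -- = (w - z)⁻¹ (R(w) f' - f)`.
      have hpt : Set.EqOn (fun w => ((w - z) ^ j)⁻¹ • resolv c B w (incl p))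
          (fun w => ((w - z) ^ (j + 1))⁻¹ • resolv c B w f' - ((w - z) ^ (j + 1))⁻¹ • incl p)
          (Metric.sphere z ρ) := by
        intro w hw
        have hw0 : w - z ≠ 0 := sub_ne_zero.2 (hne w hw)
        have h1 := resolv_perturbed hc (hball (hsc hw)) (hu w hw) p
        have h2 : perturbed c B p - w • incl p = f' - (w - z) • incl p := by
          rw [hf', sub_smul]; abel
        rw [h2, map_sub, map_smul] at h1
        have h3 : resolv c B w f' - incl p = (w - z) • resolv c B w (incl p) := by
          rw [eq_comm, ← sub_eq_iff_eq_add'.2 (sub_eq_iff_eq_add.1 h1)]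
        simp only
        rw [← smul_sub, h3, smul_smul, pow_succ, mul_inv, mul_assoc, inv_mul_cancel₀ hw0, mul_one]
      have hci : ContinuousOn (fun w => ((w - z) ^ (j + 1))⁻¹) (Metric.sphere z ρ) := by
        refine ContinuousOn.inv₀ (by fun_prop) fun w hw => pow_ne_zero _ (sub_ne_zero.2 (hne w hw))
      have hcr : ContinuousOn (fun w => resolv c B w f') (Metric.sphere z ρ) :=
        hcont.clm_apply continuousOn_const
      rw [circleIntegral.integral_congr hρ.le hpt, circleIntegral.integral_sub
        ((hci.fun_smul hcr).circleIntegrable hρ.le)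
        ((hci.fun_smul continuousOn_const).circleIntegrable hρ.le), ih f' hp (j + 1),
        if_neg (Nat.succ_ne_zero j), zero_sub, circleIntegral.integral_smul_const]
      split_ifs with hj
      · subst hj
        simp only [zero_add, pow_one]
        rw [circleIntegral.integral_sub_center_inv z hρ.ne', neg_smul]
      · have h4 : (∮ w in C(z, ρ), ((w - z) ^ (j + 1))⁻¹) = 0 := by
          have h5 := circleIntegral.integral_sub_zpow_of_ne (n := -((j : ℤ) + 1))
            (by omega) z z ρ
          rw [← h5]
          congr 1
        rw [h4, zero_smul, neg_zero]
  -- All generalized eigenvectors lie in the eigenspace of the compact operator `P` for the nonzero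
  -- value `-2πi`, which is finite-dimensional.
  have hle : (⨆ n, genKer (unbounded (perturbed c B)) z n : Submodule ℂ L2) ≤
      Module.End.eigenspace (P : L2 →ₗ[ℂ] L2) (-(2 * Real.pi * Complex.I : ℂ)) := by
    refine iSup_le fun n f hf => ?_
    rw [Module.End.mem_eigenspace_iff]
    have h1 := key n f hf 0
    simp only [pow_zero, inv_one, one_smul, if_true] at h1
    rw [← h1, ← circleIntegral_apply hρ.le hcont]
    rfl
  have hfd : FiniteDimensional ℂ
      (Module.End.eigenspace (P : L2 →ₗ[ℂ] L2) (-(2 * Real.pi * Complex.I : ℂ))) :=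
    ContinuousLinearMap.finite_dimensional_eigenspace hPc _ (by
      simp [Real.pi_ne_zero, Complex.I_ne_zero])
  exact Submodule.finiteDimensional_of_le hle

/-- Off the essential spectrum, the spectrum is discrete. -/
theorem isDiscreteEigenvalue_of_mem_spec (hB : RelCompact B) (hc : c ≠ 0) (hz : z / c ∉ posRay)
    (hs : z ∈ spec (unbounded (perturbed c B))) :
    IsDiscreteEigenvalue (unbounded (perturbed c B)) z := by
  refine ⟨?_, (isEigenvalue_iff_mem_spec hB hc hz).2 hs, finiteDimensional_genKer hB hc hz⟩
  obtain ⟨ρ, hρ, hball, hunit⟩ := eventually_resolv hB hc hz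
  refine ⟨ρ, hρ, fun w hw hwz => ?_⟩
  by_contra hne
  have hwb : w ∈ Metric.closedBall z ρ := by
    rw [Metric.mem_closedBall, dist_eq_norm]
    exact hwz.le
  exact (mem_spec_iff hB hc (hball hwb)).1 hw (hunit w hwb hne)

end Perturbed

/-! ### The softened Coulomb profile in the complex domain -/

/-- The analytic extension `z ↦ e^{-C/z} / z` of the softened Coulomb profile. -/
def profile (C : ℝ) (z : ℂ) : ℂ := Complex.exp (-C / z) / z

theorem profile_ofReal (C r : ℝ) : profile C r = (VP C r : ℂ) := by
  simp [profile, VP]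

theorem norm_profile (C : ℝ) (z : ℂ) :
    ‖profile C z‖ = Real.exp (-(C * z.re / Complex.normSq z)) / ‖z‖ := by
  rw [profile, norm_div, Complex.norm_exp]
  congr 2
  rw [Complex.div_re]
  simp [neg_div]

/-- Here `Re (C/z) ≥ 0`, so the exponential factor is at most 1. This controls infinity. -/
theorem norm_profile_le_inv {C : ℝ} (hC : 0 ≤ C) {z : ℂ} (hz : 0 ≤ z.re) :
    ‖profile C z‖ ≤ ‖z‖⁻¹ := by
  rw [norm_profile, ← one_div]
  gcongr
  rw [Real.exp_le_one_iff, neg_nonpos]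
  exact div_nonneg (mul_nonneg hC hz) (Complex.normSq_nonneg z)

/-- `e^{-s} ≤ 1/s` with `s = Re (C/z)`. Unlike `1/|z|`, this bound is constant along rays and so
removes the Coulomb singularity. -/
theorem norm_profile_le {C : ℝ} (hC : 0 < C) {z : ℂ} (hz : 0 < z.re) :
    ‖profile C z‖ ≤ ‖z‖ / (C * z.re) := by
  have hz0 : z ≠ 0 := fun h => by simp [h] at hz
  have hn : 0 < ‖z‖ := norm_pos_iff.2 hz0
  rw [norm_profile, Complex.normSq_eq_norm_sq]
  set s := C * z.re / ‖z‖ ^ 2 with hs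
  have hs0 : 0 < s := by positivity
  have h1 : Real.exp (-s) ≤ s⁻¹ := by
    rw [Real.exp_neg]
    exact inv_anti₀ hs0 (by linarith [Real.add_one_le_exp s])
  calc Real.exp (-s) / ‖z‖ ≤ s⁻¹ / ‖z‖ := by gcongr
    _ = ‖z‖ / (C * z.re) := by rw [hs]; field_simp

theorem differentiableAt_profile (C : ℝ) {z : ℂ} (hz : z ≠ 0) :
    DifferentiableAt ℂ (profile C) z := by
  unfold profile
  fun_prop (disch := exact hz)

theorem re_pos_of_mem_sector {β : ℝ} (hβ : β ≤ Real.pi / 2) {z : ℂ} (hz : z ∈ sector β) :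
    0 < z.re :=
  (Complex.abs_arg_lt_pi_div_two_iff.1 (hz.2.trans_le hβ)).resolve_right hz.1

theorem isOpen_sector_pi_div_two : IsOpen (sector (Real.pi / 2)) := by
  have h : sector (Real.pi / 2) = {z : ℂ | 0 < z.re} := by
    ext z
    refine ⟨re_pos_of_mem_sector le_rfl, fun hz => ⟨fun h => ?_, ?_⟩⟩
    · rw [Set.mem_ofPred_eq, h, Complex.zero_re] at hz
      exact lt_irrefl _ hz
    · exact Complex.abs_arg_lt_pi_div_two_iff.2 (Or.inl hz)
  rw [h]
  exact isOpen_lt continuous_const Complex.continuous_re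

theorem radialConditions_VP {C : ℝ} (hC : 0 < C) : RadialConditions (VP C) (Real.pi / 2) := by
  -- With `ε = 1/2` the bound `1/|z|` suffices for condition (III), leaving `|z|^{1/2}`.
  refine ⟨profile C, ⟨?_, fun r _ => profile_ofReal C r⟩, fun β hβ => ?_, 1 / 2, by norm_num,
    fun β hβ => ?_⟩
  · refine DifferentiableOn.analyticOnNhd (fun z hz => ?_) isOpen_sector_pi_div_two
    exact (differentiableAt_profile C hz.1).differentiableWithinAt
  · have h1 : Tendsto (fun z : ℂ => ‖z‖⁻¹) (Bornology.cobounded ℂ ⊓ 𝓟 (sector β)) (𝓝 0) :=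
      (tendsto_inv_atTop_zero.comp tendsto_norm_cobounded_atTop).mono_left inf_le_left
    refine squeeze_zero' (Eventually.of_forall fun z => norm_nonneg _) ?_ h1
    filter_upwards [mem_inf_of_right (mem_principal_self (sector β))] with z hz
    exact norm_profile_le_inv hC.le (re_pos_of_mem_sector hβ.le hz).le
  · have h1 : Tendsto (fun z : ℂ => ‖z‖ ^ ((1 : ℝ) / 2)) (𝓝[sector β] 0) (𝓝 0) := by
      have h2 : Continuous fun z : ℂ => ‖z‖ ^ ((1 : ℝ) / 2) :=
        continuous_norm.rpow_const fun _ => Or.inr (by norm_num)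
      have h3 := h2.tendsto 0
      rw [norm_zero, Real.zero_rpow (by norm_num)] at h3
      exact h3.mono_left nhdsWithin_le_nhds
    refine squeeze_zero' (Eventually.of_forall fun z => by positivity) ?_ h1
    filter_upwards [self_mem_nhdsWithin] with z hz
    have hn : 0 < ‖z‖ := norm_pos_iff.2 hz.1
    calc ‖z‖ ^ ((2 : ℝ) - 1 / 2) * ‖profile C z‖ ≤ ‖z‖ ^ ((2 : ℝ) - 1 / 2) * ‖z‖⁻¹ := by
          gcongr
          exact norm_profile_le_inv hC.le (re_pos_of_mem_sector hβ.le hz).le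
      _ = ‖z‖ ^ ((1 : ℝ) / 2) := by
          rw [← Real.rpow_neg_one, ← Real.rpow_add hn]
          norm_num

/-! ### The dilated potentials -/

/-- The strip `|Im θ| < π/2`. -/
def strip : Set ℂ := {θ | |θ.im| < Real.pi / 2}

theorem isOpen_strip : IsOpen strip :=
  isOpen_lt (continuous_abs.comp Complex.continuous_im) continuous_const

theorem strip_eq : strip = Complex.imLm ⁻¹' Set.Ioo (-(Real.pi / 2)) (Real.pi / 2) := by
  ext θ
  exact abs_lt (a := θ.im) (b := Real.pi / 2)

theorem isPreconnected_strip : IsPreconnected strip := by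
  rw [strip_eq]
  exact ((convex_Ioo _ _).linear_preimage Complex.imLm).isPreconnected

theorem add_ofReal_mem_strip {θ : ℂ} (hθ : θ ∈ strip) (t : ℝ) : θ + t ∈ strip := by
  simpa [strip] using hθ

theorem ofReal_mem_strip (t : ℝ) : (t : ℂ) ∈ strip := by
  simp [strip, Real.pi_pos]

theorem cos_im_pos {θ : ℂ} (hθ : θ ∈ strip) : 0 < Real.cos θ.im :=
  Real.cos_pos_of_mem_Ioo (abs_lt.1 hθ)

/-- The dilated softened Coulomb potential `x ↦ V_P(e^θ |x|)`. -/
def pot (C : ℝ) (θ : ℂ) (x : R3) : ℂ := profile C (Complex.exp θ * ‖x‖)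

theorem pot_zero (C : ℝ) (x : R3) : pot C 0 x = (VP C ‖x‖ : ℂ) := by
  rw [pot, Complex.exp_zero, one_mul, profile_ofReal]

theorem pot_smul (C : ℝ) (θ : ℂ) (t : ℝ) (x : R3) :
    pot C θ (Real.exp t • x) = pot C (θ + t) x := by
  rw [pot, pot, norm_smul, Real.norm_eq_abs, abs_of_pos (Real.exp_pos t), Complex.exp_add]
  push_cast
  rw [mul_assoc]

/-- Division by zero returns `0`, so bounds and holomorphy in `θ` hold at every `x` without
exception. -/
theorem pot_at_zero (C : ℝ) (θ : ℂ) : pot C θ 0 = 0 := by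
  simp [pot, profile]

theorem re_exp_mul (θ : ℂ) (r : ℝ) :
    (Complex.exp θ * r).re = Real.exp θ.re * Real.cos θ.im * r := by
  rw [Complex.re_mul_ofReal, Complex.exp_re]

theorem norm_exp_mul (θ : ℂ) {r : ℝ} (hr : 0 ≤ r) :
    ‖Complex.exp θ * r‖ = Real.exp θ.re * r := by
  rw [norm_mul, Complex.norm_exp, Complex.norm_real, Real.norm_of_nonneg hr]

/-- For `z = e^θ r` the ratio `|z| / Re z` equals `1 / cos Im θ`, whatever `r` is. -/
theorem norm_pot_le {C : ℝ} (hC : 0 < C) {θ : ℂ} (hθ : θ ∈ strip) (x : R3) :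
    ‖pot C θ x‖ ≤ (C * Real.cos θ.im)⁻¹ := by
  have hcos := cos_im_pos hθ
  rcases eq_or_ne x 0 with rfl | hx
  · rw [pot_at_zero, norm_zero]
    positivity
  · have hx0 : 0 < ‖x‖ := norm_pos_iff.2 hx
    have hre : 0 < (Complex.exp θ * ‖x‖).re := by
      rw [re_exp_mul]
      positivity
    refine (norm_profile_le hC hre).trans_eq ?_
    rw [re_exp_mul, norm_exp_mul _ hx0.le]
    have := Real.exp_pos θ.re
    field_simp

theorem vanishes_pot {C : ℝ} (hC : 0 < C) {θ : ℂ} (hθ : θ ∈ strip) : Vanishes (pot C θ) := by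
  intro ε hε
  have hcos := cos_im_pos hθ
  refine ⟨(Real.exp θ.re * ε)⁻¹, fun x hx => ?_⟩
  have he := Real.exp_pos θ.re
  have hx0 : 0 < ‖x‖ := lt_of_le_of_lt (by positivity) hx
  have hre : 0 ≤ (Complex.exp θ * ‖x‖).re := by
    rw [re_exp_mul]
    positivity
  refine (norm_profile_le_inv hC.le hre).trans ?_
  rw [norm_exp_mul _ hx0.le]
  refine inv_le_of_inv_le₀ hε ?_
  have h1 : (Real.exp θ.re * ε)⁻¹ * Real.exp θ.re = ε⁻¹ := by field_simp
  rw [← h1, mul_comm]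
  gcongr

theorem measurable_pot (C : ℝ) (θ : ℂ) : Measurable (pot C θ) := by
  unfold pot profile
  fun_prop

theorem isBddMeas_pot {C : ℝ} (hC : 0 < C) {θ : ℂ} (hθ : θ ∈ strip) : IsBddMeas (pot C θ) :=
  ⟨measurable_pot C θ, _, norm_pot_le hC hθ⟩

theorem differentiable_pot (C : ℝ) (x : R3) : Differentiable ℂ fun θ => pot C θ x := by
  rcases eq_or_ne x 0 with rfl | hx
  · simp only [pot_at_zero]
    exact differentiable_const 0
  · intro θ
    have hne : Complex.exp θ * ‖x‖ ≠ 0 :=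
      mul_ne_zero (Complex.exp_ne_zero θ) (by exact_mod_cast norm_ne_zero_iff.2 hx)
    exact (differentiableAt_profile C hne).comp θ (f := fun θ => Complex.exp θ * ‖x‖)
      (by fun_prop)

theorem differentiableOn_mulL_pot {C : ℝ} (hC : 0 < C) :
    DifferentiableOn ℂ (fun θ => mulL (pot C θ)) strip := by
  refine differentiableOn_mulL isOpen_strip (fun θ _ => measurable_pot C θ)
    (fun x => (differentiable_pot C x).differentiableOn) fun θ₀ hθ₀ => ?_
  have hcos := cos_im_pos hθ₀
  have hcont : ContinuousAt (fun θ : ℂ => (C * Real.cos θ.im)⁻¹) θ₀ := by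
    refine ContinuousAt.inv₀ ?_ (by positivity)
    exact (continuous_const.mul (Real.continuous_cos.comp Complex.continuous_im)).continuousAt
  refine ⟨(C * Real.cos θ₀.im)⁻¹ + 1, ?_⟩
  filter_upwards [hcont.eventually_lt_const (lt_add_one _), isOpen_strip.mem_nhds hθ₀]
    with θ h1 h2 x
  exact (norm_pot_le hC h2 x).trans h1.le

theorem dil_mulL_pot {C : ℝ} (hC : 0 < C) {θ : ℂ} (hθ : θ ∈ strip) (t : ℝ) (f : L2) :
    dil t (mulL (pot C θ) f) = mulL (pot C (θ + t)) (dil t f) := by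
  rw [dil_mulL (isBddMeas_pot hC hθ)]
  simp only [pot_smul]

/-! ### Dilatation analyticity of the softened Coulomb potential -/

theorem mulDomain_eq {v : R3 → ℂ} (hv : IsBddMeas v) : mulDomain v = domH2 := by
  ext f
  exact ⟨fun h => h.1, fun h => ⟨h, hv.memLp f⟩⟩

theorem mulOp_apply {v : R3 → ℂ} (hv : IsBddMeas v) (f : L2) (h : f ∈ (mulOp v).domain) :
    mulOp v ⟨f, h⟩ = mulL v f := by
  refine Eq.symm ?_
  rw [mulL_eq_iff hv]
  exact ((hv.memLp f).coeFn_toLp).symm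

theorem relCompact_mulL {v : R3 → ℂ} (hv : IsBddMeas v) (hv0 : Vanishes v) :
    RelCompact (mulL v) := fun _ hζ => isCompactOperator_mulL_freeRes hv hv0 hζ

theorem neg_one_notMem_posRay : (-1 : ℂ) ∉ posRay := by
  rintro ⟨y, hy, h⟩
  have : y = -1 := by exact_mod_cast h
  rw [this] at hy
  norm_num at hy

/-- On `H²` the operator is `B (-Δ + 1)⁻¹`, compact, after `-Δ + 1`, bounded for the graph norm. -/
theorem RelCompact.comp_incl {B : L2 →L[ℂ] L2} (hB : RelCompact B) :
    IsCompactOperator (B.comp incl) := by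
  have h1 : B.comp incl = (B * freeRes (-1)).comp (negLaplacian - (-1 : ℂ) • incl) := by
    ext1 p
    exact congrArg B (freeRes_negLaplacian neg_one_notMem_posRay p).symm
  rw [h1]
  exact (hB _ neg_one_notMem_posRay).comp_clm _

theorem pot_zero_eq (C : ℝ) : pot C 0 = fun x : R3 => (VP C ‖x‖ : ℂ) := funext (pot_zero C)

theorem zero_mem_strip : (0 : ℂ) ∈ strip := by
  simpa using ofReal_mem_strip 0

theorem analyticOnNhd_dilated {C : ℝ} (hC : 0 < C) :
    AnalyticOnNhd ℂ (fun θ => (mulL (pot C θ)).comp incl) strip := by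
  refine DifferentiableOn.analyticOnNhd (fun θ hθ => ?_) isOpen_strip
  exact ((differentiableOn_mulL_pot hC θ hθ).clm_comp (differentiableWithinAt_const incl))

theorem isContinuation_dilated {C : ℝ} (hC : 0 < C) :
    IsContinuation (mulOp (pot C 0)) (Real.pi / 2) (fun θ => (mulL (pot C θ)).comp incl) := by
  have hv := isBddMeas_pot hC zero_mem_strip
  refine ⟨analyticOnNhd_dilated hC, fun t f => ?_⟩
  have hdom : dilate (-t) (incl f) ∈ (mulOp (pot C 0)).domain := by
    change _ ∈ mulDomain _
    rw [mulDomain_eq hv]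
    exact incl_mem_domH2 (dilH2 (-t) f)
  refine ⟨hdom, ?_⟩
  rw [mulOp_apply hv, ← dil_apply, ← dil_apply, dil_mulL_pot hC zero_mem_strip, dil_dil_neg,
    zero_add]
  rfl

theorem isFormalAdjoint_mulOp {v : R3 → ℂ} (hv : IsBddMeas v)
    (hreal : ∀ x, v x = starRingEnd ℂ (v x)) : (mulOp v).IsFormalAdjoint (mulOp v) := by
  rintro ⟨f, hf⟩ ⟨h, hh⟩
  rw [mulOp_apply hv, mulOp_apply hv]
  exact inner_mulL hv hv hreal f h

theorem conj_pot_zero (C : ℝ) (x : R3) : pot C 0 x = starRingEnd ℂ (pot C 0 x) := by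
  rw [pot_zero, Complex.conj_ofReal]

theorem classC_mulOp {C : ℝ} (hC : 0 < C) :
    ClassC (Real.pi / 2) (mulOp (fun x : R3 => (VP C ‖x‖ : ℂ))) := by
  rw [← pot_zero_eq]
  have hv := isBddMeas_pot hC zero_mem_strip
  refine ⟨mulDomain_eq hv, isFormalAdjoint_mulOp hv (conj_pot_zero C), ⟨(mulL (pot C 0)).comp incl,
    (relCompact_mulL hv (vanishes_pot hC zero_mem_strip)).comp_incl, fun f => ?_⟩,
    _, isContinuation_dilated hC⟩
  have hdom : incl f ∈ (mulOp (pot C 0)).domain := by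
    change _ ∈ mulDomain _
    rw [mulDomain_eq hv]
    exact incl_mem_domH2 f
  exact ⟨hdom, (mulOp_apply hv _ _).symm⟩

/-- Identity theorem along a real line. -/
theorem eqOn_of_eq_add_ofReal {X : Type*} [NormedAddCommGroup X] [NormedSpace ℂ X] {F G : ℂ → X}
    {U : Set ℂ} (hF : AnalyticOnNhd ℂ F U) (hG : AnalyticOnNhd ℂ G U) (hU : IsPreconnected U)
    {θ : ℂ} (hθ : θ ∈ U) (h : ∀ t : ℝ, F (θ + t) = G (θ + t)) : Set.EqOn F G U := by
  refine hF.eqOn_of_preconnected_of_frequently_eq hG hU hθ ?_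
  have h1 : Tendsto (fun t : ℝ => θ + t) (𝓝[≠] 0) (𝓝[≠] θ) := by
    refine tendsto_nhdsWithin_iff.2 ⟨?_, ?_⟩
    · have : Continuous fun t : ℝ => θ + (t : ℂ) := by fun_prop
      have h2 := this.tendsto 0
      rw [Complex.ofReal_zero, add_zero] at h2
      exact h2.mono_left nhdsWithin_le_nhds
    · filter_upwards [self_mem_nhdsWithin] with t ht h2
      exact ht (by simpa using h2)
  exact h1.frequently (Eventually.of_forall h).frequently

/-- The family is prescribed on the real line, and the strip is connected, so the continuation is
unique. -/
theorem IsContinuation.eq_dilated {C : ℝ} (hC : 0 < C) {W : ℂ → H2 →L[ℂ] L2}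
    (hW : IsContinuation (mulOp (fun x : R3 => (VP C ‖x‖ : ℂ))) (Real.pi / 2) W) {θ : ℂ}
    (hθ : θ ∈ strip) : W θ = (mulL (pot C θ)).comp incl := by
  rw [← pot_zero_eq] at hW
  have h := isContinuation_dilated hC
  refine eqOn_of_eq_add_ofReal hW.1 h.1 isPreconnected_strip zero_mem_strip (fun t => ?_) hθ
  rw [zero_add]
  ext1 f
  obtain ⟨h1, h2⟩ := hW.2 t f
  obtain ⟨h3, h4⟩ := h.2 t f
  rw [h2, h4]

/-! ### The dilated Hamiltonians -/

/-- The factor `e^{-2θ}`. -/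
def rot (θ : ℂ) : ℂ := Complex.exp (-2 * θ)

/-- The operator of multiplication by `g V_P(e^θ |x|)`. -/
def coupled (C g : ℝ) (θ : ℂ) : L2 →L[ℂ] L2 := (g : ℂ) • mulL (pot C θ)

/-- The dilated Hamiltonian `H(θ) = e^{-2θ} (-Δ) + g V_P(θ)` as an operator `H² → L²`. -/
def ham (C g : ℝ) (θ : ℂ) : H2 →L[ℂ] L2 := perturbed (rot θ) (coupled C g θ)

/-- The spectrum of `H(θ)`. -/
def hamSpec (C g : ℝ) (θ : ℂ) : Set ℂ := spec (unbounded (ham C g θ))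

/-- The resolvent of `H(θ)`. -/
def hamRes (C g : ℝ) (θ z : ℂ) : L2 →L[ℂ] L2 := resolv (rot θ) (coupled C g θ) z

theorem rot_ne_zero (θ : ℂ) : rot θ ≠ 0 := Complex.exp_ne_zero _

theorem rot_add (θ : ℂ) (t : ℝ) : rot (θ + t) = rot θ * ((Real.exp (2 * t) : ℝ) : ℂ)⁻¹ := by
  rw [rot, rot, mul_add, Complex.exp_add, Complex.ofReal_exp, ← Complex.exp_neg]
  push_cast
  ring_nf

theorem dilatedHamiltonian_eq {C : ℝ} (hC : 0 < C) {W : ℂ → H2 →L[ℂ] L2}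
    (hW : IsContinuation (mulOp (fun x : R3 => (VP C ‖x‖ : ℂ))) (Real.pi / 2) W) (g : ℝ) {θ : ℂ}
    (hθ : θ ∈ strip) : dilatedHamiltonian W g θ = unbounded (ham C g θ) := by
  rw [dilatedHamiltonian, hW.eq_dilated hC hθ]
  rfl

theorem mem_rotatedRay_iff (θ z : ℂ) : z ∈ rotatedRay θ ↔ z / rot θ ∈ posRay := by
  constructor
  · rintro ⟨x, hx, rfl⟩
    exact ⟨x, hx, (mul_div_cancel_left₀ _ (rot_ne_zero θ)).symm⟩
  · rintro ⟨x, hx, h⟩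
    exact ⟨x, hx, ((div_eq_iff (rot_ne_zero θ)).1 h.symm).trans (mul_comm _ _)⟩

theorem posRay_mul_iff {a : ℝ} (ha : 0 < a) (z : ℂ) : z * a ∈ posRay ↔ z ∈ posRay := by
  constructor
  · rintro ⟨x, hx, h⟩
    refine ⟨x / a, div_nonneg hx ha.le, ?_⟩
    rw [Complex.ofReal_div, h, mul_div_cancel_right₀ _ (by exact_mod_cast ha.ne')]
  · rintro ⟨x, hx, rfl⟩
    exact ⟨x * a, mul_nonneg hx ha.le, by push_cast; rfl⟩

/-- The real part of `θ` contributes a positive factor, which preserves the half-line. -/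
theorem div_rot_mem_posRay_iff (θ z : ℂ) :
    z / rot θ ∈ posRay ↔ z * Complex.exp (2 * (θ.im * Complex.I)) ∈ posRay := by
  have h1 : z / rot θ = z * Complex.exp (2 * (θ.im * Complex.I)) * (Real.exp (2 * θ.re) : ℝ) := by
    rw [rot, div_eq_mul_inv, ← Complex.exp_neg, mul_assoc, Complex.ofReal_exp, ← Complex.exp_add]
    congr 2
    conv_lhs => rw [← Complex.re_add_im θ]
    push_cast
    ring
  rw [h1, posRay_mul_iff (Real.exp_pos _)]

theorem relCompact_coupled {C : ℝ} (hC : 0 < C) (g : ℝ) {θ : ℂ} (hθ : θ ∈ strip) :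
    RelCompact (coupled C g θ) := fun ζ hζ => by
  rw [coupled, smul_mul_assoc]
  exact (relCompact_mulL (isBddMeas_pot hC hθ) (vanishes_pot hC hθ) ζ hζ).smul (g : ℂ)

/-- The factor `e^{2t}` by which a dilatation scales `-Δ` cancels against `e^{-2(θ + t)}`. This
intertwining makes spectrum and eigenvalues depend on `Im θ` alone. -/
theorem ham_dilH2 {C : ℝ} (hC : 0 < C) (g : ℝ) {θ : ℂ} (hθ : θ ∈ strip) (t : ℝ) (p : H2) :
    ham C g (θ + t) (dilH2 t p) = dil t (ham C g θ p) := by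
  have he : ((Real.exp (2 * t) : ℝ) : ℂ) ≠ 0 := by exact_mod_cast (Real.exp_pos _).ne'
  rw [ham, ham, perturbed_apply, perturbed_apply, map_add, map_smul, negLaplacian_dilH2, smul_smul,
    rot_add, mul_assoc, inv_mul_cancel₀ he, mul_one, incl_dilH2]
  change _ + (g : ℂ) • mulL (pot C (θ + t)) (dil t (incl p))
    = _ + dil t ((g : ℂ) • mulL (pot C θ) (incl p))
  rw [map_smul, dil_mulL_pot hC hθ]

theorem dilH2_dilH2_neg (t : ℝ) (p : H2) : dilH2 t (dilH2 (-t) p) = p := by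
  apply incl_injective
  change incl _ = incl _
  rw [incl_dilH2, incl_dilH2, dil_dil_neg]

theorem InResolventSet.translate {C : ℝ} (hC : 0 < C) {g : ℝ} {θ : ℂ} (hθ : θ ∈ strip) {z : ℂ}
    (h : InResolventSet (unbounded (ham C g θ)) z) (t : ℝ) :
    InResolventSet (unbounded (ham C g (θ + t))) z := by
  rw [inResolventSet_unbounded_iff] at h ⊢
  obtain ⟨R, h1, h2⟩ := h
  refine ⟨((dil t).toContinuousLinearEquiv : L2 →L[ℂ] L2) * R *
    ((dil (-t)).toContinuousLinearEquiv : L2 →L[ℂ] L2), fun f => ?_, fun p => ?_⟩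
  · obtain ⟨p, hp, hA⟩ := h1 (dil (-t) f)
    refine ⟨dilH2 t p, congrArg (dil t) hp, ?_⟩
    rw [ham_dilH2 hC g hθ, incl_dilH2, ← map_smul, ← map_sub, hA, dil_dil_neg]
  · change dil t (R (dil (-t) (ham C g (θ + t) p - z • incl p))) = incl p
    have h3 : ham C g (θ + t) p = dil t (ham C g θ (dilH2 (-t) p)) := by
      rw [← ham_dilH2 hC g hθ, dilH2_dilH2_neg]
    have h4 : incl p = dil t (incl (dilH2 (-t) p)) := by rw [← incl_dilH2, dilH2_dilH2_neg]
    rw [h3, h4, ← map_smul, ← map_sub, dil_neg_dil, h2]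

theorem hamSpec_translate {C : ℝ} (hC : 0 < C) (g : ℝ) {θ : ℂ} (hθ : θ ∈ strip) (t : ℝ) :
    hamSpec C g (θ + t) = hamSpec C g θ := by
  ext z
  refine not_congr ⟨fun h => ?_, fun h => h.translate hC hθ t⟩
  have := h.translate hC (add_ofReal_mem_strip hθ t) (-t)
  rwa [Complex.ofReal_neg, add_neg_cancel_right] at this

theorem hamSpec_congr {C : ℝ} (hC : 0 < C) (g : ℝ) {θ θ' : ℂ} (hθ : θ ∈ strip)
    (h : θ'.im = θ.im) : hamSpec C g θ' = hamSpec C g θ := by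
  have h1 : θ' = θ + ((θ'.re - θ.re : ℝ) : ℂ) := by
    apply Complex.ext <;> simp [h]
  rw [h1, hamSpec_translate hC g hθ]

theorem isEigenvalue_translate {C : ℝ} (hC : 0 < C) {g : ℝ} {θ : ℂ} (hθ : θ ∈ strip) {z : ℂ}
    (h : IsEigenvalue (unbounded (ham C g θ)) z) (t : ℝ) :
    IsEigenvalue (unbounded (ham C g (θ + t))) z := by
  rw [isEigenvalue_unbounded_iff] at h ⊢
  obtain ⟨p, hp, hA⟩ := h
  refine ⟨dilH2 t p, ?_, ?_⟩
  · rw [incl_dilH2]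
    exact fun h => hp ((dil t).map_eq_zero_iff.1 h)
  · rw [ham_dilH2 hC g hθ, hA, map_smul, incl_dilH2]

theorem isEigenvalue_congr {C : ℝ} (hC : 0 < C) (g : ℝ) {θ θ' : ℂ} (hθ : θ ∈ strip)
    (h : θ'.im = θ.im) (z : ℂ) :
    IsEigenvalue (unbounded (ham C g θ')) z ↔ IsEigenvalue (unbounded (ham C g θ)) z := by
  have hθ' : θ' ∈ strip := by rw [strip, Set.mem_ofPred_eq, h]; exact hθ
  have h1 : θ' = θ + ((θ'.re - θ.re : ℝ) : ℂ) := by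
    apply Complex.ext <;> simp [h]
  have h2 : θ = θ' + ((θ.re - θ'.re : ℝ) : ℂ) := by
    apply Complex.ext <;> simp [h]
  constructor
  · intro h3
    rw [h2]
    exact isEigenvalue_translate hC hθ' h3 _
  · intro h3
    rw [h1]
    exact isEigenvalue_translate hC hθ h3 _

/-! ### Local constancy of the spectrum in `θ` -/

/-- The parameters `θ` for which `z` is off the essential spectrum of `H(θ)`. -/
def offRay (z : ℂ) : Set ℂ := {θ | θ ∈ strip ∧ z / rot θ ∉ posRay}

theorem continuous_div_rot (z : ℂ) : Continuous fun θ => z / rot θ := by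
  unfold rot
  exact continuous_const.div (by fun_prop) fun θ => Complex.exp_ne_zero _

theorem isOpen_offRay_param (z : ℂ) : IsOpen (offRay z) :=
  isOpen_strip.inter (isClosed_posRay.isOpen_compl.preimage (continuous_div_rot z))

theorem mem_offRay_congr {z θ θ' : ℂ} (h : θ'.im = θ.im) : θ' ∈ offRay z ↔ θ ∈ offRay z := by
  simp only [offRay, strip, Set.mem_ofPred_eq, div_rot_mem_posRay_iff, h]

theorem mem_hamSpec_iff {C : ℝ} (hC : 0 < C) (g : ℝ) {θ z : ℂ} (h : θ ∈ offRay z) :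
    z ∈ hamSpec C g θ ↔ ¬ IsUnit (1 + birman (rot θ) (coupled C g θ) z) :=
  mem_spec_iff (relCompact_coupled hC g h.1) (rot_ne_zero θ) h.2

theorem differentiableAt_freeRes_rot {θ z : ℂ} (h : θ ∈ offRay z) :
    DifferentiableAt ℂ (fun w => freeRes (z / rot w)) θ := by
  refine (analyticAt_freeRes h.2).differentiableAt.comp θ (f := fun w => z / rot w) ?_
  have h1 : DifferentiableAt ℂ rot θ := by unfold rot; fun_prop
  exact (differentiableAt_const z).fun_div h1 (rot_ne_zero θ)

theorem differentiableAt_rot_inv (θ : ℂ) : DifferentiableAt ℂ (fun w => (rot w)⁻¹) θ := by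
  have h1 : DifferentiableAt ℂ rot θ := by unfold rot; fun_prop
  exact h1.fun_inv (rot_ne_zero θ)

theorem differentiableAt_birman_rot {C : ℝ} (hC : 0 < C) (g : ℝ) {θ z : ℂ} (h : θ ∈ offRay z) :
    DifferentiableAt ℂ (fun w => birman (rot w) (coupled C g w) z) θ := by
  have h1 : DifferentiableAt ℂ (coupled C g) θ :=
    ((differentiableOn_mulL_pot hC).differentiableAt (isOpen_strip.mem_nhds h.1)).fun_const_smul
      (g : ℂ)
  exact (differentiableAt_rot_inv θ).fun_smul (h1.fun_mul (differentiableAt_freeRes_rot h))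

theorem analyticAt_birman_rot {C : ℝ} (hC : 0 < C) (g : ℝ) {θ z : ℂ} (h : θ ∈ offRay z) :
    AnalyticAt ℂ (fun w => birman (rot w) (coupled C g w) z) θ :=
  DifferentiableOn.analyticAt
    (fun _ hw => (differentiableAt_birman_rot hC g hw).differentiableWithinAt)
    ((isOpen_offRay_param z).mem_nhds h)

theorem differentiableAt_hamRes {C : ℝ} (hC : 0 < C) (g : ℝ) {θ z : ℂ} (h : θ ∈ offRay z)
    (hz : z ∉ hamSpec C g θ) : DifferentiableAt ℂ (fun w => hamRes C g w z) θ := by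
  rw [mem_hamSpec_iff hC g h, not_not] at hz
  exact (differentiableAt_rot_inv θ).fun_smul ((differentiableAt_freeRes_rot h).fun_mul
    (analyticAt_ringInverse (analyticAt_const.add (analyticAt_birman_rot hC g h))
      hz).differentiableAt)

/-- Off the essential spectrum, the spectrum of `H(θ)` is locally constant in `θ`. -/
theorem eventually_mem_hamSpec_iff {C : ℝ} (hC : 0 < C) (g : ℝ) {θ z : ℂ} (h : θ ∈ offRay z) :
    ∀ᶠ w in 𝓝 θ, (z ∈ hamSpec C g w ↔ z ∈ hamSpec C g θ) := by
  have hoff := (isOpen_offRay_param z).mem_nhds h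
  have hcpt := (relCompact_coupled hC g h.1).birman (z := z) h.2
  -- Here `z` is fixed and Fredholm theory is applied in the variable `θ`.
  rcases fredholm_dichotomy (analyticAt_birman_rot hC g h) hcpt with h1 | h1
  · filter_upwards [h1, hoff] with w hw hw'
    rw [mem_hamSpec_iff hC g hw', mem_hamSpec_iff hC g h]
    exact ⟨fun _ => h1.self_of_nhds, fun _ => hw⟩
  -- An exceptional `θ` is impossible: the shift by the real number `ε/2` stays in the punctured
  -- neighbourhood and does not change the spectrum.
  · have hnot : z ∉ hamSpec C g θ := by
      obtain ⟨ε, hε, hball⟩ := Metric.eventually_nhds_iff_ball.1 (eventually_nhdsWithin_iff.1 h1)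
      have h2 : θ + ((ε / 2 : ℝ) : ℂ) ∈ Metric.ball θ ε := by
        rw [Metric.mem_ball, dist_eq_norm, add_sub_cancel_left, Complex.norm_real,
          Real.norm_of_nonneg (by linarith)]
        linarith
      have h3 : θ + ((ε / 2 : ℝ) : ℂ) ≠ θ := by
        intro h4
        rw [add_eq_left, Complex.ofReal_eq_zero] at h4
        linarith
      have h5 : θ + ((ε / 2 : ℝ) : ℂ) ∈ offRay z := (mem_offRay_congr (by simp)).2 h
      have h6 := hball _ h2 h3
      rw [← hamSpec_translate hC g h.1 (ε / 2), mem_hamSpec_iff hC g h5, not_not]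
      exact h6
    have hu : IsUnit (1 + birman (rot θ) (coupled C g θ) z) := by
      rwa [mem_hamSpec_iff hC g h, not_not] at hnot
    have h2 : ContinuousAt (fun w => 1 + birman (rot w) (coupled C g w) z) θ :=
      continuousAt_const.add (analyticAt_birman_rot hC g h).continuousAt
    filter_upwards [h2.eventually (Units.isOpen.mem_nhds hu), hoff] with w hw hw'
    rw [mem_hamSpec_iff hC g hw', mem_hamSpec_iff hC g h]
    exact not_congr ⟨fun _ => hu, fun _ => hw⟩

/-- The discrete spectrum of `H(θ)` is stable in `θ`. -/
theorem exists_stability {C : ℝ} (hC : 0 < C) (g : ℝ) {θ z : ℂ} (h : θ ∈ offRay z) :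
    ∃ δ : ℝ, 0 < δ ∧ ∀ θ' : ℂ, θ' ∈ strip → |θ'.im - θ.im| < δ →
      (z ∈ hamSpec C g θ' ↔ z ∈ hamSpec C g θ) := by
  obtain ⟨δ, hδ, hball⟩ := Metric.eventually_nhds_iff_ball.1 (eventually_mem_hamSpec_iff hC g h)
  refine ⟨δ, hδ, fun θ' hθ' hd => ?_⟩
  -- Only `Im θ'` is near `Im θ`; taking the real part of `θ` keeps the spectrum and lands in the
  -- ball.
  let θ'' : ℂ := ⟨θ.re, θ'.im⟩
  have h1 : θ'' ∈ Metric.ball θ δ := by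
    have h2 : θ'' - θ = ((θ'.im - θ.im : ℝ) : ℂ) * Complex.I := by
      apply Complex.ext <;> simp [θ'']
    rwa [Metric.mem_ball, dist_eq_norm, h2, norm_mul, Complex.norm_I, mul_one, Complex.norm_real]
  rw [← hball θ'' h1, hamSpec_congr hC g hθ' (rfl : θ''.im = θ'.im)]

/-- The point of the segment from `0` to `i Im θ` at parameter `r`. -/
def imSegment (θ : ℂ) (r : ℝ) : ℂ := ((r * θ.im : ℝ) : ℂ) * Complex.I

theorem imSegment_im (θ : ℂ) (r : ℝ) : (imSegment θ r).im = r * θ.im := by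
  simp [imSegment]

theorem imSegment_mem_strip {θ : ℂ} (hθ : θ ∈ strip) {r : ℝ} (hr : r ∈ Set.Icc (0 : ℝ) 1) :
    imSegment θ r ∈ strip := by
  rw [strip, Set.mem_ofPred_eq, imSegment_im, abs_mul, abs_of_nonneg hr.1]
  exact (mul_le_of_le_one_left (abs_nonneg _) hr.2).trans_lt hθ

/-- As long as the essential spectrum does not meet `z`, the point `z` stays in (or out of) the
spectrum. -/
theorem mem_hamSpec_iff_zero {C : ℝ} (hC : 0 < C) (g : ℝ) {θ z : ℂ} (hθ : θ ∈ strip)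
    (h : ∀ r ∈ Set.Icc (0 : ℝ) 1, imSegment θ r ∈ offRay z) :
    z ∈ hamSpec C g θ ↔ z ∈ hamSpec C g 0 := by
  have hcont : Continuous (imSegment θ) := by unfold imSegment; fun_prop
  have hloc : ∀ r : Set.Icc (0 : ℝ) 1,
      ∀ᶠ r' : Set.Icc (0 : ℝ) 1 in 𝓝 r, (z ∈ hamSpec C g (imSegment θ r') ↔ z ∈ hamSpec C g (imSegment θ r)) :=
    fun r => (hcont.comp continuous_subtype_val).continuousAt.eventually
      (eventually_mem_hamSpec_iff hC g (h r r.2))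
  have hconst : IsLocallyConstant fun r : Set.Icc (0 : ℝ) 1 => z ∈ hamSpec C g (imSegment θ r) :=
    (IsLocallyConstant.iff_eventually_eq _).2 fun r => (hloc r).mono fun r' h => propext h
  have h1 := hconst.apply_eq_of_preconnectedSpace ⟨1, by simp⟩ ⟨0, by simp⟩
  have h2 : hamSpec C g (imSegment θ 1) = hamSpec C g θ :=
    hamSpec_congr hC g hθ (by rw [imSegment_im, one_mul])
  have h3 : hamSpec C g (imSegment θ 0) = hamSpec C g 0 :=
    hamSpec_congr hC g zero_mem_strip (by rw [imSegment_im, zero_mul, Complex.zero_im])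
  rw [← h2, ← h3]
  exact iff_of_eq h1

/-! ### The self-adjoint Hamiltonian -/

theorem ham_zero_apply (C g : ℝ) (p : H2) :
    ham C g 0 p = negLaplacian p + (g : ℂ) • mulL (pot C 0) (incl p) := by
  rw [ham, perturbed_apply, rot, mul_zero, Complex.exp_zero, one_smul]
  rfl

theorem inner_ham {C : ℝ} (hC : 0 < C) (g : ℝ) (p q : H2) :
    ⟪ham C g 0 p, incl q⟫_ℂ = ⟪incl p, ham C g 0 q⟫_ℂ := by
  have hv := isBddMeas_pot hC zero_mem_strip
  rw [ham_zero_apply, ham_zero_apply, inner_add_left, inner_add_right, inner_negLaplacian,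
    inner_smul_left, inner_smul_right, Complex.conj_ofReal,
    inner_mulL hv hv (conj_pot_zero C)]

/-- By symmetry `⟪ψ, Hψ⟫` is real, so `Im ⟪ψ, (H - z)ψ⟫ = -Im z ‖ψ‖²`; Cauchy–Schwarz concludes. -/
theorem abs_im_mul_norm_le {C : ℝ} (hC : 0 < C) (g : ℝ) (z : ℂ) (p : H2) :
    |z.im| * ‖incl p‖ ≤ ‖ham C g 0 p - z • incl p‖ := by
  have h1 : (⟪incl p, ham C g 0 p⟫_ℂ).im = 0 := by
    rw [← Complex.conj_eq_iff_im, inner_conj_symm, inner_ham hC]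
  have h2 : (⟪incl p, ham C g 0 p - z • incl p⟫_ℂ).im = -(z.im * ‖incl p‖ ^ 2) := by
    rw [inner_sub_right, inner_smul_right, inner_self_eq_norm_sq_to_K, Complex.sub_im, h1]
    simp [← Complex.ofReal_pow]
  have h3 : |z.im| * ‖incl p‖ ^ 2 ≤ ‖incl p‖ * ‖ham C g 0 p - z • incl p‖ := by
    calc |z.im| * ‖incl p‖ ^ 2 = |(⟪incl p, ham C g 0 p - z • incl p⟫_ℂ).im| := by
          rw [h2, abs_neg, abs_mul, abs_of_nonneg (sq_nonneg ‖incl p‖)]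
      _ ≤ ‖⟪incl p, ham C g 0 p - z • incl p⟫_ℂ‖ := Complex.abs_im_le_norm _
      _ ≤ _ := norm_inner_le_norm _ _
  rcases (norm_nonneg (incl p)).eq_or_lt with h4 | h4
  · rw [← h4, mul_zero]
    exact norm_nonneg _
  · refine le_of_mul_le_mul_left ?_ h4
    calc _ = |z.im| * ‖incl p‖ ^ 2 := by ring
      _ ≤ _ := h3

theorem rot_zero : rot 0 = 1 := by simp [rot]

theorem notMem_posRay_of_im_ne_zero {z : ℂ} (hz : z.im ≠ 0) : z ∉ posRay := by
  rintro ⟨x, -, rfl⟩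
  exact hz (Complex.ofReal_im x)

theorem zero_mem_offRay {z : ℂ} (hz : z.im ≠ 0) : (0 : ℂ) ∈ offRay z :=
  ⟨zero_mem_strip, by rw [rot_zero, div_one]; exact notMem_posRay_of_im_ne_zero hz⟩

/-- Off the half-line spectral points are eigenvalues, so excluding non-real eigenvalues is enough.
-/
theorem notMem_hamSpec_zero {C : ℝ} (hC : 0 < C) (g : ℝ) {z : ℂ} (hz : z.im ≠ 0) :
    z ∉ hamSpec C g 0 := by
  intro h
  have hoff := zero_mem_offRay hz
  have h1 := (isEigenvalue_iff_mem_spec (relCompact_coupled hC g hoff.1) (rot_ne_zero 0)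
    hoff.2).2 h
  obtain ⟨p, hp, hA⟩ := (isEigenvalue_unbounded_iff _ _).1 h1
  have h2 := abs_im_mul_norm_le hC g z p
  have hA : ham C g 0 p = z • incl p := hA
  rw [hA, sub_self, norm_zero] at h2
  have h3 : 0 < |z.im| * ‖incl p‖ := mul_pos (abs_pos.2 hz) (norm_pos_iff.2 hp)
  linarith

/-! ### The discrete spectrum -/

/-- Non-real discrete eigenvalues lie in the sector swept by the essential spectrum. -/
theorem arg_mem_of_mem_hamSpec {C : ℝ} (hC : 0 < C) {g : ℝ} {θ z : ℂ} (hθ : θ ∈ strip)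
    (hpos : 0 < θ.im) (hz : z ∈ hamSpec C g θ) (hzim : z.im ≠ 0) (hoff : z / rot θ ∉ posRay) :
    -2 * θ.im < z.arg ∧ z.arg < 0 := by
  by_contra hcon
  -- If the half-line never crosses `z` as the angle returns to `0`, then `z` would be a non-real
  -- spectral point of `H`. A crossing at `r` gives `arg z = -2 r Im θ` with `0 < r < 1`.
  refine notMem_hamSpec_zero hC g hzim ((mem_hamSpec_iff_zero hC g hθ fun r hr => ?_).1 hz)
  refine ⟨imSegment_mem_strip hθ hr, fun hmem => ?_⟩
  have hlt := (abs_lt (a := θ.im) (b := Real.pi / 2) |>.1 hθ).2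
  rw [div_rot_mem_posRay_iff, imSegment_im] at hmem
  rw [div_rot_mem_posRay_iff] at hoff
  have hz0 : z ≠ 0 := fun h => hzim (by rw [h, Complex.zero_im])
  obtain ⟨x, hx, h⟩ := hmem
  have hx0 : x ≠ 0 := by
    rintro rfl
    rw [Complex.ofReal_zero, eq_comm, mul_eq_zero] at h
    exact h.elim hz0 (Complex.exp_ne_zero _)
  have hxpos : 0 < x := lt_of_le_of_ne hx hx0.symm
  have hr0 : r ≠ 0 := by
    rintro rfl
    rw [zero_mul, Complex.ofReal_zero, zero_mul, mul_zero, Complex.exp_zero, mul_one] at h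
    exact hzim (by rw [← h, Complex.ofReal_im])
  have hr1 : r ≠ 1 := by
    rintro rfl
    rw [one_mul] at h
    exact hoff ⟨x, hx, h⟩
  have hrpos : 0 < r := lt_of_le_of_ne hr.1 hr0.symm
  have hrlt : r < 1 := lt_of_le_of_ne hr.2 hr1
  have hzeq : z = x * (Complex.cos ((-(2 * (r * θ.im)) : ℝ) : ℂ) +
      Complex.sin ((-(2 * (r * θ.im)) : ℝ) : ℂ) * Complex.I) := by
    have h2 : z = x * Complex.exp (((-(2 * (r * θ.im)) : ℝ) : ℂ) * Complex.I) := by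
      rw [h, mul_assoc, ← Complex.exp_add]
      push_cast
      ring_nf
      simp
    rw [h2, Complex.exp_mul_I]
  have h3 : r * θ.im < θ.im := mul_lt_of_lt_one_left hpos hrlt
  have h4 : 0 < r * θ.im := mul_pos hrpos hpos
  have harg : z.arg = -(2 * (r * θ.im)) := by
    rw [hzeq]
    exact Complex.arg_mul_cos_add_sin_mul_I hxpos ⟨by linarith, by linarith⟩
  exact hcon ⟨by rw [harg]; linarith, by rw [harg]; linarith⟩

/-- As `0 < |2 Im θ| < π`, the rotated half-line meets the real axis only at `0`. -/
theorem mem_offRay_ofReal {E : ℝ} (hE : E ≠ 0) {θ : ℂ} (hθ : θ ∈ strip) (h0 : θ.im ≠ 0) :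
    θ ∈ offRay (E : ℂ) := by
  refine ⟨hθ, fun hmem => ?_⟩
  rw [div_rot_mem_posRay_iff] at hmem
  obtain ⟨x, -, h⟩ := hmem
  have h1 : (2 * ((θ.im : ℂ) * Complex.I)) = ((2 * θ.im : ℝ) : ℂ) * Complex.I := by
    push_cast; ring
  rw [h1] at h
  have him := congrArg Complex.im h
  rw [Complex.im_ofReal_mul, Complex.exp_ofReal_mul_I_im, Complex.ofReal_im] at him
  have hs : Real.sin (2 * θ.im) = 0 := (mul_eq_zero.1 him.symm).resolve_left hE
  obtain ⟨hl, hu⟩ := abs_lt (a := θ.im) (b := Real.pi / 2) |>.1 hθ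
  have h2 := (Real.sin_eq_zero_iff_of_lt_of_lt (by linarith) (by linarith)).1 hs
  exact h0 (by linarith)

/-! ### Gaussian smearing -/

/-- The normalised Gaussian kernel of inverse width `a`. -/
def gaussKer (a : ℝ) (w : ℂ) : ℂ := (√(a / Real.pi) : ℝ) * Complex.exp (-a * w ^ 2)

/-- The convolution of `φ` with a Gaussian, extended to complex arguments. -/
def smear {X : Type*} [NormedAddCommGroup X] [NormedSpace ℂ X] (a : ℝ) (φ : ℝ → X) (θ : ℂ) : X :=
  ∫ t : ℝ, gaussKer a (t - θ) • φ t

theorem norm_gaussKer_le {a : ℝ} (ha : 0 < a) (t : ℝ) (w : ℂ) :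
    ‖gaussKer a (t - w)‖ ≤ √(a / Real.pi) * Real.exp (a * ‖w‖ ^ 2) *
      Real.exp (-(a / 2) * t ^ 2) := by
  rw [gaussKer, norm_mul, Complex.norm_exp, Complex.norm_real,
    Real.norm_of_nonneg (Real.sqrt_nonneg _), mul_assoc, ← Real.exp_add]
  gcongr
  have h1 : (-(a : ℂ) * (t - w) ^ 2).re = -a * ((t - w.re) ^ 2 - w.im ^ 2) := by
    simp [sq]
  rw [h1, ← Complex.normSq_eq_norm_sq, Complex.normSq_apply]
  -- Half of this square is the difference of the two exponents.
  have h2 : 0 ≤ a * (t - 2 * w.re) ^ 2 := by positivity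
  nlinarith [h2]

theorem continuous_gaussKer (a : ℝ) : Continuous (gaussKer a) := by
  unfold gaussKer
  fun_prop

theorem hasDerivAt_gaussKer (a t : ℝ) (w : ℂ) :
    HasDerivAt (fun w : ℂ => gaussKer a (t - w)) (2 * a * (t - w) * gaussKer a (t - w)) w := by
  have h1 : HasDerivAt (fun w : ℂ => -(a : ℂ) * (t - w) ^ 2) (-(a : ℂ) * (2 * (t - w) * (-1))) w := by
    have h2 : HasDerivAt (fun w : ℂ => (t : ℂ) - w) (-1) w := by
      simpa using (hasDerivAt_id w).const_sub (t : ℂ)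
    have h3 := (h2.fun_pow 2).const_mul (-(a : ℂ))
    simpa using h3
  have h4 := (h1.cexp).const_mul ((√(a / Real.pi) : ℝ) : ℂ)
  refine h4.congr_deriv ?_
  rw [gaussKer]
  ring

theorem integrable_gaussKer_smul {X : Type*} [NormedAddCommGroup X] [NormedSpace ℂ X] {a : ℝ}
    (ha : 0 < a) {φ : ℝ → X} (hφ : Continuous φ) {M : ℝ} (hM : ∀ t, ‖φ t‖ ≤ M) (w : ℂ) :
    Integrable fun t : ℝ => gaussKer a (t - w) • φ t := by
  have h1 : Integrable fun t : ℝ => √(a / Real.pi) * Real.exp (a * ‖w‖ ^ 2) *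
      Real.exp (-(a / 2) * t ^ 2) * M :=
    ((integrable_exp_neg_mul_sq (by linarith : 0 < a / 2)).const_mul _).mul_const M
  refine h1.mono' ?_ (Eventually.of_forall fun t => ?_)
  · have : Continuous fun t : ℝ => gaussKer a (t - w) • φ t :=
      ((continuous_gaussKer a).comp (by fun_prop : Continuous fun t : ℝ => (t : ℂ) - w)).smul hφ
    exact this.aestronglyMeasurable
  · rw [norm_smul]
    exact mul_le_mul (norm_gaussKer_le ha t w) (hM t) (norm_nonneg _) (by positivity)

/-- Gaussian smearing produces entire functions. -/
theorem differentiable_smear {X : Type*} [NormedAddCommGroup X] [NormedSpace ℂ X]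
    {a : ℝ} (ha : 0 < a) {φ : ℝ → X} (hφ : Continuous φ) {M : ℝ}
    (hM : ∀ t, ‖φ t‖ ≤ M) : Differentiable ℂ (smear a φ) := by
  intro w₀
  set K : ℝ := ‖w₀‖ + 1 with hK
  have hM0 : 0 ≤ M := (norm_nonneg _).trans (hM 0)
  let A : ℝ := √(a / Real.pi) * Real.exp (a * K ^ 2) * M * (2 * a)
  let bound : ℝ → ℝ := fun t => A * (‖t * Real.exp (-(a / 2) * t ^ 2)‖ +
    K * Real.exp (-(a / 2) * t ^ 2))
  have hbound : Integrable bound :=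
    (((integrable_mul_exp_neg_mul_sq (by linarith : 0 < a / 2)).norm).add
      ((integrable_exp_neg_mul_sq (by linarith : 0 < a / 2)).const_mul K)).const_mul A
  have hcontk : ∀ w : ℂ, Continuous fun t : ℝ => gaussKer a (t - w) := fun w =>
    (continuous_gaussKer a).comp (by fun_prop : Continuous fun t : ℝ => (t : ℂ) - w)
  refine (hasDerivAt_integral_of_dominated_loc_of_deriv_le (𝕜 := ℂ) (bound := bound)
    (F := fun w t => gaussKer a (t - w) • φ t)
    (F' := fun w t => (2 * a * (t - w) * gaussKer a (t - w)) • φ t)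
    (Metric.ball_mem_nhds w₀ one_pos) (Eventually.of_forall fun w =>
      (((hcontk w).smul hφ).aestronglyMeasurable)) (integrable_gaussKer_smul ha hφ hM w₀)
    ?_ ?_ hbound ?_).2.differentiableAt
  · have : Continuous fun t : ℝ => (2 * a * (t - w₀) * gaussKer a (t - w₀)) • φ t :=
      ((by fun_prop : Continuous fun t : ℝ => 2 * (a : ℂ) * (t - w₀)).mul (hcontk w₀)).smul hφ
    exact this.aestronglyMeasurable
  · refine Eventually.of_forall fun t w hw => ?_
    have hwK : ‖w‖ ≤ K := by
      have := norm_le_norm_add_norm_sub w₀ w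
      rw [Metric.mem_ball, dist_eq_norm, norm_sub_rev] at hw
      linarith
    have h1 : ‖(2 * a * (t - w) : ℂ)‖ ≤ 2 * a * (‖t‖ + K) := by
      rw [norm_mul, norm_mul, Complex.norm_two, Complex.norm_real, Real.norm_of_nonneg ha.le]
      gcongr
      exact (norm_sub_le _ _).trans (by rw [Complex.norm_real]; gcongr)
    have h2 : ‖gaussKer a (t - w)‖ ≤
        √(a / Real.pi) * Real.exp (a * K ^ 2) * Real.exp (-(a / 2) * t ^ 2) :=
      (norm_gaussKer_le ha t w).trans (by gcongr)
    rw [norm_smul, norm_mul]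
    calc ‖(2 * a * (t - w) : ℂ)‖ * ‖gaussKer a (t - w)‖ * ‖φ t‖
        ≤ (2 * a * (‖t‖ + K)) * (√(a / Real.pi) * Real.exp (a * K ^ 2) *
          Real.exp (-(a / 2) * t ^ 2)) * M := by
          gcongr
          exact hM t
      _ = bound t := by
          simp only [bound, A]
          rw [norm_mul, Real.norm_of_nonneg (Real.exp_pos _).le]
          ring
  · exact Eventually.of_forall fun t w _ => (hasDerivAt_gaussKer a t w).smul_const (φ t)

/-- Gaussian smearing is an approximate identity. -/
theorem tendsto_smear_zero {X : Type*} [NormedAddCommGroup X] [NormedSpace ℂ X]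
    [CompleteSpace X]
    {φ : ℝ → X} (hφ : Continuous φ) {M : ℝ} (hM : ∀ t, ‖φ t‖ ≤ M) :
    Tendsto (fun a => smear a φ 0) atTop (𝓝 (φ 0)) := by
  -- The substitution `t = x/√a` moves the parameter into the argument of `φ`, ready for dominated
  -- convergence.
  have hform : ∀ a : ℝ, 0 < a → smear a φ 0 =
      (√Real.pi)⁻¹ • ∫ x : ℝ, Real.exp (-1 * x ^ 2) • φ ((√a)⁻¹ * x) := by
    intro a ha
    have hsa : 0 < √a := Real.sqrt_pos.2 ha
    have h1 := Measure.integral_comp_mul_left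
      (fun t : ℝ => Real.exp (-a * t ^ 2) • φ t) (√a)⁻¹
    have h2 : ∀ x : ℝ, Real.exp (-a * ((√a)⁻¹ * x) ^ 2) = Real.exp (-1 * x ^ 2) := by
      intro x
      congr 1
      rw [mul_pow, inv_pow, Real.sq_sqrt ha.le]
      field_simp
    simp only [h2] at h1
    rw [h1, smear, inv_inv, abs_of_pos hsa, smul_smul, ← integral_smul]
    congr 1
    funext t
    rw [gaussKer, sub_zero, smul_smul, Real.sqrt_div ha.le]
    rw [← Complex.coe_smul]
    congr 1
    push_cast
    ring
  have hlim : Tendsto (fun a : ℝ => (√Real.pi)⁻¹ • ∫ x : ℝ, Real.exp (-1 * x ^ 2) •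
      φ ((√a)⁻¹ * x)) atTop (𝓝 ((√Real.pi)⁻¹ • ∫ x : ℝ, Real.exp (-1 * x ^ 2) • φ 0)) := by
    refine Tendsto.const_smul ?_ _
    refine tendsto_integral_filter_of_dominated_convergence
      (fun x => Real.exp (-1 * x ^ 2) * M) (Eventually.of_forall fun a => ?_)
      (Eventually.of_forall fun a => Eventually.of_forall fun x => ?_)
      ((integrable_exp_neg_mul_sq one_pos).mul_const M) (Eventually.of_forall fun x => ?_)
    · have : Continuous fun x : ℝ => Real.exp (-1 * x ^ 2) • φ ((√a)⁻¹ * x) :=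
        (by fun_prop : Continuous fun x : ℝ => Real.exp (-1 * x ^ 2)).smul
          (hφ.comp (by fun_prop))
      exact this.aestronglyMeasurable
    · rw [norm_smul, Real.norm_of_nonneg (Real.exp_pos _).le]
      gcongr
      exact hM _
    · refine Tendsto.const_smul ((hφ.tendsto 0).comp ?_) _
      have h1 : Tendsto (fun a : ℝ => (√a)⁻¹ * x) atTop (𝓝 (0 * x)) :=
        (tendsto_inv_atTop_zero.comp Real.tendsto_sqrt_atTop).mul_const x
      rwa [zero_mul] at h1
  have hval : (√Real.pi)⁻¹ • ∫ x : ℝ, Real.exp (-1 * x ^ 2) • φ 0 = φ 0 := by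
    rw [integral_smul_const, integral_gaussian, div_one, smul_smul,
      inv_mul_cancel₀ (Real.sqrt_pos.2 Real.pi_pos).ne', one_smul]
  rw [hval] at hlim
  refine hlim.congr' ?_
  filter_upwards [eventually_gt_atTop 0] with a ha
  exact (hform a ha).symm

/-! ### Dilatation analytic vectors -/

/-- The smeared vector `∫ √(a/π) e^{-a(t-θ)²} u(t) f dt`; an entire function of `θ`. -/
def smearDil (a : ℝ) (θ : ℂ) (f : L2) : L2 := smear a (fun t => dil t f) θ

theorem integrable_smearDil {a : ℝ} (ha : 0 < a) (θ : ℂ) (f : L2) :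
    Integrable fun t : ℝ => gaussKer a (t - θ) • dil t f :=
  integrable_gaussKer_smul ha (continuous_dil f) (fun t => ((dil t).norm_map f).le) θ

theorem differentiable_smearDil {a : ℝ} (ha : 0 < a) (f : L2) :
    Differentiable ℂ fun θ => smearDil a θ f :=
  differentiable_smear ha (continuous_dil f) (fun t => ((dil t).norm_map f).le)

theorem tendsto_smearDil (f : L2) : Tendsto (fun a => smearDil a 0 f) atTop (𝓝 f) := by
  have h := tendsto_smear_zero (continuous_dil f) (fun t => ((dil t).norm_map f).le)
  rwa [dil_zero] at h

theorem smearDil_dil (a : ℝ) (θ : ℂ) (s : ℝ) (f : L2) :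
    smearDil a θ (dil s f) = dil s (smearDil a θ f) := by
  have h := (dil s).toLinearIsometry.integral_comp_comm
    (fun t : ℝ => gaussKer a (t - θ) • dil t f) (μ := volume)
  refine Eq.trans ?_ h
  refine integral_congr_ae (Eventually.of_forall fun t => ?_)
  change gaussKer a (t - θ) • dil t (dil s f) = dil s (gaussKer a (t - θ) • dil t f)
  rw [map_smul, dil_dil, dil_dil, add_comm]

/-- A real shift of `θ` is a translation of the integration variable, absorbed by the group law. -/
theorem smearDil_add (a : ℝ) (θ : ℂ) (s : ℝ) (f : L2) :
    smearDil a (θ + s) f = dil s (smearDil a θ f) := by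
  rw [← smearDil_dil]
  have h := integral_sub_right_eq_self (μ := (volume : Measure ℝ))
    (fun t : ℝ => gaussKer a (t - θ) • dil t (dil s f)) s
  refine Eq.trans ?_ h
  refine integral_congr_ae (Eventually.of_forall fun t => ?_)
  simp only [dil_dil, sub_add_cancel]
  congr 2
  push_cast
  ring

/-- The vectors `f_θ` obtained by smearing are total, for each `θ`. -/
theorem eq_zero_of_smearDil {X : Type*} [NormedAddCommGroup X] [NormedSpace ℂ X]
    [CompleteSpace X] (T : L2 →L[ℂ] X) (θ : ℂ) (h : ∀ a, 0 < a → ∀ f, T (smearDil a θ f) = 0) :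
    T = 0 := by
  ext1 f
  have h1 : ∀ a, 0 < a → T (smearDil a 0 f) = 0 := by
    intro a ha
    have hd : Differentiable ℂ fun w => T (smearDil a w f) :=
      T.differentiable.comp (differentiable_smearDil ha f)
    have hF : AnalyticOnNhd ℂ (fun w => T (smearDil a w f)) Set.univ :=
      hd.differentiableOn.analyticOnNhd isOpen_univ
    -- For real `t` the vector smeared at `θ + t` is a dilated `f` smeared at `θ`, so the entire
    -- function vanishes on a whole line and hence at `0`, where smearing approximates the identity.
    refine eqOn_of_eq_add_ofReal hF (analyticOnNhd_const (v := (0 : X))) isPreconnected_univ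
      (Set.mem_univ θ) (fun t => ?_) (Set.mem_univ 0)
    rw [smearDil_add, ← smearDil_dil]
    exact h a ha _
  have h2 : Tendsto (fun a => T (smearDil a 0 f)) atTop (𝓝 (T f)) :=
    (T.continuous.tendsto f).comp (tendsto_smearDil f)
  have h3 : Tendsto (fun a => T (smearDil a 0 f)) atTop (𝓝 0) := by
    refine tendsto_const_nhds.congr' ?_
    filter_upwards [eventually_gt_atTop 0] with a ha
    exact (h1 a ha).symm
  exact tendsto_nhds_unique h2 h3

/-- The functional `h ↦ ⟪f_{conj θ}, h⟫`; an entire function of `θ`. -/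
def smearFun (a : ℝ) (f : L2) (θ : ℂ) : L2 →L[ℂ] ℂ := smear a (fun t => innerSL ℂ (dil t f)) θ

theorem continuous_innerSL_dil (f : L2) : Continuous fun t => innerSL ℂ (dil t f) :=
  (innerSL ℂ).continuous.comp (continuous_dil f)

theorem norm_innerSL_dil_le (f : L2) (t : ℝ) : ‖innerSL ℂ (dil t f)‖ ≤ ‖f‖ := by
  rw [innerSL_apply_norm, (dil t).norm_map]

theorem differentiable_smearFun {a : ℝ} (ha : 0 < a) (f : L2) :
    Differentiable ℂ (smearFun a f) :=
  differentiable_smear ha (continuous_innerSL_dil f) (norm_innerSL_dil_le f)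

theorem conj_gaussKer (a : ℝ) (w : ℂ) :
    starRingEnd ℂ (gaussKer a w) = gaussKer a (starRingEnd ℂ w) := by
  rw [gaussKer, gaussKer, map_mul, Complex.conj_ofReal, ← Complex.exp_conj, map_mul, map_neg,
    Complex.conj_ofReal, map_pow]

theorem smearFun_apply {a : ℝ} (ha : 0 < a) (f : L2) (θ : ℂ) (h : L2) :
    smearFun a f θ h = ⟪smearDil a (starRingEnd ℂ θ) f, h⟫_ℂ := by
  have h1 : smearFun a f θ h = ∫ t : ℝ, gaussKer a (t - θ) * ⟪dil t f, h⟫_ℂ := by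
    have h2 := ContinuousLinearMap.integral_apply (integrable_gaussKer_smul ha
      (continuous_innerSL_dil f) (norm_innerSL_dil_le f) θ) h
    exact h2
  have h3 : ∫ t : ℝ, ⟪h, gaussKer a (t - starRingEnd ℂ θ) • dil t f⟫_ℂ
      = ⟪h, smearDil a (starRingEnd ℂ θ) f⟫_ℂ :=
    integral_inner (𝕜 := ℂ) (integrable_smearDil ha (starRingEnd ℂ θ) f) h
  rw [h1, ← inner_conj_symm, ← h3, ← integral_conj]
  refine integral_congr_ae (Eventually.of_forall fun t => ?_)
  simp only
  rw [inner_smul_right, map_mul, conj_gaussKer, map_sub, Complex.conj_conj, Complex.conj_ofReal,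
    inner_conj_symm]

/-! ### Matrix elements of the resolvent between dilatation analytic vectors -/

/-- The sign `s` treats both half-planes at once. For `0 ≤ s Im θ` the half-line `e^{-2θ}[0,∞)`
stays in the closed half-plane opposite to that of `z`. -/
theorem mem_offRay_of_half {s : ℝ} (hs : s = 1 ∨ s = -1) {z θ : ℂ} (hz : 0 < s * z.im)
    (hθ : θ ∈ strip) (hsθ : 0 ≤ s * θ.im) : θ ∈ offRay z := by
  refine ⟨hθ, fun hmem => ?_⟩
  rw [div_rot_mem_posRay_iff] at hmem
  obtain ⟨x, hx, h⟩ := hmem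
  have hx : 0 ≤ x := hx
  have hzeq : z = x * Complex.exp (((-(2 * θ.im) : ℝ) : ℂ) * Complex.I) := by
    rw [h, mul_assoc, ← Complex.exp_add]
    push_cast
    ring_nf
    simp
  have him : z.im = -(x * Real.sin (2 * θ.im)) := by
    rw [hzeq, Complex.im_ofReal_mul, Complex.exp_ofReal_mul_I_im, Real.sin_neg, mul_neg]
  obtain ⟨hl, hu⟩ := abs_lt (a := θ.im) (b := Real.pi / 2) |>.1 hθ
  rw [him] at hz
  rcases hs with rfl | rfl
  · have h1 : 0 ≤ Real.sin (2 * θ.im) :=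
      Real.sin_nonneg_of_nonneg_of_le_pi (by linarith) (by linarith)
    have := mul_nonneg hx h1
    linarith
  · have h1 : Real.sin (2 * θ.im) ≤ 0 :=
      Real.sin_nonpos_of_nonpos_of_neg_pi_le (by linarith) (by linarith)
    have := mul_nonpos_of_nonneg_of_nonpos hx h1
    linarith

theorem half_imSegment {s : ℝ} {θ : ℂ} (hsθ : 0 ≤ s * θ.im) {r : ℝ}
    (hr : r ∈ Set.Icc (0 : ℝ) 1) : 0 ≤ s * (imSegment θ r).im := by
  rw [imSegment_im, mul_left_comm]
  exact mul_nonneg hr.1 hsθ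

theorem im_ne_zero_of_half {s : ℝ} {z : ℂ} (hz : 0 < s * z.im) : z.im ≠ 0 := fun h => by
  rw [h, mul_zero] at hz
  exact lt_irrefl _ hz

theorem notMem_hamSpec_of_half {C : ℝ} (hC : 0 < C) (g : ℝ) {s : ℝ} (hs : s = 1 ∨ s = -1)
    {z θ : ℂ} (hz : 0 < s * z.im) (hθ : θ ∈ strip) (hsθ : 0 ≤ s * θ.im) : z ∉ hamSpec C g θ := by
  rw [mem_hamSpec_iff_zero hC g hθ fun r hr =>
    mem_offRay_of_half hs hz (imSegment_mem_strip hθ hr) (half_imSegment hsθ hr)]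
  exact notMem_hamSpec_zero hC g (im_ne_zero_of_half hz)

theorem hamRes_ham {C : ℝ} (hC : 0 < C) (g : ℝ) {θ z : ℂ} (h : θ ∈ offRay z)
    (hz : z ∉ hamSpec C g θ) (p : H2) :
    hamRes C g θ z (ham C g θ p - z • incl p) = incl p := by
  rw [mem_hamSpec_iff hC g h, not_not] at hz
  exact resolv_perturbed (rot_ne_zero θ) h.2 hz p

theorem exists_ham_eq {C : ℝ} (hC : 0 < C) (g : ℝ) {θ z : ℂ} (h : θ ∈ offRay z)
    (hz : z ∉ hamSpec C g θ) (f : L2) :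
    ∃ p : H2, incl p = hamRes C g θ z f ∧ ham C g θ p - z • incl p = f := by
  rw [mem_hamSpec_iff hC g h, not_not] at hz
  exact exists_resolv_eq (rot_ne_zero θ) h.2 hz f

theorem hamRes_dil {C : ℝ} (hC : 0 < C) (g : ℝ) {θ z : ℂ} (h : θ ∈ offRay z)
    (hz : z ∉ hamSpec C g θ) (t : ℝ) (f : L2) :
    hamRes C g (θ + t) z (dil t f) = dil t (hamRes C g θ z f) := by
  obtain ⟨p, hp, hA⟩ := exists_ham_eq hC g h hz f
  have h' : θ + t ∈ offRay z := (mem_offRay_congr (by simp)).2 h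
  have hz' : z ∉ hamSpec C g (θ + t) := by rwa [hamSpec_translate hC g h.1]
  have h1 := hamRes_ham hC g h' hz' (dilH2 t p)
  rwa [ham_dilH2 hC g h.1, incl_dilH2, ← map_smul, ← map_sub, hA, hp] at h1

/-- The matrix element of the resolvent of `H(θ)` between two smeared vectors. -/
def matElem (C g a b : ℝ) (f h : L2) (z θ : ℂ) : ℂ :=
  smearFun a f θ (hamRes C g θ z (smearDil b θ h))

/-- Conjugation fixes the real shift, so both arguments of the inner product undergo the same
unitary dilatation. -/
theorem smearFun_add_dil {a : ℝ} (ha : 0 < a) (f : L2) (θ : ℂ) (t : ℝ) (y : L2) :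
    smearFun a f (θ + t) (dil t y) = smearFun a f θ y := by
  rw [smearFun_apply ha, smearFun_apply ha, map_add, Complex.conj_ofReal, smearDil_add,
    (dil t).inner_map_map]

theorem matElem_add {C : ℝ} (hC : 0 < C) (g : ℝ) {a : ℝ} (ha : 0 < a) (b : ℝ)
    (f h : L2) {z θ : ℂ} (hoff : θ ∈ offRay z) (hz : z ∉ hamSpec C g θ) (t : ℝ) :
    matElem C g a b f h z (θ + t) = matElem C g a b f h z θ := by
  rw [matElem, matElem, smearDil_add, hamRes_dil hC g hoff hz, smearFun_add_dil ha]

theorem differentiableAt_matElem {C : ℝ} (hC : 0 < C) (g : ℝ) {a b : ℝ} (ha : 0 < a) (hb : 0 < b)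
    (f h : L2) {z θ : ℂ} (hoff : θ ∈ offRay z) (hz : z ∉ hamSpec C g θ) :
    DifferentiableAt ℂ (matElem C g a b f h z) θ :=
  ((differentiable_smearFun ha f).differentiableAt).clm_apply
    ((differentiableAt_hamRes hC g hoff hz).clm_apply (differentiable_smearDil hb h).differentiableAt)

/-- A function invariant under real translations has vanishing complex derivative. -/
theorem hasDerivAt_zero_of_add_ofReal {X : Type*} [NormedAddCommGroup X] [NormedSpace ℂ X]
    {F : ℂ → X} {θ : ℂ} (hF : DifferentiableAt ℂ F θ) (h : ∀ t : ℝ, F (θ + t) = F θ) :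
    HasDerivAt F 0 θ := by
  have h1 := hF.hasDerivAt
  have h2 : HasDerivAt (fun t : ℝ => θ + (t : ℂ)) 1 0 := by
    simpa using (Complex.ofRealCLM.hasDerivAt (x := (0 : ℝ))).const_add θ
  have h3 : HasDerivAt F (deriv F θ) (θ + ((0 : ℝ) : ℂ)) := by simpa using h1
  have h4 := h3.scomp (0 : ℝ) h2
  have h5 : (F ∘ fun t : ℝ => θ + (t : ℂ)) = fun _ => F θ := funext h
  rw [h5, one_smul] at h4
  rwa [h4.unique (hasDerivAt_const (0 : ℝ) (F θ))] at h1

/-- A holomorphic function invariant under real shifts has zero derivative, so it is constant on the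
vertical segment from `0` to `i Im θ`; a last real shift reaches `θ`. -/
theorem matElem_eq_zero_param {C : ℝ} (hC : 0 < C) (g : ℝ) {s : ℝ} (hs : s = 1 ∨ s = -1)
    {a b : ℝ} (ha : 0 < a) (hb : 0 < b) (f h : L2)
    {z θ : ℂ} (hz : 0 < s * z.im) (hθ : θ ∈ strip) (hsθ : 0 ≤ s * θ.im) :
    matElem C g a b f h z θ = matElem C g a b f h z 0 := by
  have hmem : ∀ r ∈ Set.Icc (0 : ℝ) 1, imSegment θ r ∈ offRay z ∧
      z ∉ hamSpec C g (imSegment θ r) := fun r hr =>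
    ⟨mem_offRay_of_half hs hz (imSegment_mem_strip hθ hr) (half_imSegment hsθ hr),
      notMem_hamSpec_of_half hC g hs hz (imSegment_mem_strip hθ hr) (half_imSegment hsθ hr)⟩
  have hder : ∀ r ∈ Set.Icc (0 : ℝ) 1,
      HasDerivAt (fun r => matElem C g a b f h z (imSegment θ r)) 0 r := by
    intro r hr
    obtain ⟨h1, h2⟩ := hmem r hr
    have h3 := hasDerivAt_zero_of_add_ofReal (differentiableAt_matElem hC g ha hb f h h1 h2)
      (matElem_add hC g ha b f h h1 h2)
    have h4 : HasDerivAt (imSegment θ) (θ.im * Complex.I) r := by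
      have h5 : HasDerivAt (fun r : ℝ => ((r * θ.im : ℝ) : ℂ)) (θ.im : ℂ) r := by
        simpa using ((hasDerivAt_id r).mul_const θ.im).ofReal_comp
      exact h5.mul_const Complex.I
    have h6 := h3.scomp r h4
    rwa [smul_zero] at h6
  have h1 := constant_of_has_deriv_right_zero
    (fun r hr => (hder r hr).continuousAt.continuousWithinAt)
    (fun r hr => (hder r (Set.Ico_subset_Icc_self hr)).hasDerivWithinAt) 1 (by simp)
  have h2 : imSegment θ 0 = 0 := by simp [imSegment]
  have h3 : θ = imSegment θ 1 + (θ.re : ℂ) := by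
    apply Complex.ext <;> simp [imSegment]
  obtain ⟨h4, h5⟩ := hmem 1 (by simp)
  rw [h2] at h1
  rw [← h1]
  conv_lhs => rw [h3]
  exact matElem_add hC g ha b f h h4 h5 θ.re

theorem matElem_zero {C g a b : ℝ} (ha : 0 < a) (f h : L2) (z : ℂ) :
    matElem C g a b f h z 0 = ⟪smearDil a 0 f, hamRes C g 0 z (smearDil b 0 h)⟫_ℂ := by
  rw [matElem, smearFun_apply ha, map_zero]

/-! ### Boundary values of the resolvent at the real axis -/

/-- The point `E + i s ε`. -/
def nearReal (s E ε : ℝ) : ℂ := E + ((s * ε : ℝ) : ℂ) * Complex.I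

theorem nearReal_im (s E ε : ℝ) : (nearReal s E ε).im = s * ε := by simp [nearReal]

theorem half_nearReal {s : ℝ} (hs : s = 1 ∨ s = -1) (E : ℝ) {ε : ℝ} (hε : 0 < ε) :
    0 < s * (nearReal s E ε).im := by
  rw [nearReal_im]
  rcases hs with rfl | rfl <;> simpa using hε

theorem continuous_nearReal (s E : ℝ) : Continuous (nearReal s E) := by
  unfold nearReal; fun_prop

theorem nearReal_zero (s E : ℝ) : nearReal s E 0 = E := by simp [nearReal]

theorem tendsto_nearReal (s E : ℝ) : Tendsto (nearReal s E) (𝓝[>] 0) (𝓝 (E : ℂ)) := by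
  have h := (continuous_nearReal s E).tendsto 0
  rw [nearReal_zero] at h
  exact h.mono_left nhdsWithin_le_nhds

theorem nearReal_sub (s E ε : ℝ) : nearReal s E ε - E = ((s * ε : ℝ) : ℂ) * Complex.I := by
  simp [nearReal]

theorem norm_nearReal_sub {s : ℝ} (hs : s = 1 ∨ s = -1) (E : ℝ) {ε : ℝ} (hε : 0 < ε) :
    ‖nearReal s E ε - E‖ = ε := by
  rw [nearReal_sub, norm_mul, Complex.norm_I, mul_one, Complex.norm_real]
  rcases hs with rfl | rfl <;> simp [abs_of_pos hε]

theorem tendsto_nearReal_ne {s : ℝ} (hs : s = 1 ∨ s = -1) (E : ℝ) :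
    Tendsto (nearReal s E) (𝓝[>] 0) (𝓝[≠] (E : ℂ)) := by
  refine tendsto_nhdsWithin_iff.2 ⟨tendsto_nearReal s E, ?_⟩
  filter_upwards [self_mem_nhdsWithin] with ε hε h
  have h1 := norm_nearReal_sub hs E hε
  have h2 : nearReal s E ε = E := h
  rw [h2, sub_self, norm_zero] at h1
  exact (Set.mem_Ioi.1 hε).ne h1

theorem norm_hamRes_zero_le {C : ℝ} (hC : 0 < C) (g : ℝ) {z : ℂ} (hz : z.im ≠ 0) (f : L2) :
    |z.im| * ‖hamRes C g 0 z f‖ ≤ ‖f‖ := by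
  obtain ⟨p, hp, hA⟩ := exists_ham_eq hC g (zero_mem_offRay hz) (notMem_hamSpec_zero hC g hz) f
  rw [← hp, ← hA]
  exact abs_im_mul_norm_le hC g z p

theorem norm_smul_hamRes_le {C : ℝ} (hC : 0 < C) (g : ℝ) {s : ℝ} (hs : s = 1 ∨ s = -1) (E : ℝ)
    {ε : ℝ} (hε : 0 < ε) (f : L2) : ‖(ε : ℂ) • hamRes C g 0 (nearReal s E ε) f‖ ≤ ‖f‖ := by
  have h := norm_hamRes_zero_le hC g (im_ne_zero_of_half (half_nearReal hs E hε)) f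
  rw [nearReal_im] at h
  rw [norm_smul, Complex.norm_real, Real.norm_of_nonneg hε.le]
  convert h using 2
  rcases hs with rfl | rfl <;> simp [abs_of_pos hε]

/-- An eigenvalue of `H` stays in the spectrum of `H(θ)`. -/
theorem mem_hamSpec_of_isEigenvalue {C : ℝ} (hC : 0 < C) (g : ℝ) {s : ℝ} (hs : s = 1 ∨ s = -1)
    {E : ℝ} {θ : ℂ} (hoff : θ ∈ offRay (E : ℂ)) (hsθ : 0 ≤ s * θ.im)
    (hE : IsEigenvalue (unbounded (ham C g 0)) (E : ℂ)) : (E : ℂ) ∈ hamSpec C g θ := by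
  by_contra hspec
  obtain ⟨p, hp, hA⟩ := (isEigenvalue_unbounded_iff _ _).1 hE
  set ψ := incl p with hψ
  -- If `E` is not in the spectrum of `H(θ)`, the matrix element, computed at `θ`, is continuous in
  -- `z` at `E`, so the factor `ε` kills it. At parameter `0` it involves the resolvent of `H`.
  have hlim : ∀ a, 0 < a → Tendsto (fun ε : ℝ => (ε : ℂ) *
      ⟪smearDil a 0 ψ, hamRes C g 0 (nearReal s E ε) (smearDil a 0 ψ)⟫_ℂ) (𝓝[>] 0) (𝓝 0) := by
    intro a ha
    have hu := hspec
    rw [mem_hamSpec_iff hC g hoff, not_not] at hu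
    have h1 : ContinuousAt (fun z => matElem C g a a ψ ψ z θ) E := by
      have h2 : ContinuousAt (fun z => hamRes C g θ z) E :=
        (analyticAt_resolv hoff.2 hu).continuousAt
      exact (smearFun a ψ θ).continuous.continuousAt.comp
        (h2.clm_apply continuousAt_const)
    have h3 : Tendsto (fun ε : ℝ => (ε : ℂ)) (𝓝[>] 0) (𝓝 0) := by
      have := Complex.continuous_ofReal.tendsto 0
      rw [Complex.ofReal_zero] at this
      exact this.mono_left nhdsWithin_le_nhds
    have h4 := h3.mul (h1.tendsto.comp (tendsto_nearReal s E))
    rw [zero_mul] at h4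
    refine h4.congr' ?_
    filter_upwards [self_mem_nhdsWithin] with ε hε
    rw [Function.comp_apply, matElem_eq_zero_param hC g hs ha ha ψ ψ (half_nearReal hs E hε)
      hoff.1 hsθ, matElem_zero ha]
  have hRψ : ∀ ε : ℝ, 0 < ε → (ε : ℂ) • hamRes C g 0 (nearReal s E ε) ψ
      = ((s : ℂ) * Complex.I) • ψ := by
    intro ε hε
    have him := im_ne_zero_of_half (half_nearReal hs E hε)
    have h1 := hamRes_ham hC g (zero_mem_offRay him) (notMem_hamSpec_zero hC g him) p
    rw [hA, ← sub_smul, ← neg_sub, nearReal_sub, map_smul] at h1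
    rw [← hψ] at h1
    conv_rhs => rw [← h1]
    rw [smul_smul]
    congr 1
    have h2 : (s : ℂ) * s = 1 := by rcases hs with rfl | rfl <;> simp
    push_cast
    linear_combination (-(ε : ℂ)) * h2 + (s : ℂ) * s * ε * Complex.I_mul_I
  -- On `ψ` itself `ε R` acts as the scalar `is`. Replacing `ψ` by its smearing costs the right-hand
  -- side, by the uniform bound on `ε R`, and letting `a → ∞` forces `ψ = 0`.
  have hbound : ∀ a, 0 < a → ‖⟪smearDil a 0 ψ, ψ⟫_ℂ‖ ≤
      ‖smearDil a 0 ψ‖ * ‖smearDil a 0 ψ - ψ‖ := by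
    intro a ha
    set Ψ := smearDil a 0 ψ
    have h1 : Tendsto (fun ε : ℝ => ‖(ε : ℂ) * ⟪Ψ, hamRes C g 0 (nearReal s E ε) Ψ⟫_ℂ‖ +
        ‖Ψ‖ * ‖Ψ - ψ‖) (𝓝[>] 0) (𝓝 (‖(0 : ℂ)‖ + ‖Ψ‖ * ‖Ψ - ψ‖)) :=
      (hlim a ha).norm.add tendsto_const_nhds
    rw [norm_zero, zero_add] at h1
    refine ge_of_tendsto h1 ?_
    filter_upwards [self_mem_nhdsWithin] with ε hε
    set R := hamRes C g 0 (nearReal s E ε)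
    have h2 : ‖⟪Ψ, ψ⟫_ℂ‖ = ‖⟪Ψ, (ε : ℂ) • R ψ⟫_ℂ‖ := by
      rw [hRψ ε hε, inner_smul_right, norm_mul, norm_mul, Complex.norm_I, Complex.norm_real]
      rcases hs with rfl | rfl <;> simp
    have h3 : ⟪Ψ, (ε : ℂ) • R ψ⟫_ℂ = (ε : ℂ) * ⟪Ψ, R Ψ⟫_ℂ - ⟪Ψ, (ε : ℂ) • R (Ψ - ψ)⟫_ℂ := by
      rw [map_sub, smul_sub, inner_sub_right, inner_smul_right _ (R Ψ)]
      ring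
    rw [h2, h3]
    refine (norm_sub_le _ _).trans ?_
    gcongr
    refine (norm_inner_le_norm _ _).trans ?_
    gcongr
    exact norm_smul_hamRes_le hC g hs E hε _
  have hΨ := tendsto_smearDil ψ
  have h1 : Tendsto (fun a => ‖⟪smearDil a 0 ψ, ψ⟫_ℂ‖) atTop (𝓝 ‖⟪ψ, ψ⟫_ℂ‖) :=
    (hΨ.inner tendsto_const_nhds).norm
  have h2 : Tendsto (fun a => ‖smearDil a 0 ψ‖ * ‖smearDil a 0 ψ - ψ‖) atTop
      (𝓝 (‖ψ‖ * ‖ψ - ψ‖)) := hΨ.norm.mul (hΨ.sub_const ψ).norm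
  have h3 := le_of_tendsto_of_tendsto h1 h2 (by
    filter_upwards [eventually_gt_atTop 0] with a ha
    exact hbound a ha)
  rw [sub_self, norm_zero, mul_zero, norm_le_zero_iff, inner_self_eq_zero] at h3
  exact hp h3

/-- Orthogonality says formally that `f` is an eigenvector of the adjoint. Self-adjointness enters
through surjectivity of `H ± i`: for `q = (E + i)(H + i)⁻¹ f` the vector `f - q` is orthogonal to
the range of `H - i`, so `f = q` lies in the domain. -/
theorem orthogonal_range_eq_bot {C : ℝ} (hC : 0 < C) (g : ℝ) {E : ℝ}
    (hE : ¬ IsEigenvalue (unbounded (ham C g 0)) (E : ℂ)) {f : L2}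
    (hf : ∀ p : H2, ⟪ham C g 0 p - (E : ℂ) • incl p, f⟫_ℂ = 0) : f = 0 := by
  have himI : Complex.I.im ≠ 0 := by simp
  have himI' : (-Complex.I).im ≠ 0 := by simp
  obtain ⟨q₀, -, hq₀⟩ := exists_ham_eq hC g (zero_mem_offRay himI')
    (notMem_hamSpec_zero hC g himI') f
  set q : H2 := ((E : ℂ) - -Complex.I) • q₀ with hq
  have hAq : ham C g 0 q - (-Complex.I) • incl q = ((E : ℂ) - -Complex.I) • f := by
    rw [hq, map_smul, map_smul, smul_comm (-Complex.I), ← smul_sub, hq₀]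
  have horth : ∀ p : H2, ⟪ham C g 0 p - Complex.I • incl p, f - incl q⟫_ℂ = 0 := by
    intro p
    have h1 : ⟪ham C g 0 p - Complex.I • incl p, f⟫_ℂ = ((E : ℂ) + Complex.I) * ⟪incl p, f⟫_ℂ := by
      have h2 : ham C g 0 p - Complex.I • incl p =
          (ham C g 0 p - (E : ℂ) • incl p) + ((E : ℂ) - Complex.I) • incl p := by
        rw [sub_smul]; abel
      rw [h2, inner_add_left, hf, zero_add, inner_smul_left, map_sub, Complex.conj_ofReal,
        Complex.conj_I, sub_neg_eq_add]
    have h3 : ⟪ham C g 0 p - Complex.I • incl p, incl q⟫_ℂ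
        = ⟪incl p, ham C g 0 q - (-Complex.I) • incl q⟫_ℂ := by
      rw [inner_sub_left, inner_sub_right, inner_ham hC, inner_smul_left, inner_smul_right,
        Complex.conj_I]
    rw [inner_sub_right, h1, h3, hAq, inner_smul_right, sub_neg_eq_add, sub_self]
  have hfq : f = incl q := by
    obtain ⟨p, -, hp⟩ := exists_ham_eq hC g (zero_mem_offRay himI)
      (notMem_hamSpec_zero hC g himI) (f - incl q)
    have := horth p
    rw [hp, inner_self_eq_zero] at this
    exact sub_eq_zero.1 this
  by_contra hf0
  refine hE ((isEigenvalue_unbounded_iff _ _).2 ⟨q, hfq ▸ hf0, ?_⟩)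
  rw [hfq, sub_smul] at hAq
  exact sub_left_injective hAq

/-- The range of `H - E` is dense, and on it `R (H - E) p = p + (z - E) R p` has norm at most `2
‖p‖`. The bound `‖ε R‖ ≤ 1` extends the limit to all vectors. -/
theorem tendsto_smul_hamRes_zero {C : ℝ} (hC : 0 < C) (g : ℝ) {s : ℝ} (hs : s = 1 ∨ s = -1)
    {E : ℝ} (hE : ¬ IsEigenvalue (unbounded (ham C g 0)) (E : ℂ)) (f : L2) :
    Tendsto (fun ε : ℝ => (ε : ℂ) • hamRes C g 0 (nearReal s E ε) f) (𝓝[>] 0) (𝓝 0) := by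
  let A : H2 →L[ℂ] L2 := ham C g 0 - (E : ℂ) • incl
  have hA : ∀ p, A p = ham C g 0 p - (E : ℂ) • incl p := fun p => rfl
  have hdense : (LinearMap.range (A : H2 →ₗ[ℂ] L2)).topologicalClosure = ⊤ := by
    rw [Submodule.topologicalClosure_eq_top_iff, Submodule.eq_bot_iff]
    intro h hh
    exact orthogonal_range_eq_bot hC g hE fun p => hh (A p) ⟨p, rfl⟩
  rw [tendsto_zero_iff_norm_tendsto_zero, Metric.tendsto_nhds]
  intro δ hδ
  have hf : f ∈ (LinearMap.range (A : H2 →ₗ[ℂ] L2)).topologicalClosure := by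
    rw [hdense]; trivial
  obtain ⟨_, ⟨p, rfl⟩, hp⟩ := Metric.mem_closure_iff.1 hf (δ / 2) (by linarith)
  rw [dist_eq_norm] at hp
  have hp : ‖f - A p‖ < δ / 2 := hp
  have hev : ∀ᶠ ε : ℝ in 𝓝[>] 0, ε * (2 * ‖incl p‖) < δ / 2 := by
    have h1 : Tendsto (fun ε : ℝ => ε * (2 * ‖incl p‖)) (𝓝[>] 0) (𝓝 (0 * (2 * ‖incl p‖))) :=
      (tendsto_id.mono_left nhdsWithin_le_nhds).mul_const _
    rw [zero_mul] at h1
    exact h1.eventually_lt_const (by linarith)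
  filter_upwards [hev, self_mem_nhdsWithin] with ε hε1 hε
  have hε : 0 < ε := hε
  rw [dist_zero_right, norm_norm]
  set R := hamRes C g 0 (nearReal s E ε) with hR
  have him := im_ne_zero_of_half (half_nearReal hs E hε)
  have h1 : R (A p) = incl p + (nearReal s E ε - E) • R (incl p) := by
    have h2 : A p = (ham C g 0 p - nearReal s E ε • incl p) + (nearReal s E ε - E) • incl p := by
      rw [hA, sub_smul]; abel
    rw [h2, map_add, map_smul,
      hamRes_ham hC g (zero_mem_offRay him) (notMem_hamSpec_zero hC g him)]
  have h3 : ‖(ε : ℂ) • R (A p)‖ ≤ ε * (2 * ‖incl p‖) := by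
    have h4 := norm_smul_hamRes_le hC g hs E hε (incl p)
    rw [norm_smul, Complex.norm_real, Real.norm_of_nonneg hε.le] at h4 ⊢
    gcongr
    rw [h1]
    refine (norm_add_le _ _).trans ?_
    rw [norm_smul, norm_nearReal_sub hs E hε]
    linarith
  calc ‖(ε : ℂ) • R f‖ = ‖(ε : ℂ) • R (f - A p) + (ε : ℂ) • R (A p)‖ := by
        rw [← smul_add, ← map_add, sub_add_cancel]
    _ ≤ ‖f - A p‖ + ε * (2 * ‖incl p‖) :=
        (norm_add_le _ _).trans (add_le_add (norm_smul_hamRes_le hC g hs E hε _) h3)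
    _ < δ := by linarith

/-- A real point of the discrete spectrum of `H(θ)` is an eigenvalue of `H`. -/
theorem isEigenvalue_of_mem_hamSpec {C : ℝ} (hC : 0 < C) (g : ℝ) {s : ℝ} (hs : s = 1 ∨ s = -1)
    {E : ℝ} {θ : ℂ} (hoff : θ ∈ offRay (E : ℂ)) (hsθ : 0 ≤ s * θ.im)
    (hspec : (E : ℂ) ∈ hamSpec C g θ) : IsEigenvalue (unbounded (ham C g 0)) (E : ℂ) := by
  by_contra hE
  have hB := relCompact_coupled hC g hoff.1
  have hmero : MeromorphicAt (hamRes C g θ) E := meromorphicAt_resolv hB (rot_ne_zero θ) hoff.2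
  obtain ⟨p, hp, hA⟩ := (isEigenvalue_unbounded_iff _ _).1
    ((isEigenvalue_iff_mem_spec hB (rot_ne_zero θ) hoff.2).2 hspec)
  have hA : ham C g θ p = (E : ℂ) • incl p := hA
  have hRψ : ∀ ε : ℝ, 0 < ε →
      ((E : ℂ) - nearReal s E ε) • hamRes C g θ (nearReal s E ε) (incl p) = incl p := by
    intro ε hε
    have hz := half_nearReal hs E hε
    have h1 := hamRes_ham hC g (mem_offRay_of_half hs hz hoff.1 hsθ)
      (notMem_hamSpec_of_half hC g hs hz hoff.1 hsθ) p
    rwa [hA, ← sub_smul, map_smul] at h1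
  -- An eigenvector of `H(θ)` prevents the resolvent from having a finite limit, so there is a pole,
  -- of order `k + 1` with leading coefficient `G E ≠ 0`.
  have horder : ¬ 0 ≤ meromorphicOrderAt (hamRes C g θ) (E : ℂ) := by
    intro h0
    obtain ⟨c, hc⟩ := tendsto_nhds_of_meromorphicOrderAt_nonneg hmero h0
    have h1 : Tendsto (fun ε : ℝ => ((E : ℂ) - nearReal s E ε) •
        hamRes C g θ (nearReal s E ε) (incl p)) (𝓝[>] 0) (𝓝 (((E : ℂ) - E) • c (incl p))) :=
      ((tendsto_nearReal s E).const_sub (E : ℂ)).smul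
        (((ContinuousLinearMap.apply ℂ L2 (incl p)).continuous.tendsto c).comp
          (hc.comp (tendsto_nearReal_ne hs E)))
    rw [sub_self, zero_smul] at h1
    have h2 : Tendsto (fun _ : ℝ => incl p) (𝓝[>] 0) (𝓝 0) := by
      refine h1.congr' ?_
      filter_upwards [self_mem_nhdsWithin] with ε hε
      exact hRψ ε hε
    exact hp (tendsto_nhds_unique tendsto_const_nhds h2)
  have hne_top : meromorphicOrderAt (hamRes C g θ) (E : ℂ) ≠ ⊤ := fun h => horder (h ▸ le_top)
  obtain ⟨n, hn⟩ := WithTop.ne_top_iff_exists.1 hne_top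
  have hn0 : n ≤ -1 := by
    rw [← hn] at horder
    have : ¬ (0 : ℤ) ≤ n := fun h => horder (by exact_mod_cast h)
    omega
  obtain ⟨G, hG, hG0, hRG⟩ := (meromorphicOrderAt_eq_int_iff hmero).1 hn.symm
  obtain ⟨k, hk⟩ := Int.eq_ofNat_of_zero_le (a := -n - 1) (by omega)
  have hnk : n = -((k + 1 : ℕ) : ℤ) := by push_cast; omega
  -- The matrix elements of the resolvents of `H(θ)` and `H` agree. Since `ε R f → 0` for `H`, the
  -- leading Laurent coefficient vanishes between smeared vectors.
  have hzero : ∀ a b, 0 < a → 0 < b → ∀ f h : L2,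
      smearFun a f θ (G E (smearDil b θ h)) = 0 := by
    intro a b ha hb f h
    set ℓ := smearFun a f θ
    set y := smearDil b θ h
    have h1 : Tendsto (fun ε : ℝ => ‖ℓ (G (nearReal s E ε) y)‖) (𝓝[>] 0) (𝓝 ‖ℓ (G E y)‖) :=
      ((ℓ.continuous.tendsto _).comp
        (((ContinuousLinearMap.apply ℂ L2 y).continuous.tendsto (G E)).comp
          (hG.continuousAt.tendsto.comp (tendsto_nearReal s E)))).norm
    have h2 : Tendsto (fun ε : ℝ => ‖smearFun a f 0 ((ε : ℂ) •
        hamRes C g 0 (nearReal s E ε) (smearDil b 0 h))‖) (𝓝[>] 0) (𝓝 0) := by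
      have h3 := (((smearFun a f 0).continuous.tendsto _).comp
        (tendsto_smul_hamRes_zero hC g hs hE (smearDil b 0 h))).norm
      rwa [map_zero, norm_zero] at h3
    have h4 : ∀ᶠ ε : ℝ in 𝓝[>] 0, ‖ℓ (G (nearReal s E ε) y)‖ ≤
        ‖smearFun a f 0 ((ε : ℂ) • hamRes C g 0 (nearReal s E ε) (smearDil b 0 h))‖ := by
      have hlt : ∀ᶠ ε : ℝ in 𝓝[>] 0, ε ≤ 1 :=
        (eventually_le_nhds zero_lt_one).filter_mono nhdsWithin_le_nhds
      filter_upwards [self_mem_nhdsWithin, hlt, (tendsto_nearReal_ne hs E).eventually hRG]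
        with ε hε hε1 hR
      have hε : 0 < ε := hε
      have h5 : smearFun a f 0 (hamRes C g 0 (nearReal s E ε) (smearDil b 0 h))
          = ℓ (hamRes C g θ (nearReal s E ε) y) :=
        (matElem_eq_zero_param hC g hs ha hb f h (half_nearReal hs E hε) hoff.1 hsθ).symm
      have h6 : ‖(nearReal s E ε - E) ^ n‖ = (ε ^ (k + 1))⁻¹ := by
        rw [norm_zpow, norm_nearReal_sub hs E hε, hnk, zpow_neg, zpow_natCast]
      rw [map_smul, h5, hR, smul_apply, map_smul, norm_smul, norm_smul, h6,
        Complex.norm_real, Real.norm_of_nonneg hε.le, pow_succ, mul_inv, mul_comm (ε ^ k)⁻¹,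
        ← mul_assoc, ← mul_assoc, mul_inv_cancel₀ hε.ne', one_mul]
      -- One factor `ε` cancels one order of the pole; the remaining `ε^{-k}` is at least 1 for `ε ≤
      -- 1`.
      refine le_mul_of_one_le_left (norm_nonneg _) ?_
      exact (one_le_inv₀ (pow_pos hε k)).2 (pow_le_one₀ hε.le hε1)
    have h7 := le_of_tendsto_of_tendsto h1 h2 h4
    exact norm_le_zero_iff.1 h7
  refine hG0 ?_
  -- Totality of the smeared vectors is used twice: at `θ` for the right argument, then at `conj θ`
  -- for the left one.
  have hcomp : ∀ a, 0 < a → ∀ f : L2, (smearFun a f θ).comp (G E) = 0 := fun a ha f =>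
    eq_zero_of_smearDil _ θ fun b hb h => hzero a b ha hb f h
  ext1 y
  have hy : innerSL ℂ (G E y) = 0 := by
    refine eq_zero_of_smearDil _ (starRingEnd ℂ θ) fun a ha f => ?_
    have h1 : smearFun a f θ (G E y) = 0 := DFunLike.congr_fun (hcomp a ha f) y
    rw [smearFun_apply ha] at h1
    rw [innerSL_apply_apply, ← inner_conj_symm, h1, map_zero]
  have h2 : ⟪G E y, G E y⟫_ℂ = 0 := DFunLike.congr_fun hy (G E y)
  exact inner_self_eq_zero.1 h2

/-- The non-zero real eigenvalues of `H(θ)` are those of `H`. -/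
theorem isEigenvalue_ham_iff {C : ℝ} (hC : 0 < C) (g : ℝ) {E : ℝ} (hE : E ≠ 0) {θ : ℂ}
    (hθ : θ ∈ strip) : IsEigenvalue (unbounded (ham C g θ)) (E : ℂ) ↔
      IsEigenvalue (unbounded (ham C g 0)) (E : ℂ) := by
  by_cases h0 : θ.im = 0
  · exact isEigenvalue_congr hC g zero_mem_strip (by rw [h0, Complex.zero_im]) E
  · have hoff := mem_offRay_ofReal hE hθ h0
    have hB := relCompact_coupled hC g hθ
    obtain ⟨s, hs, hsθ⟩ : ∃ s : ℝ, (s = 1 ∨ s = -1) ∧ 0 ≤ s * θ.im := by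
      rcases le_total 0 θ.im with h | h
      · exact ⟨1, Or.inl rfl, by linarith⟩
      · exact ⟨-1, Or.inr rfl, by linarith⟩
    refine (isEigenvalue_iff_mem_spec hB (rot_ne_zero θ) hoff.2).trans ⟨fun h => ?_, fun h => ?_⟩
    · exact isEigenvalue_of_mem_hamSpec hC g hs hoff hsθ h
    · exact mem_hamSpec_of_isEigenvalue hC g hs hoff hsθ h

end DilationAnalytic

end

theorem mainTheorem4 (C : ℝ) (hC : 0 < C) :
    RadialConditions (VP C) (Real.pi / 2) ∧
    ClassC (Real.pi / 2) (mulOp (fun x : R3 => (VP C ‖x‖ : ℂ))) ∧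
    ∀ W : ℂ → H2 →L[ℂ] L2,
      IsContinuation (mulOp (fun x : R3 => (VP C ‖x‖ : ℂ))) (Real.pi / 2) W →
      ∀ g : ℝ, ∀ θ : ℂ, |θ.im| < Real.pi / 2 →
        -- the spectrum: the rotated half-line and isolated eigenvalues of finite multiplicity
        (rotatedRay θ ⊆ spec (dilatedHamiltonian W g θ) ∧
          ∀ z ∈ spec (dilatedHamiltonian W g θ), z ∉ rotatedRay θ →
            IsDiscreteEigenvalue (dilatedHamiltonian W g θ) z) ∧
        -- real eigenvalues and the threshold `0`
        {E : ℝ | IsEigenvalue (dilatedHamiltonian W g θ) (E : ℂ)} ∪ {0} =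
          {E : ℝ | IsEigenvalue (dilatedHamiltonian W g 0) (E : ℂ)} ∪ {0} ∧
        -- non-real points of the discrete spectrum
        (0 < θ.im → ∀ z ∈ spec (dilatedHamiltonian W g θ), z.im ≠ 0 → z ∉ rotatedRay θ →
          -2 * θ.im < z.arg ∧ z.arg < 0) ∧
        -- stability in `θ` of the discrete spectrum
        (∀ z ∈ spec (dilatedHamiltonian W g θ), z ∉ rotatedRay θ →
          ∃ δ : ℝ, 0 < δ ∧ ∀ θ' : ℂ, |θ'.im| < Real.pi / 2 → |θ'.im - θ.im| < δ →
            z ∈ spec (dilatedHamiltonian W g θ')) := by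
  refine ⟨radialConditions_VP hC, classC_mulOp hC, fun W hW g θ hθ => ?_⟩
  have hθ : θ ∈ strip := hθ
  have hB := relCompact_coupled hC g hθ
  rw [dilatedHamiltonian_eq hC hW g hθ, dilatedHamiltonian_eq hC hW g zero_mem_strip]
  simp only [mem_rotatedRay_iff]
  refine ⟨⟨?_, fun z hz hoff => ?_⟩, ?_, fun hpos z hz hzim hoff => ?_, fun z hz hoff => ?_⟩
  · rintro _ ⟨x, hx, rfl⟩
    exact smul_posRay_subset_spec hB (rot_ne_zero θ) hx
  · exact isDiscreteEigenvalue_of_mem_spec hB (rot_ne_zero θ) hoff hz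
  · ext E
    -- The threshold has been added to both sides, so eigenvalues at `0` need not be compared.
    by_cases hE : E = 0
    · simp [hE]
    · simpa [hE] using isEigenvalue_ham_iff hC g hE hθ
  · exact arg_mem_of_mem_hamSpec hC hθ hpos hz hzim hoff
  · obtain ⟨δ, hδ, h⟩ := exists_stability hC g (θ := θ) (z := z) ⟨hθ, hoff⟩
    refine ⟨δ, hδ, fun θ' hθ' hd => ?_⟩
    rw [dilatedHamiltonian_eq hC hW g hθ']
    exact (h θ' hθ' hd).2 hz
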